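/- \textbf{Setting.} Let $\omega>0$ and let $\varepsilon,\mu,\sigma:\mathbb R^3\to\mathbb R$ be Lipschitz with $\varepsilon>0$, $\mu>0$, $\sigma\ge 0$, such that outside some ball $\varepsilon=\varepsilon_o$, $\mu=\mu_o$, $\sigma=0$ for constants $\varepsilon_o,\mu_o$. Call such data a \emph{medium} and put (with principal branches) \[\gamma=\varepsilon+\tfrac{i\sigma}{\omega},\quad k=\omega(\varepsilon_o\mu_o)^{1/2},\quad \alpha=\nabla\log\gamma,\quad \beta=\nabla\log\mu,\quad \kappa=\omega(\mu\gamma)^{1/2},\quad \theta=\omega^2(\gamma\mu-\varepsilon_o\mu_o).\] Products $a\cdot b=\sum_j a_jb_j$ of complex vectors are bilinear. Write 8-vectors as $w=(w_1,w_2,w_3,w_4)$ with scalars $w_1,w_4$ and 3-vectors $w_2,w_3$. For $w,\varphi\in\mathcal S(\mathbb R^3)^8$ the weak potential $Q$ is \begin{align*} \langle Qw,\varphi\rangle=\int\Big(&\tfrac14(\alpha\cdot\alpha-4\theta)[w_1\varphi_1+w_3\cdot\varphi_3]-\tfrac12\alpha\cdot[\nabla(w_1\varphi_1-w_3\cdot\varphi_3)+\nabla\cdot(w_3\varphi_3^T+\varphi_3w_3^T)]\\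 &+\tfrac14(\beta\cdot\beta-4\theta)[w_4\varphi_4+w_2\cdot\varphi_2]-\tfrac12\beta\cdot[\nabla(w_4\varphi_4-w_2\cdot\varphi_2)+\nabla\cdot(w_2\varphi_2^T+\varphi_2w_2^T)]\\ &-2i\kappa\,\nabla\cdot(w_1\varphi_2+w_2\varphi_1+w_3\varphi_4+w_4\varphi_3)\Big)\,dx, \end{align*} and the weak potential $\tilde Q$ is \begin{align*} \langle\tilde Qw,\varphi\rangle=\int\Big(&\tfrac14(\beta\cdot\beta-4\theta)[w_1\varphi_1+w_3\cdot\varphi_3]+\tfrac12\beta\cdot[\nabla(w_1\varphi_1-w_3\cdot\varphi_3)+\nabla\cdot(w_3\varphi_3^T+\varphi_3w_3^T)]\\ &+\tfrac14(\alpha\cdot\alpha-4\theta)[w_4\varphi_4+w_2\cdot\varphi_2]+\tfrac12\alpha\cdot[\nabla(w_4\varphi_4-w_2\cdot\varphi_2)+\nabla\cdot(w_2\varphi_2^T+\varphi_2w_2^T)]\\ &+2i\kappa\,\nabla\cdot(w_3\wedge\varphi_2-w_2\wedge\varphi_3)\Big)\,dx. \end{align*} For $\zeta\in\mathbb C^3$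 let $p_\zeta(\xi)=|\xi|^2-2i\zeta\cdot\xi$, and for $b\in\mathbb R$ let \[\|f\|_{X^b_\zeta}=\Big(\sum_{j=1}^8\big\|(|\zeta|+|p_\zeta|)^b\hat f_j\big\|_{L^2(\mathbb R^3)}^2\Big)^{1/2},\] where $\hat f$ is the distributional Fourier transform extending $\hat f(\xi)=\int e^{ix\cdot\xi}f(x)\,dx$ (so that $p_\zeta$ is the symbol of $-\Delta+2\zeta\cdot\nabla$); the norm is $\infty$ if $\hat f$ is not a function with finite weighted norm, and $f\in X^b_\zeta$ means that it is finite. \textbf{Proposition.} There is an absolute constant $C>0$ such that for all $A>1$ and $R>0$ there is a constant $K$, depending only on $A$ and $R$, with the following property. For every medium with $\|\alpha\|_{L^\infty(\mathbb R^3)}<A$ and $\|\beta\|_{L^\infty(\mathbb R^3)}<A$ there is a number $Z_0$ (which may depend on $A$, $R$ and the medium) such that, whenever $\zeta\in\mathbb C^3$ and $\tau\in\mathbb R$ satisfy \[\mathrm{Re}\,\zeta\perp\mathrm{Im}\,\zeta,\qquad |\mathrm{Re}\,\zeta|^2=\tau^2=|\mathrm{Im}\,\zeta|^2-k^2,\qquad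 \tau>CR^3A^4,\qquad |\zeta|\ge Z_0,\] every $u\in\mathcal S(\mathbb R^3)^8$ with $\operatorname{supp}u\subset\{|x|<R\}$ satisfies $(-\Delta+2\zeta\cdot\nabla+Q)u\in X^{-1/2}_\zeta$ and \[\|u\|_{X^{1/2}_\zeta}\le K\,\|(-\Delta+2\zeta\cdot\nabla+Q)u\|_{X^{-1/2}_\zeta},\] and the same holds with $\tilde Q$ in place of $Q$. -/

import Mathlib

open MeasureTheory SchwartzMap FourierTransform
open scoped NNReal ENNReal

namespace Maxwell

noncomputable section

/-- Physical space. -/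
abbrev R3 := EuclideanSpace ℝ (Fin 3)

/-- Complex 3-vectors; `‖·‖` is the Hermitian norm. -/
abbrev C3 := EuclideanSpace ℂ (Fin 3)

/-- Electromagnetic parameters on the whole space: a frequency `ω > 0`, and Lipschitz functions
`ε > 0`, `μ > 0`, `σ ≥ 0` which equal the constants `ε₀`, `μ₀` and `0` outside some ball. -/
structure Medium where
  ω : ℝ
  ε₀ : ℝ
  μ₀ : ℝ
  ε : R3 → ℝ
  μ : R3 → ℝ
  σ : R3 → ℝ
  ω_pos : 0 < ω
  ε_lip : ∃ c : ℝ≥0, LipschitzWith c ε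
  μ_lip : ∃ c : ℝ≥0, LipschitzWith c μ
  σ_lip : ∃ c : ℝ≥0, LipschitzWith c σ
  ε_pos : ∀ x, 0 < ε x
  μ_pos : ∀ x, 0 < μ x
  σ_nonneg : ∀ x, 0 ≤ σ x
  const_outside : ∃ r : ℝ, ∀ x, r ≤ ‖x‖ → ε x = ε₀ ∧ μ x = μ₀ ∧ σ x = 0

/-- The partial derivative `∂ᵢ f`. -/
def pd (i : Fin 3) (f : R3 → ℂ) (x : R3) : ℂ :=
  fderiv ℝ f x (EuclideanSpace.single i 1)

/-- `∇ log f` for functions with values in the open right half-plane (principal logarithm). For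
Lipschitz `f` the classical derivative exists almost everywhere and is the weak derivative. -/
def gradLog (f : R3 → ℂ) (x : R3) : C3 :=
  WithLp.toLp 2 fun i => pd i (fun y => Complex.log (f y)) x

/-- The bilinear (not sesquilinear) dot product of complex vectors. -/
def dot (a b : Fin 3 → ℂ) : ℂ := ∑ i, a i * b i

namespace Medium

variable (m : Medium)

/-- `γ = ε + i σ / ω`. -/
def γ (x : R3) : ℂ := (m.ε x : ℂ) + Complex.I * (m.σ x : ℂ) / (m.ω : ℂ)

/-- `k = ω (ε₀ μ₀)^{1/2}`. -/
def k : ℝ := m.ω * Real.sqrt (m.ε₀ * m.μ₀)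

/-- `α = ∇ log γ`. -/
def α : R3 → C3 := gradLog m.γ

/-- `β = ∇ log μ`. -/
def β : R3 → C3 := gradLog fun x => (m.μ x : ℂ)

/-- `κ = ω (μ γ)^{1/2}`, principal branch. -/
def κ (x : R3) : ℂ := (m.ω : ℂ) * ((m.μ x : ℂ) * m.γ x) ^ (1 / 2 : ℂ)

/-- `θ = ω² (γ μ - ε₀ μ₀)`. -/
def θ (x : R3) : ℂ := (m.ω : ℂ) ^ 2 * (m.γ x * (m.μ x : ℂ) - (m.ε₀ : ℂ) * (m.μ₀ : ℂ))

end Medium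

/-- Schwartz 8-vectors. Writing `w = (w₁, w₂, w₃, w₄)` with scalars `w₁, w₄` and 3-vectors
`w₂, w₃`, the components are numbered `w₁ = w 0`, `w₂ = (w 1, w 2, w 3)`,
`w₃ = (w 4, w 5, w 6)`, `w₄ = w 7`. -/
abbrev Schwartz8 := Fin 8 → 𝓢(R3, ℂ)

def part1 (w : Schwartz8) (x : R3) : ℂ := w 0 x
def part2 (w : Schwartz8) (x : R3) : Fin 3 → ℂ := ![w 1 x, w 2 x, w 3 x]
def part3 (w : Schwartz8) (x : R3) : Fin 3 → ℂ := ![w 4 x, w 5 x, w 6 x]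
def part4 (w : Schwartz8) (x : R3) : ℂ := w 7 x

/-- The gradient of a scalar function. -/
def grad (f : R3 → ℂ) (x : R3) : Fin 3 → ℂ := fun i => pd i f x

/-- The divergence of a vector field. -/
def div (F : R3 → Fin 3 → ℂ) (x : R3) : ℂ := ∑ i, pd i (fun y => F y i) x

/-- The (row-wise) divergence of a matrix field. -/
def divMat (F : R3 → Matrix (Fin 3) (Fin 3) ℂ) (x : R3) : Fin 3 → ℂ :=
  fun i => ∑ j, pd j (fun y => F y i j) x

/-- The matrix field `a bᵀ + b aᵀ`. -/
def symProd (a b : R3 → Fin 3 → ℂ) (x : R3) : Matrix (Fin 3) (Fin 3) ℂ :=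
  Matrix.vecMulVec (a x) (b x) + Matrix.vecMulVec (b x) (a x)

/-- Functionals on Schwartz 8-vectors; `Λ φ` is the bilinear pairing `⟨Λ, φ⟩`. -/
abbrev Functional8 := Schwartz8 → ℂ

/-- The weak potential `Q`, as the bilinear pairing `⟨Q w, φ⟩`. -/
def weakQ (m : Medium) (w : Schwartz8) : Functional8 := fun φ =>
  ∫ x : R3,
    ((1 / 4 : ℂ) * (dot (m.α x) (m.α x) - 4 * m.θ x)
        * (part1 w x * part1 φ x + dot (part3 w x) (part3 φ x))
      - (1 / 2 : ℂ) * dot (m.α x)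
        (grad (fun y => part1 w y * part1 φ y - dot (part3 w y) (part3 φ y)) x
          + divMat (symProd (part3 w) (part3 φ)) x)
      + (1 / 4 : ℂ) * (dot (m.β x) (m.β x) - 4 * m.θ x)
        * (part4 w x * part4 φ x + dot (part2 w x) (part2 φ x))
      - (1 / 2 : ℂ) * dot (m.β x)
        (grad (fun y => part4 w y * part4 φ y - dot (part2 w y) (part2 φ y)) x
          + divMat (symProd (part2 w) (part2 φ)) x)
      - 2 * Complex.I * m.κ x
        * div (fun y => part1 w y • part2 φ y + part1 φ y • part2 w y
            + part4 φ y • part3 w y + part4 w y • part3 φ y) x)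

/-- The weak potential `Q̃`, as the bilinear pairing `⟨Q̃ w, φ⟩`. -/
def weakQtilde (m : Medium) (w : Schwartz8) : Functional8 := fun φ =>
  ∫ x : R3,
    ((1 / 4 : ℂ) * (dot (m.β x) (m.β x) - 4 * m.θ x)
        * (part1 w x * part1 φ x + dot (part3 w x) (part3 φ x))
      + (1 / 2 : ℂ) * dot (m.β x)
        (grad (fun y => part1 w y * part1 φ y - dot (part3 w y) (part3 φ y)) x
          + divMat (symProd (part3 w) (part3 φ)) x)
      + (1 / 4 : ℂ) * (dot (m.α x) (m.α x) - 4 * m.θ x)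
        * (part4 w x * part4 φ x + dot (part2 w x) (part2 φ x))
      + (1 / 2 : ℂ) * dot (m.α x)
        (grad (fun y => part4 w y * part4 φ y - dot (part2 w y) (part2 φ y)) x
          + divMat (symProd (part2 w) (part2 φ)) x)
      + 2 * Complex.I * m.κ x
        * div (fun y => crossProduct (part3 w y) (part2 φ y)
            - crossProduct (part2 w y) (part3 φ y)) x)

/-- The functional represented by a Schwartz 8-vector, `φ ↦ ∫ u · φ`. -/
def ofSchwartz (u : Schwartz8) : Functional8 := fun φ => ∑ j, ∫ x : R3, u j x * φ j x

/-- `⟨(-Δ + 2 ζ·∇) u, φ⟩`. -/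
def freeOp (ζ : C3) (u : Schwartz8) : Functional8 := fun φ =>
  ∑ j, ∫ x : R3, (-(∑ i, pd i (pd i (u j)) x) + 2 * ∑ i, ζ i * pd i (u j) x) * φ j x

/-- The Fourier transform `φ̂(ξ) = ∫ e^{i x·ξ} φ(x) dx` of a Schwartz function, as a Schwartz
function (see `ft_apply`). With this sign, `∇` corresponds to `-iξ`. -/
def ft (φ : 𝓢(R3, ℂ)) : 𝓢(R3, ℂ) :=
  compCLMOfContinuousLinearEquiv ℂ
    (ContinuousLinearEquiv.smulLeft
      (Units.mk0 ((2 * Real.pi)⁻¹ : ℝ) (inv_ne_zero (by positivity))) : R3 ≃L[ℝ] R3) (𝓕⁻ φ)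

theorem ft_apply (φ : 𝓢(R3, ℂ)) (ξ : R3) :
    ft φ ξ = ∫ x : R3, Complex.exp (Complex.I * (inner ℝ x ξ : ℝ)) * φ x := by
  have h : ft φ ξ = (𝓕⁻ φ) ((2 * Real.pi)⁻¹ • ξ) := rfl
  rw [h, fourierInv_coe, Real.fourierInv_eq']
  refine integral_congr_ae (Filter.Eventually.of_forall fun x => ?_)
  have hpi : (Real.pi : ℂ) ≠ 0 := by exact_mod_cast Real.pi_ne_zero
  simp only [inner_smul_right, smul_eq_mul]
  congr 2
  push_cast
  field_simp

/-- The Fourier transform of the functional `Λ` is the vector `g` of functions: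
`Λ(φ̂) = ∫ g · φ` for all Schwartz 8-vectors `φ`, the integrals being absolutely convergent. -/
structure HasFourierTransform (Λ : Functional8) (g : Fin 8 → R3 → ℂ) : Prop where
  locallyIntegrable : ∀ j, LocallyIntegrable (g j) volume
  integrable : ∀ j (φ : 𝓢(R3, ℂ)), Integrable (fun ξ => g j ξ * φ ξ) volume
  pairing : ∀ φ : Schwartz8, Λ (fun j => ft (φ j)) = ∑ j, ∫ ξ : R3, g j ξ * φ j ξ

/-- `p_ζ(ξ) = |ξ|² - 2 i ζ·ξ`. -/
def p (ζ : C3) (ξ : R3) : ℂ := (‖ξ‖ : ℂ) ^ 2 - 2 * Complex.I * ∑ i, ζ i * (ξ i : ℂ)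

/-- The weight `(|ζ| + |p_ζ(ξ)|)^b`. -/
def weight (ζ : C3) (b : ℝ) (ξ : R3) : ℝ := (‖ζ‖ + ‖p ζ ξ‖) ^ b

/-- The `X^b_ζ` norm, with values in `[0, ∞]`: it is `∞` unless the Fourier transform of `Λ` is a
vector of functions (which is then unique almost everywhere) with finite weighted `L²` norm. -/
def xNorm (ζ : C3) (b : ℝ) (Λ : Functional8) : ℝ≥0∞ :=
  ⨅ (g : Fin 8 → R3 → ℂ) (_ : HasFourierTransform Λ g),
    (∑ j, eLpNorm (fun ξ => (weight ζ b ξ : ℂ) * g j ξ) 2 volume ^ 2) ^ (1 / 2 : ℝ)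

/-- The real part of a complex vector. -/
def reVec (ζ : C3) : R3 := WithLp.toLp 2 fun i => (ζ i).re

/-- The imaginary part of a complex vector. -/
def imVec (ζ : C3) : R3 := WithLp.toLp 2 fun i => (ζ i).im

end

end Maxwell

/-! Write ζ = τe + ib with e a unit vector and b ⟂ e, and put s = x·e. Then -Δ + 2ζ·∇ = S + τ² -
(∂_e - τ)², where S is symmetric and commutes with ∂_e and with multiplication by s. Conjugation by
the convexifying factor G = exp(M s²/2) replaces ∂_e - τ by Y = ∂_e - (τ + M s). The commutator of
the conjugated operator P with its adjoint then has a sign, and ‖P w‖² exceeds ‖P* w‖² by 8M(‖∂_e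
w‖² + ‖(τ + M s) w‖²) (`carleman_abstract`). The usual L² bound of τ‖w‖ thus improves by a factor
√M. This gain, and not smallness of the potential, absorbs the first-order terms, which have size A.

The estimate is wanted from X^{-1/2} to X^{1/2}, so it is applied to w = T ft(Gu) with T = q^{-1/4},
q = 1 + |p_ζ/(Kτ)|². Along e the symbol satisfies |∂_e p_ζ| ≤ 22 τ q^{1/2}. Hence commuting s past T
costs only a factor 11/K, which is absorbed once K is large compared with M (`abs_dT_le`,
`commutator_bounds`, `carleman_absorb`). The same slow variation bounds multiplication by Schwartz
functions of s in the weighted spaces, uniformly in ζ, since such a multiplication is a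
superposition of frequency translations along e (`norm_alongDir_le`). On the ball of radius R the
functions s, s² and exp(±M s²/2) may be replaced by such Schwartz functions.

The potential is a bilinear form in the products w_a φ_b and their first derivatives.
Multiplications therefore pass from one argument to the other, and conjugation by G does not change
it. The terms with α and β cost A times one derivative, and a derivative costs 10 τ q^{1/4}. The
term with κ loses its derivative by integration by parts, because κ is Lipschitz. Together with θ,
α·α and β·β it has order zero, with a constant c that may depend on the medium. Pairing the equation
with the function whose transform is T² ft(G(-Δ + 2ζ·∇)u) (`norm_source_le`) leaves the error 3(60aτ
+ c)Q against √M τ Q, where a = 30A and Q = ‖q^{1/4} ft(Gu)‖. The choice √M = 180a + 4 and τ ≥ 3c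
closes the estimate.

Thus M, K and the final constant depend on A and R alone. The medium enters only through the
thresholds for τ, that is through Z₀. Duality with the majorant √(2Kτ) q^{1/4} of the weight gives
the inequality of norms (`xNorm_le_of_dual`). Finiteness of the right side follows by Riesz
representation, because the functional is bounded by the H¹ norm of the test function
(`xNorm_lt_top`). -/

namespace Maxwell

noncomputable section

open LineDeriv
open scoped ContDiff

/-! ### The Carleman identity for abstract operators -/

section AbstractCarleman

variable {V H : Type*} [AddCommGroup V] [Module ℂ V] [NormedAddCommGroup H] [InnerProductSpace ℂ H]

/-- Two operators on a space embedded in a Hilbert space are formally adjoint to each other. -/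
def FormalAdjoint (ι : V →ₗ[ℂ] H) (A B : Module.End ℂ V) : Prop :=
  ∀ v w, inner ℂ (ι (A v)) (ι w) = inner ℂ (ι v) (ι (B w))

theorem FormalAdjoint.mul {ι : V →ₗ[ℂ] H} {A B A' B' : Module.End ℂ V}
    (h : FormalAdjoint ι A B) (h' : FormalAdjoint ι A' B') :
    FormalAdjoint ι (A * A') (B' * B) := fun v w => by
  rw [Module.End.mul_apply, h, h', Module.End.mul_apply]

theorem FormalAdjoint.sub {ι : V →ₗ[ℂ] H} {A B A' B' : Module.End ℂ V}
    (h : FormalAdjoint ι A B) (h' : FormalAdjoint ι A' B') :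
    FormalAdjoint ι (A - A') (B - B') := fun v w => by
  simp only [LinearMap.sub_apply, map_sub, inner_sub_left, inner_sub_right, h v w, h' v w]

theorem FormalAdjoint.add {ι : V →ₗ[ℂ] H} {A B A' B' : Module.End ℂ V}
    (h : FormalAdjoint ι A B) (h' : FormalAdjoint ι A' B') :
    FormalAdjoint ι (A + A') (B + B') := fun v w => by
  simp only [LinearMap.add_apply, map_add, inner_add_left, inner_add_right, h v w, h' v w]

theorem FormalAdjoint.real_smul {ι : V →ₗ[ℂ] H} {A B : Module.End ℂ V}
    (h : FormalAdjoint ι A B) (c : ℝ) : FormalAdjoint ι ((c : ℂ) • A) ((c : ℂ) • B) := fun v w => by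
  simp only [LinearMap.smul_apply, map_smul, inner_smul_left, inner_smul_right, h v w,
    Complex.conj_ofReal]

theorem FormalAdjoint.one (ι : V →ₗ[ℂ] H) : FormalAdjoint ι 1 1 := fun _ _ => rfl

theorem FormalAdjoint.symm {ι : V →ₗ[ℂ] H} {A B : Module.End ℂ V}
    (h : FormalAdjoint ι A B) : FormalAdjoint ι B A := fun v w => by
  rw [← inner_conj_symm, ← h w v, inner_conj_symm]

/-- If `[Z, Y] = c` is a scalar, then `[Z², Y²] = 2c (ZY + YZ)`. -/
theorem sq_commutator {Y Z : Module.End ℂ V} {c : ℂ} (h : Z * Y = Y * Z + c • 1) :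
    Z * Z * (Y * Y) = Y * Y * (Z * Z) + (2 * c) • (Z * Y + Y * Z) := by
  have h1 : Z * (Y * Y) = Y * Y * Z + (2 * c) • Y := by
    rw [← mul_assoc, h, add_mul, mul_assoc, h, mul_add]
    simp only [smul_mul_assoc, one_mul, mul_smul_comm, mul_one, two_mul, add_smul, mul_assoc]
    abel
  calc Z * Z * (Y * Y) = Z * (Z * (Y * Y)) := mul_assoc _ _ _
    _ = Z * (Y * Y) * Z + (2 * c) • (Z * Y) := by
        rw [h1, mul_add, mul_smul_comm, ← mul_assoc, h1]
    _ = _ := by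
        rw [h1, add_mul, smul_mul_assoc, smul_add, mul_assoc (Y * Y)]; abel

/-- The Carleman identity, as an inequality: the convexified conjugated Laplacian
`S - (D - Φ)²`, `Φ = τ + M X`, gains `8 M (‖D w‖² + ‖Φ w‖²)`. -/
theorem carleman_abstract (ι : V →ₗ[ℂ] H) {D X S : Module.End ℂ V} (τ M : ℝ)
    (hD : FormalAdjoint ι D (-D)) (hX : FormalAdjoint ι X X) (hS : FormalAdjoint ι S S)
    (hDX : D * X = X * D + 1) (hSD : S * D = D * S) (hSX : S * X = X * S) (w : V) :
    8 * M * (‖ι (D w)‖ ^ 2 + ‖ι ((τ : ℂ) • w + (M : ℂ) • X w)‖ ^ 2) ≤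
      ‖ι (S w - D (D w) + (2 * τ : ℂ) • D w + (2 * M : ℂ) • D (X w) - (M : ℂ) • w
        - (M ^ 2 : ℂ) • X (X w) - (2 * τ * M : ℂ) • X w)‖ ^ 2 := by
  set Φ : Module.End ℂ V := (τ : ℂ) • 1 + (M : ℂ) • X with hΦ
  set Y := D - Φ with hY
  set Z := D + Φ with hZ
  -- The shift by τ² completes the square: the operator on the right of the claim is S' - (D - Φ)².
  set S' : Module.End ℂ V := S + ((τ ^ 2 : ℝ) : ℂ) • 1 with hS'
  set P := S' - Y * Y with hP
  set Q := S' - Z * Z with hQ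
  have aΦ : FormalAdjoint ι Φ Φ := ((FormalAdjoint.one ι).real_smul τ).add (hX.real_smul M)
  have aY : FormalAdjoint ι Y (-Z) := by
    have := hD.sub aΦ
    rwa [show -D - Φ = -Z by rw [hZ]; abel] at this
  have aS' : FormalAdjoint ι S' S' := hS.add ((FormalAdjoint.one ι).real_smul _)
  -- Y and -Z are adjoint, and (-Z)² = Z², so Q is the adjoint of P.
  have aP : FormalAdjoint ι P Q := by
    have := aS'.sub (aY.mul aY)
    rwa [neg_mul_neg] at this
  have hDΦ : D * Φ = Φ * D + (M : ℂ) • 1 := by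
    rw [hΦ, mul_add, add_mul, mul_smul_comm, mul_smul_comm, hDX, smul_add, smul_mul_assoc,
      smul_mul_assoc, one_mul, mul_one]; abel
  have hZY : Z * Y = Y * Z + (-2 * M : ℂ) • 1 := by
    have : Z * Y = D * D - Φ * Φ - (D * Φ - Φ * D) := by rw [hZ, hY]; noncomm_ring
    rw [this]
    have : Y * Z = D * D - Φ * Φ + (D * Φ - Φ * D) := by rw [hZ, hY]; noncomm_ring
    rw [this, hDΦ]
    rw [show (-2 * M : ℂ) = -(M : ℂ) - M by ring, sub_smul, neg_smul]; abel
  have hSΦ : S * Φ = Φ * S := by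
    rw [hΦ, mul_add, add_mul, mul_smul_comm, mul_smul_comm, hSX, smul_mul_assoc, smul_mul_assoc,
      one_mul, mul_one]
  have hS'D : S' * D = D * S' := by
    rw [hS', add_mul, mul_add, hSD, smul_mul_assoc, mul_smul_comm, one_mul, mul_one]
  have hS'Φ : S' * Φ = Φ * S' := by
    rw [hS', add_mul S, mul_add Φ S, hSΦ, smul_mul_assoc, mul_smul_comm, one_mul, mul_one]
  have hS'Y : S' * Y = Y * S' := by rw [hY, mul_sub, sub_mul, hS'D, hS'Φ]
  have hS'Z : S' * Z = Z * S' := by rw [hZ, mul_add S', add_mul D, hS'D, hS'Φ]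
  have hS'YY : S' * (Y * Y) = Y * Y * S' := by
    rw [← mul_assoc, hS'Y, mul_assoc, hS'Y, mul_assoc]
  have hS'ZZ : S' * (Z * Z) = Z * Z * S' := by
    rw [← mul_assoc, hS'Z, mul_assoc, hS'Z, mul_assoc]
  -- Since S' commutes with Y and Z, only [Z², Y²] survives, and [Z, Y] = -2M. Each of (-Z)Y and
  -- Y(-Z) has the form A*A, so for M ≥ 0 the commutator is nonnegative.
  have hcomm : Q * P = P * Q + (4 * M : ℂ) • ((-Z) * Y + Y * (-Z)) := by
    have e1 : Q * P = S' * S' - S' * (Y * Y) - Z * Z * S' + Z * Z * (Y * Y) := by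
      rw [hQ, hP]; noncomm_ring
    have e2 : P * Q = S' * S' - S' * (Z * Z) - Y * Y * S' + Y * Y * (Z * Z) := by
      rw [hQ, hP]; noncomm_ring
    rw [e1, e2, sq_commutator hZY, hS'YY, hS'ZZ, show (2 * (-2 * M : ℂ)) = -(4 * M) by ring,
      neg_mul, mul_neg, neg_smul, smul_add, smul_add, smul_neg, smul_neg]
    abel
  have hn : ∀ {A B : Module.End ℂ V}, FormalAdjoint ι A B → ∀ v : V,
      ((‖ι (A v)‖ ^ 2 : ℝ) : ℂ) = inner ℂ (ι v) (ι ((B * A) v)) := fun h v => by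
    rw [Module.End.mul_apply, ← h, inner_self_eq_norm_sq_to_K]; norm_cast
  have key : ‖ι (P w)‖ ^ 2 = ‖ι (Q w)‖ ^ 2 + 4 * M * (‖ι (Y w)‖ ^ 2 + ‖ι (Z w)‖ ^ 2) := by
    have hZ2 : ((‖ι (Z w)‖ ^ 2 : ℝ) : ℂ) = inner ℂ (ι w) (ι ((Y * (-Z)) w)) := by
      have := hn aY.symm w
      simpa using this
    have : ((‖ι (P w)‖ ^ 2 : ℝ) : ℂ)
        = ((‖ι (Q w)‖ ^ 2 + 4 * M * (‖ι (Y w)‖ ^ 2 + ‖ι (Z w)‖ ^ 2) : ℝ) : ℂ) := by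
      rw [hn aP w, hcomm]
      push_cast
      have h1 := hn aP.symm w
      have h2 := hn aY w
      push_cast at h1 h2 hZ2
      rw [h1, h2, hZ2]
      simp only [LinearMap.add_apply, LinearMap.smul_apply, map_add, map_smul, inner_add_right,
        inner_smul_right]
    exact_mod_cast this
  have hpar : ‖ι (Y w)‖ ^ 2 + ‖ι (Z w)‖ ^ 2 = 2 * (‖ι (D w)‖ ^ 2 + ‖ι (Φ w)‖ ^ 2) := by
    have := parallelogram_law_with_norm ℂ (ι (D w)) (ι (Φ w))
    simp only [hY, hZ, LinearMap.sub_apply, LinearMap.add_apply, map_sub, map_add]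
    nlinarith [this]
  have hPw : P w = S w - D (D w) + (2 * τ : ℂ) • D w + (2 * M : ℂ) • D (X w) - (M : ℂ) • w
        - (M ^ 2 : ℂ) • X (X w) - (2 * τ * M : ℂ) • X w := by
    have hDXw : X (D w) = D (X w) - w := by
      have := congrArg (fun f : Module.End ℂ V => f w) hDX
      simp only [Module.End.mul_apply, LinearMap.add_apply, Module.End.one_apply] at this
      rw [this]; abel
    simp only [hP, hS', hY, hΦ, LinearMap.sub_apply, LinearMap.add_apply, Module.End.mul_apply,
      LinearMap.smul_apply, Module.End.one_apply, map_sub, map_add, map_smul, hDXw]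
    push_cast
    module
  have hΦw : Φ w = (τ : ℂ) • w + (M : ℂ) • X w := by
    simp [hΦ]
  rw [← hPw, ← hΦw, key, hpar]
  nlinarith [sq_nonneg ‖ι (Q w)‖]

end AbstractCarleman

/-! ### Operators on Schwartz 8-vectors and their `L²` norm -/

/-- The Hilbert space `L²(ℝ³)⁸`. -/
abbrev L2Vec := PiLp 2 fun _ : Fin 8 => Lp ℂ 2 (volume : Measure R3)

/-- The inclusion of Schwartz 8-vectors into `L²(ℝ³)⁸`. -/
def emb : Schwartz8 →ₗ[ℂ] L2Vec where
  toFun w := WithLp.toLp 2 fun j => (w j).toLp 2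
  map_add' _ _ := rfl
  map_smul' _ _ := rfl

theorem emb_apply (w : Schwartz8) (j : Fin 8) : emb w j = (w j).toLp 2 := rfl

theorem inner_emb (v w : Schwartz8) :
    inner ℂ (emb v) (emb w) = ∑ j, ∫ x, w j x * starRingEnd ℂ (v j x) := by
  simp only [PiLp.inner_apply, emb_apply, inner_toL2_toL2_eq, RCLike.inner_apply]

/-- A scalar operator acting on each of the eight components. -/
def diag (L : 𝓢(R3, ℂ) →ₗ[ℂ] 𝓢(R3, ℂ)) : Module.End ℂ Schwartz8 :=
  LinearMap.pi fun j => L ∘ₗ LinearMap.proj j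

@[simp] theorem diag_apply (L : 𝓢(R3, ℂ) →ₗ[ℂ] 𝓢(R3, ℂ)) (w : Schwartz8) (j : Fin 8) :
    diag L w j = L (w j) := rfl

/-- Multiplication by a function of temperate growth. -/
def mulOp (m : R3 → ℂ) : Module.End ℂ Schwartz8 := diag (smulLeftCLM ℂ m).toLinearMap

theorem mulOp_apply {m : R3 → ℂ} (hm : m.HasTemperateGrowth) (w : Schwartz8) (j : Fin 8) (x : R3) :
    mulOp m w j x = m x * w j x := by
  simp [mulOp, hm]

/-- The derivative in the direction `e`. -/
def dirOp (e : R3) : Module.End ℂ Schwartz8 := diag (lineDerivOpCLM ℂ 𝓢(R3, ℂ) e).toLinearMap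

theorem dirOp_apply (e : R3) (w : Schwartz8) (j : Fin 8) : dirOp e w j = ∂_{e} (w j) := rfl

theorem dirOp_apply_apply (e : R3) (w : Schwartz8) (j : Fin 8) (x : R3) :
    dirOp e w j x = fderiv ℝ (w j) x e := rfl

theorem mulOp_formalAdjoint {m m' : R3 → ℂ} (hm : m.HasTemperateGrowth)
    (hm' : m'.HasTemperateGrowth) (h : ∀ x, starRingEnd ℂ (m x) = m' x) :
    FormalAdjoint emb (mulOp m) (mulOp m') := fun v w => by
  simp only [inner_emb, mulOp_apply hm, mulOp_apply hm', map_mul, h]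
  refine Finset.sum_congr rfl fun j _ => integral_congr_ae (.of_forall fun x => ?_)
  ring

theorem fderiv_conj (f : 𝓢(R3, ℂ)) (x e : R3) :
    fderiv ℝ (fun y => starRingEnd ℂ (f y)) x e = starRingEnd ℂ (fderiv ℝ f x e) := by
  have := (Complex.conjCLE.toContinuousLinearMap.hasFDerivAt.comp x (f.hasFDerivAt x)).fderiv
  have h2 : (fun y => starRingEnd ℂ (f y)) = Complex.conjCLE.toContinuousLinearMap ∘ f := rfl
  rw [h2, this]; rfl

/-- The complex conjugate of a Schwartz function. -/
def conjS (f : 𝓢(R3, ℂ)) : 𝓢(R3, ℂ) :=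
  f.postcompCLM (𝕜 := ℝ) Complex.conjCLE.toContinuousLinearMap

@[simp] theorem conjS_apply (f : 𝓢(R3, ℂ)) (x : R3) : conjS f x = starRingEnd ℂ (f x) := rfl

theorem lineDeriv_conjS (f : 𝓢(R3, ℂ)) (e x : R3) :
    ∂_{e} (conjS f) x = starRingEnd ℂ (∂_{e} f x) := fderiv_conj f x e

theorem dirOp_formalAdjoint (e : R3) : FormalAdjoint emb (dirOp e) (-dirOp e) := fun v w => by
  simp only [inner_emb, LinearMap.neg_apply, Pi.neg_apply, dirOp_apply, neg_apply]
  refine Finset.sum_congr rfl fun j _ => ?_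
  have := integral_mul_lineDerivOp_right_eq_neg_left (μ := volume) (w j) (conjS (v j)) e
  simp only [lineDeriv_conjS, conjS_apply] at this
  rw [this, ← integral_neg]
  simp

theorem dirOp_mulOp {m m' : R3 → ℂ} (hm : m.HasTemperateGrowth) (hm' : m'.HasTemperateGrowth)
    {e : R3} (h : ∀ x, fderiv ℝ m x e = m' x) (w : Schwartz8) :
    dirOp e (mulOp m w) = mulOp m (dirOp e w) + mulOp m' w := by
  ext j x
  rw [Pi.add_apply, add_apply, mulOp_apply hm, mulOp_apply hm', dirOp_apply_apply,
    dirOp_apply_apply]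
  have h1 : ⇑(mulOp m w j) = fun y => m y * w j y := funext fun y => mulOp_apply hm w j y
  have hd : DifferentiableAt ℝ m x := (hm.1.differentiable (by simp)).differentiableAt
  rw [h1, fderiv_fun_mul hd (w j).differentiableAt]
  simp [h x, mul_comm]

/-! ### Norm comparison -/

theorem norm_emb (w : Schwartz8) : ‖emb w‖ = √(∑ j, ‖(w j).toLp 2 (volume : Measure R3)‖ ^ 2) := by
  rw [PiLp.norm_eq_of_L2]; rfl

theorem norm_emb_sq (w : Schwartz8) : ‖emb w‖ ^ 2 = ∑ j, ‖(w j).toLp 2 (volume : Measure R3)‖ ^ 2 := by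
  rw [PiLp.norm_sq_eq_of_L2]; rfl

theorem norm_toLp_sq (f : 𝓢(R3, ℂ)) : ‖f.toLp 2 (volume : Measure R3)‖ ^ 2 = ∫ x, ‖f x‖ ^ 2 := by
  have := inner_toL2_toL2_eq f f (volume : Measure R3)
  simp only [inner_self_eq_norm_sq_to_K, Complex.coe_algebraMap] at this
  have h2 : ∫ x, ((‖f x‖ : ℂ)) ^ 2 = ((∫ x, ‖f x‖ ^ 2 : ℝ) : ℂ) := by
    rw [← integral_complex_ofReal]; simp
  rw [← Complex.ofReal_inj, ← h2, Complex.ofReal_pow]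
  exact this

theorem integrable_norm_sq (f : 𝓢(R3, ℂ)) : Integrable fun x => ‖f x‖ ^ 2 :=
  (memLp_two_iff_integrable_sq_norm (f.memLp 2).1).1 (f.memLp 2)

theorem norm_emb_sq_eq_integral (w : Schwartz8) : ‖emb w‖ ^ 2 = ∑ j, ∫ x, ‖w j x‖ ^ 2 := by
  simp only [norm_emb_sq, norm_toLp_sq]

theorem norm_emb_le₂ {u v w : Schwartz8} {a b : ℝ} (ha : 0 ≤ a) (hb : 0 ≤ b)
    (h : ∀ j x, ‖u j x‖ ≤ a * ‖v j x‖ + b * ‖w j x‖) :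
    ‖emb u‖ ≤ a * ‖emb v‖ + b * ‖emb w‖ := by
  have h1 : ∀ j, ‖(u j).toLp 2 (volume : Measure R3)‖ ≤
      a * ‖(v j).toLp 2 (volume : Measure R3)‖ + b * ‖(w j).toLp 2 (volume : Measure R3)‖ := by
    intro j
    have hv := ((v j).memLp 2 (volume : Measure R3)).norm.const_mul a
    have hw := ((w j).memLp 2 (volume : Measure R3)).norm.const_mul b
    have e1 : ‖(u j).toLp 2 (volume : Measure R3)‖ ≤ ‖hv.toLp + hw.toLp‖ := by
      refine Lp.norm_le_norm_of_ae_le ?_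
      filter_upwards [(u j).coeFn_toLp 2, hv.coeFn_toLp, hw.coeFn_toLp,
        Lp.coeFn_add hv.toLp hw.toLp] with x h1 h2 h3 h4
      rw [h1, h4, Pi.add_apply, h2, h3]
      exact (h j x).trans (le_abs_self _)
    have e2 : ‖hv.toLp‖ = a * ‖(v j).toLp 2 (volume : Measure R3)‖ := by
      rw [Lp.norm_toLp, show (fun x => a * ‖v j x‖) = a • fun x => ‖v j x‖ from rfl,
        eLpNorm_const_smul, eLpNorm_norm, norm_toLp, ENNReal.toReal_mul]
      simp [abs_of_nonneg ha]
    have e3 : ‖hw.toLp‖ = b * ‖(w j).toLp 2 (volume : Measure R3)‖ := by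
      rw [Lp.norm_toLp, show (fun x => b * ‖w j x‖) = b • fun x => ‖w j x‖ from rfl,
        eLpNorm_const_smul, eLpNorm_norm, norm_toLp, ENNReal.toReal_mul]
      simp [abs_of_nonneg hb]
    rw [← e2, ← e3]
    exact e1.trans (norm_add_le _ _)
  -- Minkowski's inequality is used a second time, in ℝ⁸, for the vectors of component norms.
  let N : Schwartz8 → EuclideanSpace ℝ (Fin 8) := fun w =>
    WithLp.toLp 2 fun j => ‖(w j).toLp 2 (volume : Measure R3)‖
  have hN : ∀ w, ‖emb w‖ = ‖N w‖ := fun w => by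
    rw [norm_emb, EuclideanSpace.norm_eq]; simp [N]
  calc ‖emb u‖ ≤ ‖a • N v + b • N w‖ := by
        rw [norm_emb, EuclideanSpace.norm_eq]
        refine Real.sqrt_le_sqrt (Finset.sum_le_sum fun j _ => ?_)
        refine pow_le_pow_left₀ (norm_nonneg _) ((h1 j).trans ?_) 2
        simpa [N] using le_abs_self _
    _ ≤ ‖a • N v‖ + ‖b • N w‖ := norm_add_le _ _
    _ = _ := by rw [norm_smul, norm_smul, hN, hN, Real.norm_of_nonneg ha, Real.norm_of_nonneg hb]

theorem norm_emb_le {u v : Schwartz8} {a : ℝ} (ha : 0 ≤ a) (h : ∀ j x, ‖u j x‖ ≤ a * ‖v j x‖) :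
    ‖emb u‖ ≤ a * ‖emb v‖ := by
  have := norm_emb_le₂ (w := v) ha le_rfl (u := u) (v := v) (fun j x => by simpa using h j x)
  simpa using this

theorem norm_emb_eq {u v : Schwartz8} (h : ∀ j x, ‖u j x‖ = ‖v j x‖) : ‖emb u‖ = ‖emb v‖ := by
  refine le_antisymm ?_ ?_
  · simpa using norm_emb_le zero_le_one (fun j x => by simpa using (h j x).le)
  · simpa using norm_emb_le zero_le_one (fun j x => by simpa using (h j x).ge)

/-! ### The Fourier transform on Schwartz functions -/

/-- The inverse of `ft`. -/
def ift (ψ : 𝓢(R3, ℂ)) : 𝓢(R3, ℂ) :=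
  𝓕 (compCLMOfContinuousLinearEquiv ℂ
    (ContinuousLinearEquiv.smulLeft
      (Units.mk0 (2 * Real.pi : ℝ) (by positivity)) : R3 ≃L[ℝ] R3) ψ)

theorem ft_eq (φ : 𝓢(R3, ℂ)) (ξ : R3) : ft φ ξ = (𝓕⁻ φ) ((2 * Real.pi)⁻¹ • ξ) := rfl

theorem ft_ift (ψ : 𝓢(R3, ℂ)) : ft (ift ψ) = ψ := by
  ext ξ
  rw [ft_eq, ift, FourierTransform.fourierInv_fourier_eq]
  change ψ ((2 * Real.pi) • (2 * Real.pi)⁻¹ • ξ) = ψ ξ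
  rw [smul_inv_smul₀ (by positivity)]

/-- `ft` as a linear map. -/
def ftₗ : 𝓢(R3, ℂ) →ₗ[ℂ] 𝓢(R3, ℂ) where
  toFun := ft
  map_add' f g := by simp only [ft, FourierTransform.fourierInv_add, map_add]
  map_smul' c f := by simp only [ft, FourierTransform.fourierInv_smul, map_smul, RingHom.id_apply]

/-- The Fourier transform of Schwartz 8-vectors. -/
def ftOp : Module.End ℂ Schwartz8 := diag ftₗ

theorem ftOp_apply (w : Schwartz8) (j : Fin 8) : ftOp w j = ft (w j) := rfl

theorem ftOp_surjective (w : Schwartz8) : ∃ v, ftOp v = w :=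
  ⟨fun j => ift (w j), funext fun j => by rw [ftOp_apply, ft_ift]⟩

/-- The source of every factor (2π)³: `ft` is the unitary inverse transform evaluated at ξ/2π. -/
theorem integral_comp_dilation {E : Type*} [NormedAddCommGroup E] [NormedSpace ℝ E] (f : R3 → E) :
    ∫ ξ, f ((2 * Real.pi)⁻¹ • ξ) = (2 * Real.pi) ^ 3 • ∫ ξ, f ξ := by
  rw [Measure.integral_comp_smul]
  simp only [finrank_euclideanSpace, Fintype.card_fin, inv_pow, inv_inv]
  rw [abs_of_pos (by positivity)]

theorem inner_emb_ftOp (v w : Schwartz8) :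
    inner ℂ (emb (ftOp v)) (emb (ftOp w)) = (2 * Real.pi : ℂ) ^ 3 * inner ℂ (emb v) (emb w) := by
  rw [inner_emb, inner_emb, Finset.mul_sum]
  refine Finset.sum_congr rfl fun j _ => ?_
  have h1 := integral_comp_dilation fun ξ => (𝓕⁻ (w j)) ξ * starRingEnd ℂ ((𝓕⁻ (v j)) ξ)
  have h2 := integral_inner_fourier_fourier (𝓕⁻ (v j)) (𝓕⁻ (w j))
  simp only [RCLike.inner_apply, FourierTransform.fourier_fourierInv_eq] at h2
  simp only [ftOp_apply, ft_eq]
  rw [h1, ← h2, Complex.real_smul]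
  push_cast; rfl

theorem norm_emb_ftOp (v : Schwartz8) : ‖emb (ftOp v)‖ ^ 2 = (2 * Real.pi) ^ 3 * ‖emb v‖ ^ 2 := by
  have := inner_emb_ftOp v v
  rw [inner_self_eq_norm_sq_to_K, inner_self_eq_norm_sq_to_K] at this
  simp only [Complex.coe_algebraMap] at this
  exact_mod_cast this

/-- Fubini for the symmetric kernel e^{ix·ξ}. No conjugate appears, which is the form required by
the bilinear pairing in `HasFourierTransform`. -/
theorem integral_ft_mul (f g : 𝓢(R3, ℂ)) : ∫ x, ft f x * g x = ∫ x, f x * ft g x := by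
  have hft : ∀ φ : 𝓢(R3, ℂ), ∀ ξ, ft φ ((2 * Real.pi) • ξ) = 𝓕⁻ φ ξ := fun φ ξ => by
    rw [ft_eq, inv_smul_smul₀ (by positivity)]
  have hint : Integrable (fun z : R3 × R3 =>
      Complex.exp (Complex.I * (inner ℝ z.1 z.2 : ℝ)) * (f z.1 * g z.2)) := by
    have h := f.integrable (μ := volume) |>.mul_prod (g.integrable (μ := volume))
    refine (h.bdd_mul (c := 1) (f := fun z : R3 × R3 => Complex.exp (Complex.I * (inner ℝ z.1 z.2 : ℝ))) ?_ ?_)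
    · exact Continuous.aestronglyMeasurable (by fun_prop)
    · refine .of_forall fun z => ?_
      rw [mul_comm, Complex.norm_exp_ofReal_mul_I]
  calc ∫ x, ft f x * g x
      = ∫ x, ∫ y, Complex.exp (Complex.I * (inner ℝ y x : ℝ)) * (f y * g x) := by
        refine integral_congr_ae (.of_forall fun x => ?_)
        simp only [ft_apply, ← integral_mul_const, mul_assoc]
    _ = ∫ y, ∫ x, Complex.exp (Complex.I * (inner ℝ y x : ℝ)) * (f y * g x) :=
        (integral_integral_swap hint).symm
    _ = _ := by
        refine integral_congr_ae (.of_forall fun y => ?_)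
        simp only [ft_apply, ← integral_const_mul]
        refine integral_congr_ae (.of_forall fun x => ?_)
        simp only [real_inner_comm y x]
        ring

theorem hasTemperateGrowth_coord (e : R3) :
    (fun x : R3 => ((inner ℝ x e : ℝ) : ℂ)).HasTemperateGrowth := by fun_prop

theorem ft_lineDeriv (e : R3) (φ : 𝓢(R3, ℂ)) (ξ : R3) :
    ft (∂_{e} φ) ξ = -Complex.I * (inner ℝ ξ e : ℝ) * ft φ ξ := by
  have ht : (inner ℝ · e : R3 → ℝ).HasTemperateGrowth := by fun_prop
  have hpi : (Real.pi : ℂ) ≠ 0 := by exact_mod_cast Real.pi_ne_zero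
  rw [ft_eq, fourierInv_lineDerivOp_eq, ft_eq]
  simp only [neg_smul, neg_apply, smul_apply, smulLeftCLM_apply_apply ht, inner_smul_left]
  simp only [Complex.real_smul, smul_eq_mul]
  push_cast
  simp
  field_simp

theorem ft_mul_inner (e : R3) (φ : 𝓢(R3, ℂ)) :
    ft (smulLeftCLM ℂ (fun x : R3 => ((inner ℝ x e : ℝ) : ℂ)) φ) = -Complex.I • ∂_{e} (ft φ) := by
  have ht : (inner ℝ · e : R3 → ℝ).HasTemperateGrowth := by fun_prop
  have hpi : (Real.pi : ℂ) ≠ 0 := by exact_mod_cast Real.pi_ne_zero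
  have h1 : smulLeftCLM ℂ (fun x : R3 => ((inner ℝ x e : ℝ) : ℂ)) φ
      = smulLeftCLM ℂ (inner ℝ · e) φ := smulLeftCLM_ofReal ℂ ht φ
  rw [h1, ft, ft, lineDerivOp_compCLMOfContinuousLinearEquiv]
  have h2 : (ContinuousLinearEquiv.smulLeft
      (Units.mk0 ((2 * Real.pi)⁻¹ : ℝ) (inv_ne_zero (by positivity))) : R3 ≃L[ℝ] R3) e
      = (2 * Real.pi)⁻¹ • e := rfl
  rw [h2, lineDerivOp_left_smul, lineDerivOp_fourierInv_eq, FourierTransform.fourierInv_smul]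
  ext ξ
  simp only [compCLMOfContinuousLinearEquiv_apply, Function.comp_apply, smul_apply, smul_eq_mul,
    Complex.real_smul]
  push_cast
  have := Complex.I_sq
  field_simp
  linear_combination this * (𝓕⁻ (smulLeftCLM ℂ (inner ℝ · e) φ)) _

/-! ### The symbol `p_ζ` and the weight `q = 1 + |p_ζ / Λ|²` -/

/-- `ζ = τ e + i b` with `e` a unit vector, `b ⟂ e`, and `|b|` comparable to `τ ≥ 1`. -/
structure Frame (ζ : C3) (e : R3) (τ : ℝ) : Prop where
  norm_e : ‖e‖ = 1
  one_le : 1 ≤ τ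
  re_eq : reVec ζ = τ • e
  orth : inner ℝ e (imVec ζ) = 0
  im_le : ‖imVec ζ‖ ^ 2 ≤ 2 * τ ^ 2

/-- The real part of `p_ζ`. -/
def reSym (ζ : C3) (ξ : R3) : ℝ := ‖ξ‖ ^ 2 + 2 * inner ℝ ξ (imVec ζ)

theorem sum_mul_eq (ζ : C3) (ξ : R3) : ∑ i, ζ i * (ξ i : ℂ) =
    (inner ℝ ξ (reVec ζ) : ℝ) + Complex.I * (inner ℝ ξ (imVec ζ) : ℝ) := by
  simp only [PiLp.inner_apply, RCLike.inner_apply, conj_trivial, reVec, imVec, Complex.ofReal_sum,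
    Finset.mul_sum, ← Finset.sum_add_distrib]
  refine Finset.sum_congr rfl fun i _ => ?_
  conv_lhs => rw [← Complex.re_add_im (ζ i)]
  push_cast; ring

theorem norm_sq_eq_re_im (ζ : C3) : ‖ζ‖ ^ 2 = ‖reVec ζ‖ ^ 2 + ‖imVec ζ‖ ^ 2 := by
  simp only [EuclideanSpace.norm_sq_eq, reVec, imVec, ← Finset.sum_add_distrib]
  refine Finset.sum_congr rfl fun i _ => ?_
  rw [Complex.sq_norm, Complex.normSq_apply]
  simp [sq]

/-- The weight function `1 + |p_ζ / Λ|²`. -/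
def qSym (ζ : C3) (Λ : ℝ) (ξ : R3) : ℝ := 1 + ‖(Λ : ℂ)⁻¹ * p ζ ξ‖ ^ 2

theorem one_le_qSym (ζ : C3) (Λ : ℝ) (ξ : R3) : 1 ≤ qSym ζ Λ ξ :=
  le_add_of_nonneg_right (sq_nonneg _)

theorem qSym_pos (ζ : C3) (Λ : ℝ) (ξ : R3) : 0 < qSym ζ Λ ξ :=
  zero_lt_one.trans_le (one_le_qSym _ _ _)

theorem hasTemperateGrowth_p (ζ : C3) : (p ζ).HasTemperateGrowth := by
  have : p ζ = fun ξ => (((‖ξ‖ ^ 2 : ℝ) : ℂ) - 2 * Complex.I *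
      ((inner ℝ ξ (reVec ζ) : ℝ) + Complex.I * (inner ℝ ξ (imVec ζ) : ℝ))) := by
    funext ξ
    rw [p, sum_mul_eq]; push_cast; ring
  rw [this]
  fun_prop

theorem hasTemperateGrowth_reSym (ζ : C3) : (reSym ζ).HasTemperateGrowth := by
  unfold reSym; fun_prop

theorem hasTemperateGrowth_qSym_rpow (ζ : C3) (Λ r : ℝ) :
    (fun ξ => qSym ζ Λ ξ ^ r).HasTemperateGrowth := by
  have h1 : (fun ξ => (Λ : ℂ)⁻¹ * p ζ ξ).HasTemperateGrowth := by
    have := hasTemperateGrowth_p ζ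
    fun_prop
  exact (Function.hasTemperateGrowth_one_add_norm_sq_rpow ℂ r).comp h1

/-- Only derivatives in the direction e are ever needed, and on a line ξ + te the symbol is a
polynomial in t. -/
theorem fderiv_eq_of_line {m : R3 → ℝ} (hm : m.HasTemperateGrowth) {x e : R3} {m' : ℝ}
    (h : HasDerivAt (fun t : ℝ => m (x + t • e)) m' 0) :
    fderiv ℝ (fun y => (m y : ℂ)) x e = m' := by
  have hd : DifferentiableAt ℝ m x := (hm.1.differentiable (by simp)).differentiableAt
  have h1 := Complex.ofRealCLM.hasFDerivAt.comp x hd.hasFDerivAt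
  have h2 : fderiv ℝ (fun y => (m y : ℂ)) x = Complex.ofRealCLM ∘L fderiv ℝ m x := h1.fderiv
  rw [h2, ContinuousLinearMap.comp_apply, ← hd.lineDeriv_eq_fderiv, lineDeriv, h.deriv]
  rfl

/-! ### Size of p_ζ and of its derivative along e -/

namespace Frame

variable {ζ : C3} {e : R3} {τ K : ℝ}

theorem p_eq (F : Frame ζ e τ) (ξ : R3) :
    p ζ ξ = reSym ζ ξ - 2 * Complex.I * τ * (inner ℝ ξ e : ℝ) := by
  rw [p, sum_mul_eq, F.re_eq, inner_smul_right, reSym]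
  push_cast
  linear_combination -(2 * (inner ℝ ξ (imVec ζ) : ℂ)) * Complex.I_sq

theorem norm_p_sq (F : Frame ζ e τ) (ξ : R3) :
    ‖p ζ ξ‖ ^ 2 = reSym ζ ξ ^ 2 + 4 * τ ^ 2 * (inner ℝ ξ e) ^ 2 := by
  rw [F.p_eq, Complex.sq_norm, Complex.normSq_apply]
  simp; ring

theorem qSym_eq (F : Frame ζ e τ) (Λ : ℝ) (ξ : R3) :
    qSym ζ Λ ξ = 1 + Λ⁻¹ ^ 2 * (reSym ζ ξ ^ 2 + 4 * τ ^ 2 * (inner ℝ ξ e) ^ 2) := by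
  rw [qSym, norm_mul, mul_pow, F.norm_p_sq]; simp

theorem abs_inner_le (F : Frame ζ e τ) (ξ : R3) : |inner ℝ ξ e| ≤ ‖ξ‖ := by
  simpa [F.norm_e] using abs_real_inner_le_norm ξ e

/-- Since e ⟂ Im ζ, the vector Im ζ does not contribute to the term linear in t. Consequently ∂_e
p_ζ = 2 ξ·e - 2iτ and ∂_e² p_ζ = 2. -/
theorem reSym_line (F : Frame ζ e τ) (ξ : R3) (t : ℝ) :
    reSym ζ (ξ + t • e) = reSym ζ ξ + 2 * t * inner ℝ ξ e + t ^ 2 := by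
  rw [reSym, reSym, norm_add_sq_real, inner_add_left, inner_smul_left, inner_smul_right, norm_smul,
    F.norm_e, F.orth]
  simp; ring

theorem inner_line (F : Frame ζ e τ) (ξ : R3) (t : ℝ) :
    inner ℝ (ξ + t • e) e = inner ℝ ξ e + t := by
  rw [inner_add_left, inner_smul_left, real_inner_self_eq_norm_sq, F.norm_e]; simp

/-- As |Im ζ| ≤ 2τ, the linear part of the symbol is at most 4τ‖ξ‖ ≤ (2/5)‖ξ‖²; beyond radius 10τ
the symbol is elliptic. -/
theorem half_sq_le_reSym (F : Frame ζ e τ) {ξ : R3} (h : 10 * τ ≤ ‖ξ‖) :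
    ‖ξ‖ ^ 2 / 2 ≤ reSym ζ ξ := by
  have hτ := F.one_le
  have h1 : |inner ℝ ξ (imVec ζ)| ≤ ‖ξ‖ * ‖imVec ζ‖ := abs_real_inner_le_norm _ _
  have h2 : ‖imVec ζ‖ ≤ 2 * τ := by
    refine le_of_sq_le_sq ?_ (by positivity)
    nlinarith [F.im_le]
  have h3 := neg_abs_le (inner ℝ ξ (imVec ζ))
  rw [reSym]
  nlinarith [norm_nonneg ξ, mul_le_mul_of_nonneg_left h2 (norm_nonneg ξ)]

theorem large_le_qSym (F : Frame ζ e τ) (hK : 1 ≤ K) (hKτ : K ≤ τ) {ξ : R3}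
    (h : 10 * τ ≤ ‖ξ‖) : ‖ξ‖ ^ 4 ≤ 4 * τ ^ 4 * qSym ζ (K * τ) ξ := by
  have h1 := F.half_sq_le_reSym h
  have hτ := F.one_le
  rw [F.qSym_eq]
  have h2 : (‖ξ‖ ^ 2 / 2) ^ 2 ≤ reSym ζ ξ ^ 2 := pow_le_pow_left₀ (by positivity) h1 2
  have h3 : 4 * τ ^ 4 * (K * τ)⁻¹ ^ 2 = 4 * (τ / K) ^ 2 := by field_simp
  have h4 : 1 ≤ (τ / K) ^ 2 := by
    have : 1 ≤ τ / K := by rw [le_div_iff₀ (by positivity)]; linarith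
    nlinarith
  have h5 : 0 ≤ 4 * τ ^ 2 * (inner ℝ ξ e) ^ 2 := by positivity
  calc ‖ξ‖ ^ 4 = 4 * (‖ξ‖ ^ 2 / 2) ^ 2 := by ring
    _ ≤ 4 * (reSym ζ ξ ^ 2 + 4 * τ ^ 2 * (inner ℝ ξ e) ^ 2) := by linarith
    _ ≤ 4 * (τ / K) ^ 2 * (reSym ζ ξ ^ 2 + 4 * τ ^ 2 * (inner ℝ ξ e) ^ 2) := by
        have : 0 ≤ reSym ζ ξ ^ 2 + 4 * τ ^ 2 * (inner ℝ ξ e) ^ 2 := by positivity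
        nlinarith
    _ ≤ _ := by
        rw [mul_add (4 * τ ^ 4) 1, ← mul_assoc, h3]
        have : 0 ≤ 4 * τ ^ 4 := by positivity
        linarith

/-- A derivative costs τ q^{1/4}: by ellipticity where ‖ξ‖ ≥ 10τ, and because q ≥ 1 elsewhere. This
is how first-order terms of the potential are measured in the weighted norm. -/
theorem norm_le_qSym (F : Frame ζ e τ) (hK : 1 ≤ K) (hKτ : K ≤ τ) (ξ : R3) :
    ‖ξ‖ ≤ 10 * τ * qSym ζ (K * τ) ξ ^ (1 / 4 : ℝ) := by
  have hτ := F.one_le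
  have hq := one_le_qSym ζ (K * τ) ξ
  rcases le_total (10 * τ) ‖ξ‖ with h | h
  · have h1 := F.large_le_qSym hK hKτ h
    have hq4 : (qSym ζ (K * τ) ξ ^ (1 / 4 : ℝ)) ^ 4 = qSym ζ (K * τ) ξ := by
      rw [← Real.rpow_natCast, ← Real.rpow_mul (qSym_pos _ _ _).le]; norm_num
    refine le_of_pow_le_pow_left₀ (n := 4) (by norm_num) (by positivity) ?_
    rw [mul_pow, hq4, mul_pow]
    have : 0 ≤ τ ^ 4 * qSym ζ (K * τ) ξ := by positivity
    nlinarith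
  · have := Real.one_le_rpow hq (show (0 : ℝ) ≤ 1 / 4 by norm_num)
    nlinarith

/-- The derivative of `p_ζ` in the direction `e` is small compared with `Λ q^{1/2}`. -/
theorem deriv_p_le (F : Frame ζ e τ) (hK : 1 ≤ K) (hKτ : K ≤ τ) (ξ : R3) :
    4 * (inner ℝ ξ e) ^ 2 + 4 * τ ^ 2 ≤ 22 ^ 2 * τ ^ 2 * qSym ζ (K * τ) ξ := by
  have hτ := F.one_le
  have hq := one_le_qSym ζ (K * τ) ξ
  have hs : (inner ℝ ξ e) ^ 2 ≤ ‖ξ‖ ^ 2 := sq_le_sq' (by linarith [neg_abs_le (inner ℝ ξ e), F.abs_inner_le ξ]) ((le_abs_self _).trans (F.abs_inner_le ξ))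
  -- The left side is |∂_e p_ζ|². For ‖ξ‖ ≤ 10τ it is at most 404 τ² ≤ 22² τ²; for larger ‖ξ‖ the
  -- bound on ‖ξ‖⁴ is much stronger than needed.
  rcases le_total (10 * τ) ‖ξ‖ with h | h
  · have h1 := F.large_le_qSym hK hKτ h
    have h2 : (10 * τ) ^ 2 ≤ ‖ξ‖ ^ 2 := pow_le_pow_left₀ (by positivity) h 2
    have h3 : 0 < τ ^ 2 := by positivity
    have h4 : 100 * τ ^ 2 * ‖ξ‖ ^ 2 ≤ 4 * τ ^ 4 * qSym ζ (K * τ) ξ := by nlinarith [sq_nonneg ‖ξ‖]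
    have h5 : 25 * ‖ξ‖ ^ 2 ≤ τ ^ 2 * qSym ζ (K * τ) ξ := by
      have : τ ^ 2 * (25 * ‖ξ‖ ^ 2) ≤ τ ^ 2 * (τ ^ 2 * qSym ζ (K * τ) ξ) := by nlinarith
      exact le_of_mul_le_mul_left this h3
    nlinarith
  · have h2 : ‖ξ‖ ^ 2 ≤ (10 * τ) ^ 2 := pow_le_pow_left₀ (norm_nonneg _) h 2
    have : 0 ≤ τ ^ 2 * (qSym ζ (K * τ) ξ - 1) := mul_nonneg (sq_nonneg _) (by linarith)
    nlinarith

/-! ### Derivatives of q and of T = q^{-1/4} along e -/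

/-- The first derivative of `q` in the direction `e`. -/
def dq (ζ : C3) (e : R3) (τ Λ : ℝ) (ξ : R3) : ℝ :=
  Λ⁻¹ ^ 2 * (4 * reSym ζ ξ * inner ℝ ξ e + 8 * τ ^ 2 * inner ℝ ξ e)

/-- The second derivative of `q` in the direction `e`. -/
def ddq (ζ : C3) (e : R3) (τ Λ : ℝ) (ξ : R3) : ℝ :=
  Λ⁻¹ ^ 2 * (8 * (inner ℝ ξ e) ^ 2 + 4 * reSym ζ ξ + 8 * τ ^ 2)

theorem hasDerivAt_qSym (F : Frame ζ e τ) (Λ : ℝ) (ξ : R3) :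
    HasDerivAt (fun t : ℝ => qSym ζ Λ (ξ + t • e)) (dq ζ e τ Λ ξ) 0 := by
  simp only [F.qSym_eq, F.reSym_line, F.inner_line]
  have h0 := hasDerivAt_id (0 : ℝ)
  have h1 : HasDerivAt (fun t : ℝ => reSym ζ ξ + 2 * t * inner ℝ ξ e + t ^ 2)
      (2 * inner ℝ ξ e) 0 := by
    have := (((h0.const_mul 2).mul_const (inner ℝ ξ e)).const_add (reSym ζ ξ)).add (h0.pow 2)
    simpa using! this
  have h2 := (((h1.pow 2).add (((h0.const_add (inner ℝ ξ e)).pow 2).const_mul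
    (4 * τ ^ 2))).const_mul (Λ⁻¹ ^ 2)).const_add 1
  refine h2.congr_deriv ?_
  simp [dq]; left; ring

theorem hasDerivAt_dq (F : Frame ζ e τ) (Λ : ℝ) (ξ : R3) :
    HasDerivAt (fun t : ℝ => dq ζ e τ Λ (ξ + t • e)) (ddq ζ e τ Λ ξ) 0 := by
  simp only [dq, F.reSym_line, F.inner_line]
  have h0 := hasDerivAt_id (0 : ℝ)
  have h1 : HasDerivAt (fun t : ℝ => reSym ζ ξ + 2 * t * inner ℝ ξ e + t ^ 2)
      (2 * inner ℝ ξ e) 0 := by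
    have := (((h0.const_mul 2).mul_const (inner ℝ ξ e)).const_add (reSym ζ ξ)).add (h0.pow 2)
    simpa using! this
  have h2 := h0.const_add (inner ℝ ξ e)
  have h3 := (((h1.const_mul 4).mul h2).add (h2.const_mul (8 * τ ^ 2))).const_mul (Λ⁻¹ ^ 2)
  refine h3.congr_deriv ?_
  simp [ddq]; left; ring

/-- The multiplier `T = q^{-1/4}`. -/
def mT (ζ : C3) (Λ : ℝ) (ξ : R3) : ℝ := qSym ζ Λ ξ ^ (-1 / 4 : ℝ)

/-- The first derivative of `T` in the direction `e`. -/
def dT (ζ : C3) (e : R3) (τ Λ : ℝ) (ξ : R3) : ℝ :=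
  (-1 / 4) * dq ζ e τ Λ ξ * qSym ζ Λ ξ ^ (-5 / 4 : ℝ)

/-- The second derivative of `T` in the direction `e`. -/
def ddT (ζ : C3) (e : R3) (τ Λ : ℝ) (ξ : R3) : ℝ :=
  (-1 / 4) * ddq ζ e τ Λ ξ * qSym ζ Λ ξ ^ (-5 / 4 : ℝ) +
    (5 / 16) * dq ζ e τ Λ ξ ^ 2 * qSym ζ Λ ξ ^ (-9 / 4 : ℝ)

theorem mT_pos (ζ : C3) (Λ : ℝ) (ξ : R3) : 0 < mT ζ Λ ξ := Real.rpow_pos_of_pos (qSym_pos _ _ _) _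

theorem hasTemperateGrowth_mT (ζ : C3) (Λ : ℝ) : (mT ζ Λ).HasTemperateGrowth :=
  hasTemperateGrowth_qSym_rpow _ _ _

theorem hasTemperateGrowth_dq (ζ : C3) (e : R3) (τ Λ : ℝ) :
    (dq ζ e τ Λ).HasTemperateGrowth := by
  have := hasTemperateGrowth_reSym ζ
  unfold dq; fun_prop

theorem hasTemperateGrowth_ddq (ζ : C3) (e : R3) (τ Λ : ℝ) :
    (ddq ζ e τ Λ).HasTemperateGrowth := by
  have := hasTemperateGrowth_reSym ζ
  unfold ddq; fun_prop

theorem hasTemperateGrowth_dT (ζ : C3) (e : R3) (τ Λ : ℝ) :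
    (dT ζ e τ Λ).HasTemperateGrowth := by
  have := hasTemperateGrowth_dq ζ e τ Λ
  have := hasTemperateGrowth_qSym_rpow ζ Λ (-5 / 4)
  unfold dT; fun_prop

theorem hasTemperateGrowth_ddT (ζ : C3) (e : R3) (τ Λ : ℝ) :
    (ddT ζ e τ Λ).HasTemperateGrowth := by
  have := hasTemperateGrowth_dq ζ e τ Λ
  have := hasTemperateGrowth_ddq ζ e τ Λ
  have := hasTemperateGrowth_qSym_rpow ζ Λ (-5 / 4)
  have := hasTemperateGrowth_qSym_rpow ζ Λ (-9 / 4)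
  unfold ddT; fun_prop

theorem fderiv_mT (F : Frame ζ e τ) (Λ : ℝ) (ξ : R3) :
    fderiv ℝ (fun y => (mT ζ Λ y : ℂ)) ξ e = dT ζ e τ Λ ξ := by
  refine fderiv_eq_of_line (hasTemperateGrowth_mT _ _) ?_
  have h := (F.hasDerivAt_qSym Λ ξ).rpow_const (p := -1 / 4)
    (Or.inl (by simpa using (qSym_pos ζ Λ ξ).ne'))
  refine h.congr_deriv ?_
  simp only [zero_smul, add_zero, dT]
  norm_num; left; ring

theorem fderiv_dT (F : Frame ζ e τ) (Λ : ℝ) (ξ : R3) :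
    fderiv ℝ (fun y => (dT ζ e τ Λ y : ℂ)) ξ e = ddT ζ e τ Λ ξ := by
  refine fderiv_eq_of_line (hasTemperateGrowth_dT _ _ _ _) ?_
  have h := (F.hasDerivAt_qSym Λ ξ).rpow_const (p := -5 / 4)
    (Or.inl (by simpa using (qSym_pos ζ Λ ξ).ne'))
  have h2 := ((F.hasDerivAt_dq Λ ξ).const_mul (-1 / 4)).mul h
  refine h2.congr_deriv ?_
  simp only [zero_smul, add_zero, ddT]
  norm_num; ring

/-- With Λ = Kτ the derivative of q is 2Λ⁻² Re(conj p · ∂_e p). Cauchy–Schwarz applies with |p| ≤ Λ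
q^{1/2} and |∂_e p| ≤ 22 τ q^{1/2}. -/
theorem abs_dq_le (F : Frame ζ e τ) (hK : 1 ≤ K) (hKτ : K ≤ τ) (ξ : R3) :
    |dq ζ e τ (K * τ) ξ| ≤ 44 / K * qSym ζ (K * τ) ξ := by
  have hτ := F.one_le
  have hq := qSym_pos ζ (K * τ) ξ
  have h1 := F.deriv_p_le hK hKτ ξ
  have h2 : (K * τ)⁻¹ ^ 2 * (reSym ζ ξ ^ 2 + 4 * τ ^ 2 * (inner ℝ ξ e) ^ 2) ≤
      qSym ζ (K * τ) ξ := by rw [F.qSym_eq]; linarith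
  refine abs_le_of_sq_le_sq ?_ (by positivity)
  have h3 : dq ζ e τ (K * τ) ξ ^ 2 ≤ ((K * τ)⁻¹ ^ 2 * (4 * (reSym ζ ξ ^ 2 +
      4 * τ ^ 2 * (inner ℝ ξ e) ^ 2))) * ((K * τ)⁻¹ ^ 2 * (4 * (inner ℝ ξ e) ^ 2 + 4 * τ ^ 2)) := by
    rw [dq, mul_pow]
    have : 0 ≤ ((K * τ)⁻¹ ^ 2) ^ 2 := by positivity
    have h4 : (4 * reSym ζ ξ * inner ℝ ξ e + 8 * τ ^ 2 * inner ℝ ξ e) ^ 2 ≤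
        (4 * (reSym ζ ξ ^ 2 + 4 * τ ^ 2 * (inner ℝ ξ e) ^ 2)) *
          (4 * (inner ℝ ξ e) ^ 2 + 4 * τ ^ 2) := by
      -- Up to a constant the hinted square is the Cauchy–Schwarz defect (Im(conj p · ∂_e p))².
      nlinarith [sq_nonneg (τ * (reSym ζ ξ - 2 * (inner ℝ ξ e) ^ 2))]
    calc _ ≤ ((K * τ)⁻¹ ^ 2) ^ 2 * _ := mul_le_mul_of_nonneg_left h4 this
      _ = _ := by ring
  refine h3.trans ?_
  have h5 : (K * τ)⁻¹ ^ 2 * (4 * (inner ℝ ξ e) ^ 2 + 4 * τ ^ 2) ≤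
      (22 / K) ^ 2 * qSym ζ (K * τ) ξ := by
    calc _ ≤ (K * τ)⁻¹ ^ 2 * (22 ^ 2 * τ ^ 2 * qSym ζ (K * τ) ξ) :=
          mul_le_mul_of_nonneg_left h1 (by positivity)
      _ = _ := by field_simp
  calc _ ≤ (4 * qSym ζ (K * τ) ξ) * ((22 / K) ^ 2 * qSym ζ (K * τ) ξ) := by
        refine mul_le_mul ?_ h5 (by positivity) (by positivity)
        linarith
    _ = _ := by ring

/-- The second derivative of q is 2Λ⁻²|∂_e p|² + 4Λ⁻² Re p, and 22/K ≤ 1 bounds the first term by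
2q, the second being at most 4q. -/
theorem abs_ddq_le (F : Frame ζ e τ) (hK : 22 ≤ K) (hKτ : K ≤ τ) (ξ : R3) :
    |ddq ζ e τ (K * τ) ξ| ≤ 6 * qSym ζ (K * τ) ξ := by
  have hτ := F.one_le
  have hK1 : 1 ≤ K := by linarith
  have hq1 := one_le_qSym ζ (K * τ) ξ
  have h1 := F.deriv_p_le hK1 hKτ ξ
  have h5 : (K * τ)⁻¹ ^ 2 * (4 * (inner ℝ ξ e) ^ 2 + 4 * τ ^ 2) ≤ qSym ζ (K * τ) ξ := by
    calc _ ≤ (K * τ)⁻¹ ^ 2 * (22 ^ 2 * τ ^ 2 * qSym ζ (K * τ) ξ) :=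
          mul_le_mul_of_nonneg_left h1 (by positivity)
      _ = (22 / K) ^ 2 * qSym ζ (K * τ) ξ := by field_simp
      _ ≤ 1 * qSym ζ (K * τ) ξ := by
          refine mul_le_mul_of_nonneg_right ?_ (by linarith)
          have : 22 / K ≤ 1 := by rw [div_le_one (by linarith)]; exact hK
          have h0 : 0 ≤ 22 / K := by positivity
          nlinarith
      _ = _ := one_mul _
  have h6 : |(K * τ)⁻¹ ^ 2 * reSym ζ ξ| ≤ qSym ζ (K * τ) ξ := by
    have hi : (K * τ)⁻¹ ≤ 1 := inv_le_one_of_one_le₀ (by nlinarith)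
    have hi0 : 0 < (K * τ)⁻¹ := by positivity
    refine abs_le_of_sq_le_sq ?_ (by linarith)
    have : (K * τ)⁻¹ ^ 2 * reSym ζ ξ ^ 2 ≤ qSym ζ (K * τ) ξ := by
      rw [F.qSym_eq, mul_add]
      have : 0 ≤ (K * τ)⁻¹ ^ 2 * (4 * τ ^ 2 * (inner ℝ ξ e) ^ 2) := by positivity
      linarith
    calc ((K * τ)⁻¹ ^ 2 * reSym ζ ξ) ^ 2 = (K * τ)⁻¹ ^ 2 * ((K * τ)⁻¹ ^ 2 * reSym ζ ξ ^ 2) := by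
          ring
      _ ≤ 1 * qSym ζ (K * τ) ξ := by
          refine mul_le_mul (by nlinarith) this (by positivity) zero_le_one
      _ ≤ _ := by nlinarith
  have h7 : ddq ζ e τ (K * τ) ξ = 2 * ((K * τ)⁻¹ ^ 2 * (4 * (inner ℝ ξ e) ^ 2 + 4 * τ ^ 2)) +
      4 * ((K * τ)⁻¹ ^ 2 * reSym ζ ξ) := by rw [ddq]; ring
  have h8 : 0 ≤ (K * τ)⁻¹ ^ 2 * (4 * (inner ℝ ξ e) ^ 2 + 4 * τ ^ 2) := by positivity
  rw [h7, abs_le]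
  rw [abs_le] at h6
  constructor <;> linarith [h6.1, h6.2]

/-- The smallness gained from K: the logarithmic derivative of T along e is at most 11/K, with 11 =
44/4 from the exponent -1/4. -/
theorem abs_dT_le (F : Frame ζ e τ) (hK : 1 ≤ K) (hKτ : K ≤ τ) (ξ : R3) :
    |dT ζ e τ (K * τ) ξ| ≤ 11 / K * mT ζ (K * τ) ξ := by
  have hq := qSym_pos ζ (K * τ) ξ
  have h1 := F.abs_dq_le hK hKτ ξ
  have h2 : qSym ζ (K * τ) ξ * qSym ζ (K * τ) ξ ^ (-5 / 4 : ℝ) = mT ζ (K * τ) ξ := by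
    rw [mT, ← Real.rpow_one_add' hq.le] <;> norm_num
  rw [dT, abs_mul, abs_mul, abs_of_pos (Real.rpow_pos_of_pos hq _)]
  calc _ ≤ |(-1 / 4 : ℝ)| * (44 / K * qSym ζ (K * τ) ξ) * qSym ζ (K * τ) ξ ^ (-5 / 4 : ℝ) := by
        gcongr
    _ = 11 / K * (qSym ζ (K * τ) ξ * qSym ζ (K * τ) ξ ^ (-5 / 4 : ℝ)) := by norm_num; ring
    _ = _ := by rw [h2]

/-- A bound without smallness suffices here. The second derivative enters the commutators with the
factor M² but without τ, so large τ absorbs it. -/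
theorem abs_ddT_le (F : Frame ζ e τ) (hK : 22 ≤ K) (hKτ : K ≤ τ) (ξ : R3) :
    |ddT ζ e τ (K * τ) ξ| ≤ 3 * mT ζ (K * τ) ξ := by
  have hq := qSym_pos ζ (K * τ) ξ
  have h1 := F.abs_dq_le (by linarith) hKτ ξ
  have h1' : |dq ζ e τ (K * τ) ξ| ≤ 2 * qSym ζ (K * τ) ξ := by
    refine h1.trans (mul_le_mul_of_nonneg_right ?_ hq.le)
    rw [div_le_iff₀ (by linarith)]; linarith
  have h2 : qSym ζ (K * τ) ξ * qSym ζ (K * τ) ξ ^ (-5 / 4 : ℝ) = mT ζ (K * τ) ξ := by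
    rw [mT, ← Real.rpow_one_add' hq.le] <;> norm_num
  have h3 : qSym ζ (K * τ) ξ ^ 2 * qSym ζ (K * τ) ξ ^ (-9 / 4 : ℝ) = mT ζ (K * τ) ξ := by
    rw [mT, ← Real.rpow_natCast, ← Real.rpow_add hq]; norm_num
  have h4 := F.abs_ddq_le hK hKτ ξ
  rw [ddT]
  refine (abs_add_le _ _).trans ?_
  rw [abs_mul, abs_mul, abs_mul, abs_mul, abs_pow, abs_of_pos (Real.rpow_pos_of_pos hq _),
    abs_of_pos (Real.rpow_pos_of_pos hq _)]
  calc _ ≤ |(-1 / 4 : ℝ)| * (6 * qSym ζ (K * τ) ξ) * qSym ζ (K * τ) ξ ^ (-5 / 4 : ℝ) +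
        |(5 / 16 : ℝ)| * (2 * qSym ζ (K * τ) ξ) ^ 2 * qSym ζ (K * τ) ξ ^ (-9 / 4 : ℝ) := by
        gcongr
    _ = 3 / 2 * (qSym ζ (K * τ) ξ * qSym ζ (K * τ) ξ ^ (-5 / 4 : ℝ)) +
        5 / 4 * (qSym ζ (K * τ) ξ ^ 2 * qSym ζ (K * τ) ξ ^ (-9 / 4 : ℝ)) := by norm_num; ring
    _ ≤ _ := by rw [h2, h3]; linarith [mT_pos ζ (K * τ) ξ]

/-- Along the line p_ζ is exactly quadratic, p + t ∂_e p + t², and each coefficient is at most Λ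
q^{1/2} for K ≥ 22. -/
theorem norm_p_line_le (F : Frame ζ e τ) (hK : 22 ≤ K) (hKτ : K ≤ τ) (ξ : R3) (t : ℝ) :
    ‖((K * τ : ℝ) : ℂ)⁻¹ * p ζ (ξ + t • e)‖ ≤ (1 + |t|) ^ 2 * qSym ζ (K * τ) ξ ^ (1 / 2 : ℝ) := by
  have hτ := F.one_le
  have hq1 := one_le_qSym ζ (K * τ) ξ
  set Q := qSym ζ (K * τ) ξ ^ (1 / 2 : ℝ) with hQ
  have hQ1 : 1 ≤ Q := Real.one_le_rpow hq1 (by norm_num)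
  have hQ2 : Q ^ 2 = qSym ζ (K * τ) ξ := by
    rw [hQ, ← Real.rpow_natCast, ← Real.rpow_mul (by linarith)]; norm_num
  have hpl : p ζ (ξ + t • e) = p ζ ξ + t * ((2 * inner ℝ ξ e : ℝ) - 2 * Complex.I * τ)
      + (t : ℂ) ^ 2 := by
    rw [F.p_eq, F.p_eq, F.reSym_line, F.inner_line]; push_cast; ring
  have h1 : ‖((K * τ : ℝ) : ℂ)⁻¹ * p ζ ξ‖ ≤ Q := by
    refine le_of_sq_le_sq ?_ (by linarith)
    rw [hQ2, qSym]; linarith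
  have h2 : ‖((K * τ : ℝ) : ℂ)⁻¹ * ((2 * inner ℝ ξ e : ℝ) - 2 * Complex.I * τ)‖ ≤ Q := by
    refine le_of_sq_le_sq ?_ (by linarith)
    rw [hQ2, norm_mul, mul_pow, Complex.sq_norm (_ - _), Complex.normSq_apply, norm_inv,
      Complex.norm_real, Real.norm_of_nonneg (by positivity)]
    have h3 := F.deriv_p_le (by linarith) hKτ ξ
    calc _ = (K * τ)⁻¹ ^ 2 * (4 * (inner ℝ ξ e) ^ 2 + 4 * τ ^ 2) := by simp; left; ring
      _ ≤ (K * τ)⁻¹ ^ 2 * (22 ^ 2 * τ ^ 2 * qSym ζ (K * τ) ξ) :=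
          mul_le_mul_of_nonneg_left h3 (by positivity)
      _ = (22 / K) ^ 2 * qSym ζ (K * τ) ξ := by field_simp
      _ ≤ 1 * qSym ζ (K * τ) ξ := by
          refine mul_le_mul_of_nonneg_right ?_ (by linarith)
          have : 22 / K ≤ 1 := by rw [div_le_one (by linarith)]; exact hK
          have h0 : 0 ≤ 22 / K := by positivity
          nlinarith
      _ = _ := one_mul _
  have h3 : ‖((K * τ : ℝ) : ℂ)⁻¹ * (t : ℂ) ^ 2‖ ≤ |t| ^ 2 * Q := by
    rw [norm_mul, norm_inv, Complex.norm_real, Real.norm_of_nonneg (by positivity), norm_pow,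
      Complex.norm_real, Real.norm_eq_abs]
    have hi : (K * τ)⁻¹ ≤ 1 := inv_le_one_of_one_le₀ (by nlinarith)
    calc _ ≤ 1 * |t| ^ 2 := by gcongr
      _ ≤ _ := by nlinarith [sq_nonneg |t|]
  have h4 : ((K * τ : ℝ) : ℂ)⁻¹ * p ζ (ξ + t • e) = ((K * τ : ℝ) : ℂ)⁻¹ * p ζ ξ +
      t * (((K * τ : ℝ) : ℂ)⁻¹ * ((2 * inner ℝ ξ e : ℝ) - 2 * Complex.I * τ)) +
      ((K * τ : ℝ) : ℂ)⁻¹ * (t : ℂ) ^ 2 := by rw [hpl]; ring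
  rw [h4]
  refine (norm_add₃_le).trans ?_
  rw [norm_mul (t : ℂ), Complex.norm_real, Real.norm_eq_abs]
  nlinarith [abs_nonneg t, mul_le_mul_of_nonneg_left h2 (abs_nonneg t)]

theorem qSym_line_le (F : Frame ζ e τ) (hK : 22 ≤ K) (hKτ : K ≤ τ) (ξ : R3) (t : ℝ) :
    qSym ζ (K * τ) (ξ + t • e) ^ (1 / 4 : ℝ) ≤
      2 * (1 + |t|) * qSym ζ (K * τ) ξ ^ (1 / 4 : ℝ) := by
  have hq1 := one_le_qSym ζ (K * τ) ξ
  have ht := abs_nonneg t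
  have h4 : ∀ {x : ℝ}, 0 < x → (x ^ (1 / 4 : ℝ)) ^ 4 = x := fun hx => by
    rw [← Real.rpow_natCast, ← Real.rpow_mul hx.le]; norm_num
  have h2 : (qSym ζ (K * τ) ξ ^ (1 / 2 : ℝ)) ^ 2 = qSym ζ (K * τ) ξ := by
    rw [← Real.rpow_natCast, ← Real.rpow_mul (by linarith)]; norm_num
  refine le_of_pow_le_pow_left₀ (n := 4) (by norm_num) (by positivity) ?_
  rw [mul_pow, h4 (qSym_pos _ _ _), h4 (qSym_pos _ _ _)]
  have h5 := pow_le_pow_left₀ (norm_nonneg _) (F.norm_p_line_le hK hKτ ξ t) 2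
  rw [mul_pow, h2] at h5
  have h6 : (1 : ℝ) ≤ (1 + |t|) ^ 4 := one_le_pow₀ (by linarith)
  rw [qSym]
  calc _ ≤ (1 + |t|) ^ 4 * qSym ζ (K * τ) ξ + ((1 + |t|) ^ 2) ^ 2 * qSym ζ (K * τ) ξ := by
        refine add_le_add ?_ h5
        nlinarith
    _ = 2 * ((1 + |t|) ^ 4 * qSym ζ (K * τ) ξ) := by ring
    _ ≤ 16 * ((1 + |t|) ^ 4 * qSym ζ (K * τ) ξ) := by
        have : 0 ≤ (1 + |t|) ^ 4 * qSym ζ (K * τ) ξ := by positivity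
        linarith
    _ = _ := by ring

theorem mT_eq_inv (ζ : C3) (Λ : ℝ) (ξ : R3) : mT ζ Λ ξ = (qSym ζ Λ ξ ^ (1 / 4 : ℝ))⁻¹ := by
  rw [mT, ← Real.rpow_neg (qSym_pos _ _ _).le]; norm_num

theorem mT_le_line (F : Frame ζ e τ) (hK : 22 ≤ K) (hKτ : K ≤ τ) (ξ : R3) (t : ℝ) :
    mT ζ (K * τ) ξ ≤ 2 * (1 + |t|) * mT ζ (K * τ) (ξ + t • e) := by
  have h := F.qSym_line_le hK hKτ ξ t
  have h1 := Real.rpow_pos_of_pos (qSym_pos ζ (K * τ) ξ) (1 / 4)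
  have h2 := Real.rpow_pos_of_pos (qSym_pos ζ (K * τ) (ξ + t • e)) (1 / 4)
  rw [mT_eq_inv, mT_eq_inv, ← div_eq_mul_inv, le_div_iff₀ h2, inv_mul_le_iff₀ h1]
  linarith

theorem norm_zeta_le (F : Frame ζ e τ) : ‖ζ‖ ≤ 2 * τ := by
  have hτ := F.one_le
  refine le_of_sq_le_sq ?_ (by positivity)
  rw [norm_sq_eq_re_im, F.re_eq, norm_smul, F.norm_e, Real.norm_of_nonneg (by positivity)]
  nlinarith [F.im_le]

/-- Both |ζ| and |p_ζ| are at most Kτ q^{1/2}. This smooth majorant may replace the weight of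
X^{1/2}, and its inverse is a minorant of the weight of X^{-1/2}, so an estimate in terms of it
implies the wanted one. -/
theorem weight_half_le (F : Frame ζ e τ) (hK : 22 ≤ K) (ξ : R3) :
    weight ζ (1 / 2) ξ ≤ √(2 * (K * τ)) * qSym ζ (K * τ) ξ ^ (1 / 4 : ℝ) := by
  have hτ := F.one_le
  have hq1 := one_le_qSym ζ (K * τ) ξ
  set Q := qSym ζ (K * τ) ξ ^ (1 / 2 : ℝ) with hQ
  have hQ1 : 1 ≤ Q := Real.one_le_rpow hq1 (by norm_num)
  have hQ2 : Q ^ 2 = qSym ζ (K * τ) ξ := by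
    rw [hQ, ← Real.rpow_natCast, ← Real.rpow_mul (by linarith)]; norm_num
  have h1 : ‖((K * τ : ℝ) : ℂ)⁻¹ * p ζ ξ‖ ≤ Q := by
    refine le_of_sq_le_sq ?_ (by linarith)
    rw [hQ2, qSym]; linarith
  rw [norm_mul, norm_inv, Complex.norm_real, Real.norm_of_nonneg (by positivity),
    inv_mul_le_iff₀ (by positivity)] at h1
  have h2 : ‖ζ‖ ≤ K * τ := F.norm_zeta_le.trans (by nlinarith)
  have h3 : ‖ζ‖ + ‖p ζ ξ‖ ≤ 2 * (K * τ) * Q := by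
    have : K * τ ≤ K * τ * Q := le_mul_of_one_le_right (by positivity) hQ1
    linarith
  have h4 : Q ^ (1 / 2 : ℝ) = qSym ζ (K * τ) ξ ^ (1 / 4 : ℝ) := by
    rw [hQ, ← Real.rpow_mul (by linarith)]; norm_num
  rw [weight, ← h4, Real.sqrt_eq_rpow, ← Real.mul_rpow (by positivity) (by linarith)]
  exact Real.rpow_le_rpow (by positivity) h3 (by norm_num)

end Frame

/-! ### Multiplication by a function of one variable in weighted spaces -/

/-- The constant bounding multiplication by `g(x·e)` in slowly varying weighted spaces. -/
def multConst (g : 𝓢(ℝ, ℂ)) : ℝ≥0∞ :=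
  ∫⁻ t, ‖𝓕 g t‖ₑ * ENNReal.ofReal ((1 + |2 * Real.pi * t|) ^ 2)

theorem multConst_lt_top (g : 𝓢(ℝ, ℂ)) : multConst g < ⊤ := by
  have h0 := (𝓕 g).integrable_pow_mul volume 0
  have h2 := (𝓕 g).integrable_pow_mul volume 2
  have hi : Integrable (fun t : ℝ => ‖𝓕 g t‖ * (1 + |2 * Real.pi * t|) ^ 2) := by
    refine Integrable.mono' ((h0.const_mul 2).add (h2.const_mul (2 * (2 * Real.pi) ^ 2))) ?_ ?_
    · exact ((𝓕 g).continuous.norm.mul (by fun_prop)).aestronglyMeasurable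
    · refine .of_forall fun t => ?_
      rw [Real.norm_of_nonneg (by positivity)]
      simp only [Pi.add_apply, pow_zero, one_mul, Real.norm_eq_abs]
      rw [abs_mul, abs_of_pos (by positivity : 0 < 2 * Real.pi)]
      have := norm_nonneg (𝓕 g t)
      have h3 : (1 + 2 * Real.pi * |t|) ^ 2 ≤ 2 + 2 * (2 * Real.pi) ^ 2 * |t| ^ 2 := by
        nlinarith [sq_nonneg (1 - 2 * Real.pi * |t|)]
      nlinarith [mul_le_mul_of_nonneg_left h3 this]
  have := hi.lintegral_lt_top
  refine lt_of_eq_of_lt (lintegral_congr fun t => ?_) this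
  rw [ENNReal.ofReal_mul (norm_nonneg _), ofReal_norm]

/-- The function `x ↦ g (x·e)`. -/
def alongDir (g : 𝓢(ℝ, ℂ)) (e : R3) (x : R3) : ℂ := g (inner ℝ x e)

theorem hasTemperateGrowth_alongDir (g : 𝓢(ℝ, ℂ)) (e : R3) :
    (alongDir g e).HasTemperateGrowth := by
  have := g.hasTemperateGrowth
  unfold alongDir
  exact this.comp (Function.hasTemperateGrowth_inner_left e)

/-- Fourier inversion writes g(x·e) as a superposition of characters e^{2πi t x·e}, and each
character translates the transform by 2πt e. -/
theorem ft_alongDir_mul (g : 𝓢(ℝ, ℂ)) (e : R3) (φ : 𝓢(R3, ℂ)) (ξ : R3) :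
    ft (smulLeftCLM ℂ (alongDir g e) φ) ξ = ∫ t : ℝ, 𝓕 g t * ft φ (ξ + (2 * Real.pi * t) • e) := by
  have hg : ∀ s : ℝ, g s = ∫ t : ℝ, Complex.exp (Complex.I * (2 * Real.pi * t * s : ℝ)) * 𝓕 g t := by
    intro s
    have h1 : g s = (𝓕⁻ (𝓕 g)) s := by rw [FourierTransform.fourierInv_fourier_eq]
    rw [h1, fourierInv_coe, Real.fourierInv_eq']
    refine integral_congr_ae (.of_forall fun t => ?_)
    simp only [smul_eq_mul, RCLike.inner_apply, conj_trivial]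
    congr 2
    push_cast; ring
  have hint : Integrable (fun z : R3 × ℝ =>
      Complex.exp (Complex.I * (inner ℝ z.1 ξ + 2 * Real.pi * z.2 * inner ℝ z.1 e : ℝ)) *
        (φ z.1 * 𝓕 g z.2)) := by
    have h := φ.integrable (μ := volume) |>.mul_prod ((𝓕 g).integrable (μ := volume))
    refine h.bdd_mul (c := 1) (f := fun z : R3 × ℝ =>
      Complex.exp (Complex.I * (inner ℝ z.1 ξ + 2 * Real.pi * z.2 * inner ℝ z.1 e : ℝ))) ?_ ?_
    · exact Continuous.aestronglyMeasurable (by fun_prop)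
    · refine .of_forall fun z => ?_
      rw [mul_comm, Complex.norm_exp_ofReal_mul_I]
  rw [ft_apply]
  calc _ = ∫ x : R3, ∫ t : ℝ,
        Complex.exp (Complex.I * (inner ℝ x ξ + 2 * Real.pi * t * inner ℝ x e : ℝ)) *
          (φ x * 𝓕 g t) := by
        refine integral_congr_ae (.of_forall fun x => ?_)
        simp only [smulLeftCLM_apply_apply (hasTemperateGrowth_alongDir g e), alongDir, smul_eq_mul]
        rw [hg, ← integral_mul_const, ← integral_const_mul]
        refine integral_congr_ae (.of_forall fun t => ?_)
        simp only [Complex.ofReal_add, mul_add, Complex.exp_add]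
        ring
    _ = ∫ t : ℝ, ∫ x : R3,
        Complex.exp (Complex.I * (inner ℝ x ξ + 2 * Real.pi * t * inner ℝ x e : ℝ)) *
          (φ x * 𝓕 g t) := integral_integral_swap hint
    _ = _ := by
        refine integral_congr_ae (.of_forall fun t => ?_)
        simp only [ft_apply, ← integral_const_mul]
        refine integral_congr_ae (.of_forall fun x => ?_)
        simp only [inner_add_right, inner_smul_right]
        ring

theorem lintegral_sq_le {ν : Measure ℝ} {f : ℝ → ℝ≥0∞} (hf : AEMeasurable f ν) :
    (∫⁻ t, f t ∂ν) ^ 2 ≤ ν Set.univ * ∫⁻ t, f t ^ 2 ∂ν := by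
  have h := ENNReal.lintegral_mul_le_Lp_mul_Lq ν Real.HolderConjugate.two_two
    (f := fun _ => 1) aemeasurable_const hf
  simp only [Pi.mul_apply, one_mul, ENNReal.one_rpow, lintegral_one] at h
  refine (pow_le_pow_left₀ zero_le h 2).trans_eq ?_
  have h2 : ∀ x : ℝ≥0∞, (x ^ (1 / 2 : ℝ)) ^ 2 = x := fun x => by
    rw [← ENNReal.rpow_natCast, ← ENNReal.rpow_mul]; norm_num
  rw [mul_pow, h2, h2]
  simp only [ENNReal.rpow_two]

/-- Slow variation moves W across each translation at the price C(1 + |2πt|)², after which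
translations preserve L². The prices, weighted by |𝓕 g|, add up to `multConst g`. -/
theorem lintegral_alongDir_le (g : 𝓢(ℝ, ℂ)) (e : R3) {W : R3 → ℝ} (hW : Measurable W)
    (hW0 : ∀ ξ, 0 ≤ W ξ) {C : ℝ} (hC : 0 ≤ C)
    (hslow : ∀ ξ (t : ℝ), W ξ ≤ C * (1 + |t|) ^ 2 * W (ξ + t • e)) (φ : 𝓢(R3, ℂ)) :
    ∫⁻ ξ, ‖(W ξ : ℂ) * ft (smulLeftCLM ℂ (alongDir g e) φ) ξ‖ₑ ^ 2 ≤
      (ENNReal.ofReal C * multConst g) ^ 2 * ∫⁻ ξ, ‖(W ξ : ℂ) * ft φ ξ‖ₑ ^ 2 := by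
  set k : ℝ → ℝ≥0∞ := fun t => ‖𝓕 g t‖ₑ * ENNReal.ofReal ((1 + |2 * Real.pi * t|) ^ 2) with hk
  have hkm : Measurable k :=
    ((𝓕 g).continuous.enorm.measurable).mul (by fun_prop)
  -- The growth factor is put into the measure. Cauchy–Schwarz against its total mass yields one
  -- factor `multConst g`, and Tonelli with translation invariance yields the other.
  set ν : Measure ℝ := volume.withDensity k with hν
  have hνu : ν Set.univ = multConst g := by simp [hν, multConst, hk]
  set Fn : R3 → ℝ≥0∞ := fun ξ => ‖(W ξ : ℂ) * ft φ ξ‖ₑ with hF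
  have hFm : Measurable Fn := by
    have := (ft φ).continuous.measurable
    fun_prop
  have hpt : ∀ ξ, ‖(W ξ : ℂ) * ft (smulLeftCLM ℂ (alongDir g e) φ) ξ‖ₑ ≤
      ENNReal.ofReal C * ∫⁻ t, Fn (ξ + (2 * Real.pi * t) • e) ∂ν := by
    intro ξ
    rw [hν, lintegral_withDensity_eq_lintegral_mul _ hkm (by fun_prop),
      ← lintegral_const_mul _ (by fun_prop), ft_alongDir_mul, ← integral_const_mul]
    refine (enorm_integral_le_lintegral_enorm _).trans (lintegral_mono fun t => ?_)
    simp only [Pi.mul_apply, hk, hF, enorm_mul]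
    have h1 : ‖(W ξ : ℂ)‖ₑ ≤ ENNReal.ofReal C * ENNReal.ofReal ((1 + |2 * Real.pi * t|) ^ 2) *
        ‖(W (ξ + (2 * Real.pi * t) • e) : ℂ)‖ₑ := by
      have h2 : ∀ x, ‖(W x : ℂ)‖ₑ = ENNReal.ofReal (W x) := fun x => by
        rw [← ofReal_norm, Complex.norm_real, Real.norm_of_nonneg (hW0 x)]
      rw [h2, h2, ← ENNReal.ofReal_mul hC, ← ENNReal.ofReal_mul (by positivity)]
      exact ENNReal.ofReal_le_ofReal (hslow ξ _)
    calc _ ≤ _ := mul_le_mul_left h1 _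
      _ = _ := by ring
  calc _ ≤ ∫⁻ ξ, ENNReal.ofReal C ^ 2 * (multConst g *
        ∫⁻ t, Fn (ξ + (2 * Real.pi * t) • e) ^ 2 ∂ν) := by
        refine lintegral_mono fun ξ => ?_
        refine (pow_le_pow_left₀ zero_le (hpt ξ) 2).trans ?_
        rw [mul_pow, ← hνu]
        exact mul_le_mul_right (lintegral_sq_le (by fun_prop)) _
    _ = ENNReal.ofReal C ^ 2 * (multConst g *
        ∫⁻ ξ, ∫⁻ t, Fn (ξ + (2 * Real.pi * t) • e) ^ 2 ∂ν) := by
        have hsf : SFinite ν := by rw [hν]; infer_instance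
        have hm : Measurable fun ξ => ∫⁻ t, Fn (ξ + (2 * Real.pi * t) • e) ^ 2 ∂ν := by
          refine Measurable.lintegral_prod_right' (f := fun z : R3 × ℝ =>
            Fn (z.1 + (2 * Real.pi * z.2) • e) ^ 2) ?_
          exact (hFm.comp (by fun_prop)).pow_const 2
        rw [lintegral_const_mul _ (by fun_prop), lintegral_const_mul _ hm]
    _ = ENNReal.ofReal C ^ 2 * (multConst g *
        ∫⁻ t, (∫⁻ ξ, Fn (ξ + (2 * Real.pi * t) • e) ^ 2) ∂ν) := by
        have hsf : SFinite ν := by rw [hν]; infer_instance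
        rw [lintegral_lintegral_swap]
        exact ((hFm.comp (by fun_prop)).pow_const 2).aemeasurable
    _ = ENNReal.ofReal C ^ 2 * (multConst g * (multConst g * ∫⁻ ξ, Fn ξ ^ 2)) := by
        have : ∀ t : ℝ, ∫⁻ ξ, Fn (ξ + (2 * Real.pi * t) • e) ^ 2 = ∫⁻ ξ, Fn ξ ^ 2 := fun t =>
          lintegral_add_right_eq_self (fun ξ => Fn ξ ^ 2) _
        simp only [this, lintegral_const, hνu]
        ring
    _ = _ := by ring

theorem norm_emb_sq_eq_lintegral (w : Schwartz8) :
    ENNReal.ofReal (‖emb w‖ ^ 2) = ∑ j, ∫⁻ x, ‖w j x‖ₑ ^ 2 := by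
  rw [norm_emb_sq_eq_integral, ENNReal.ofReal_sum_of_nonneg
    fun j _ => integral_nonneg fun x => sq_nonneg _]
  refine Finset.sum_congr rfl fun j _ => ?_
  rw [ofReal_integral_eq_lintegral_ofReal (integrable_norm_sq _) (.of_forall fun x => sq_nonneg _)]
  refine lintegral_congr fun x => ?_
  rw [ENNReal.ofReal_pow (norm_nonneg _), ofReal_norm]

/-- Multiplication by `g(x·e)` is bounded in weighted spaces with weights varying slowly in the
direction `e`. -/
theorem norm_alongDir_le (g : 𝓢(ℝ, ℂ)) (e : R3) {W : R3 → ℝ} (hW : W.HasTemperateGrowth)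
    (hW0 : ∀ ξ, 0 ≤ W ξ) {C : ℝ} (hC : 0 ≤ C)
    (hslow : ∀ ξ (t : ℝ), W ξ ≤ C * (1 + |t|) ^ 2 * W (ξ + t • e)) (v : Schwartz8) :
    ‖emb (mulOp (fun ξ => (W ξ : ℂ)) (ftOp (mulOp (alongDir g e) v)))‖ ≤
      C * (multConst g).toReal * ‖emb (mulOp (fun ξ => (W ξ : ℂ)) (ftOp v))‖ := by
  have hWc : (fun ξ => (W ξ : ℂ)).HasTemperateGrowth := by fun_prop
  refine le_of_sq_le_sq ?_ (by positivity)
  refine (ENNReal.ofReal_le_ofReal_iff (by positivity)).1 ?_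
  rw [mul_pow, ENNReal.ofReal_mul (by positivity), norm_emb_sq_eq_lintegral,
    norm_emb_sq_eq_lintegral, ENNReal.ofReal_pow (by positivity), ENNReal.ofReal_mul hC,
    ENNReal.ofReal_toReal (multConst_lt_top g).ne, Finset.mul_sum]
  refine Finset.sum_le_sum fun j _ => ?_
  have := lintegral_alongDir_le g e hW.1.continuous.measurable hW0 hC hslow (v j)
  simpa only [mulOp_apply hWc] using! this

/-! ### The Carleman estimate on the Fourier side -/

/-- Multiplication by `x·e`, on the Fourier side. -/
def posOp (e : R3) : Module.End ℂ Schwartz8 := (-Complex.I) • dirOp e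

/-- The derivative in the direction `e`, on the Fourier side. -/
def derOp (e : R3) : Module.End ℂ Schwartz8 :=
  mulOp fun ξ => -Complex.I * (inner ℝ ξ e : ℝ)

theorem derOp_apply (e : R3) (w : Schwartz8) (j : Fin 8) (ξ : R3) :
    derOp e w j ξ = -Complex.I * (inner ℝ ξ e : ℝ) * w j ξ :=
  mulOp_apply (by fun_prop) w j ξ

theorem posOp_apply (e : R3) (w : Schwartz8) : posOp e w = (-Complex.I) • dirOp e w := rfl

theorem posOp_formalAdjoint (e : R3) : FormalAdjoint emb (posOp e) (posOp e) := fun v w => by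
  simp only [posOp_apply, map_smul, inner_smul_left, inner_smul_right, dirOp_formalAdjoint e v w,
    LinearMap.neg_apply, map_neg, inner_neg_right, Complex.conj_I]
  ring

theorem derOp_formalAdjoint (e : R3) : FormalAdjoint emb (derOp e) (-derOp e) := by
  have h : -derOp e = mulOp fun ξ => Complex.I * (inner ℝ ξ e : ℝ) := by
    refine LinearMap.ext fun w => funext fun j => SchwartzMap.ext fun ξ => ?_
    rw [mulOp_apply (by fun_prop), LinearMap.neg_apply, Pi.neg_apply, neg_apply, derOp_apply]
    ring
  rw [h]
  exact mulOp_formalAdjoint (by fun_prop) (by fun_prop) fun x => by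
    simp [Complex.conj_ofReal]

theorem fderiv_inner_dir {e : R3} (he : ‖e‖ = 1) (ξ : R3) :
    fderiv ℝ (fun y : R3 => -Complex.I * ((inner ℝ y e : ℝ) : ℂ)) ξ e = -Complex.I := by
  have h1 : fderiv ℝ (fun y : R3 => ((inner ℝ y e : ℝ) : ℂ)) ξ e = (1 : ℝ) := by
    refine fderiv_eq_of_line (by fun_prop) ?_
    have : (fun t : ℝ => inner ℝ (ξ + t • e) e) = fun t => inner ℝ ξ e + t := by
      funext t
      rw [inner_add_left, inner_smul_left, real_inner_self_eq_norm_sq, he]; simp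
    rw [this]
    exact (hasDerivAt_id (0 : ℝ)).const_add _
  have hd : DifferentiableAt ℝ (fun y : R3 => ((inner ℝ y e : ℝ) : ℂ)) ξ :=
    ((hasTemperateGrowth_coord e).1.differentiable (by simp)).differentiableAt
  rw [fderiv_const_mul hd, smul_apply, h1]
  simp

theorem derOp_posOp {e : R3} (he : ‖e‖ = 1) : derOp e * posOp e = posOp e * derOp e + 1 := by
  refine LinearMap.ext fun w => ?_
  have h := dirOp_mulOp (m := fun ξ => -Complex.I * (inner ℝ ξ e : ℝ)) (m' := fun _ => -Complex.I)
    (by fun_prop) (by fun_prop) (fderiv_inner_dir he) w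
  have h2 : mulOp (fun _ => -Complex.I) w = (-Complex.I) • w := by
    ext j x
    rw [mulOp_apply (by fun_prop)]; rfl
  simp only [Module.End.mul_apply, LinearMap.add_apply, Module.End.one_apply, posOp_apply, map_smul]
  rw [derOp, h, h2, smul_add, smul_smul]
  simp

namespace Frame

variable {ζ : C3} {e : R3} {τ K M : ℝ}

/-- The part of the symbol `p_ζ` that does not depend on the frequency in the direction `e`. -/
def transSym (ζ : C3) (e : R3) (ξ : R3) : ℝ := reSym ζ ξ - (inner ℝ ξ e) ^ 2

theorem hasTemperateGrowth_transSym (ζ : C3) (e : R3) : (transSym ζ e).HasTemperateGrowth := by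
  have := hasTemperateGrowth_reSym ζ
  unfold transSym; fun_prop

theorem transSym_posOp (F : Frame ζ e τ) :
    mulOp (fun ξ => (transSym ζ e ξ : ℂ)) * posOp e =
      posOp e * mulOp (fun ξ => (transSym ζ e ξ : ℂ)) := by
  have ht := hasTemperateGrowth_transSym ζ e
  refine LinearMap.ext fun w => ?_
  have h0 : ∀ ξ, fderiv ℝ (fun y => (transSym ζ e y : ℂ)) ξ e = 0 := fun ξ => by
    have := fderiv_eq_of_line (x := ξ) (e := e) (m' := 0) ht (by
      have : (fun t : ℝ => transSym ζ e (ξ + t • e)) = fun _ => transSym ζ e ξ := by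
        funext t
        rw [transSym, transSym, F.reSym_line, F.inner_line]; ring
      rw [this]
      exact hasDerivAt_const _ _)
    simpa using this
  have h := dirOp_mulOp (m := fun ξ => (transSym ζ e ξ : ℂ)) (m' := fun _ => 0)
    (by fun_prop) (by fun_prop) h0 w
  have h2 : mulOp (fun _ => 0) w = 0 := by
    ext j x
    rw [mulOp_apply (by fun_prop)]; simp
  simp only [Module.End.mul_apply, posOp_apply, map_smul, h, h2, add_zero]

theorem transSym_derOp (ζ : C3) (e : R3) :
    mulOp (fun ξ => (transSym ζ e ξ : ℂ)) * derOp e =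
      derOp e * mulOp (fun ξ => (transSym ζ e ξ : ℂ)) := by
  have ht := hasTemperateGrowth_transSym ζ e
  refine LinearMap.ext fun w => funext fun j => SchwartzMap.ext fun ξ => ?_
  simp only [Module.End.mul_apply]
  rw [mulOp_apply (by fun_prop), derOp_apply, derOp_apply, mulOp_apply (by fun_prop)]
  ring

/-- The convexified operator, on the Fourier side. -/
def convexOp (ζ : C3) (e : R3) (τ M : ℝ) (w w₁ w₂ : Schwartz8) : Schwartz8 :=
  mulOp (p ζ) w + (2 * M : ℂ) • derOp e w₁ - (M : ℂ) • w - (M ^ 2 : ℂ) • w₂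
    - (2 * τ * M : ℂ) • w₁

/-- The last two arguments of `convexOp` stand for s w and s² w, and here they really are these.
Keeping them separate allows T to be applied after s instead of before; the discrepancy is then a
commutator. -/
theorem carleman_convexOp (F : Frame ζ e τ) (M : ℝ) (w : Schwartz8) :
    8 * M * (‖emb (derOp e w)‖ ^ 2 + ‖emb ((τ : ℂ) • w + (M : ℂ) • posOp e w)‖ ^ 2) ≤
      ‖emb (convexOp ζ e τ M w (posOp e w) (posOp e (posOp e w)))‖ ^ 2 := by
  have ht := hasTemperateGrowth_transSym ζ e
  have h := carleman_abstract emb (D := derOp e) (X := posOp e)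
    (S := mulOp fun ξ => (transSym ζ e ξ : ℂ)) τ M (derOp_formalAdjoint e) (posOp_formalAdjoint e)
    (mulOp_formalAdjoint (by fun_prop) (by fun_prop) fun x => Complex.conj_ofReal _)
    (derOp_posOp F.norm_e) (transSym_derOp ζ e) F.transSym_posOp w
  have hp : mulOp (p ζ) w = mulOp (fun ξ => (transSym ζ e ξ : ℂ)) w - derOp e (derOp e w)
      + (2 * τ : ℂ) • derOp e w := by
    ext j ξ
    simp only [Pi.add_apply, Pi.sub_apply, Pi.smul_apply, add_apply, sub_apply, smul_apply]
    rw [mulOp_apply (hasTemperateGrowth_p ζ), mulOp_apply (by fun_prop), derOp_apply, derOp_apply,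
      F.p_eq, transSym]
    simp only [smul_eq_mul]
    push_cast
    linear_combination ((inner ℝ ξ e : ℝ) : ℂ) ^ 2 * w j ξ * Complex.I_sq
  rw [convexOp, hp]
  exact h

theorem posOp_mT (F : Frame ζ e τ) (Λ : ℝ) (V : Schwartz8) :
    posOp e (mulOp (fun ξ => (mT ζ Λ ξ : ℂ)) V) =
      mulOp (fun ξ => (mT ζ Λ ξ : ℂ)) (posOp e V) +
        (-Complex.I) • mulOp (fun ξ => (dT ζ e τ Λ ξ : ℂ)) V := by
  have h1 := hasTemperateGrowth_mT ζ Λ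
  have h2 := hasTemperateGrowth_dT ζ e τ Λ
  rw [posOp_apply, dirOp_mulOp (by fun_prop) (by fun_prop) (F.fderiv_mT Λ), smul_add, posOp_apply,
    map_smul]

theorem posOp_dT (F : Frame ζ e τ) (Λ : ℝ) (V : Schwartz8) :
    posOp e (mulOp (fun ξ => (dT ζ e τ Λ ξ : ℂ)) V) =
      mulOp (fun ξ => (dT ζ e τ Λ ξ : ℂ)) (posOp e V) +
        (-Complex.I) • mulOp (fun ξ => (ddT ζ e τ Λ ξ : ℂ)) V := by
  have h1 := hasTemperateGrowth_dT ζ e τ Λ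
  have h2 := hasTemperateGrowth_ddT ζ e τ Λ
  rw [posOp_apply, dirOp_mulOp (by fun_prop) (by fun_prop) (F.fderiv_dT Λ), smul_add, posOp_apply,
    map_smul]

theorem norm_dT_mul_le (F : Frame ζ e τ) (hK : 1 ≤ K) (hKτ : K ≤ τ) (V : Schwartz8) (j : Fin 8)
    (ξ : R3) : ‖mulOp (fun ξ => (dT ζ e τ (K * τ) ξ : ℂ)) V j ξ‖ ≤
      11 / K * ‖mulOp (fun ξ => (mT ζ (K * τ) ξ : ℂ)) V j ξ‖ := by
  have h1 := hasTemperateGrowth_mT ζ (K * τ)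
  have h2 := hasTemperateGrowth_dT ζ e τ (K * τ)
  rw [mulOp_apply (by fun_prop), mulOp_apply (by fun_prop), norm_mul, norm_mul, ← mul_assoc,
    Complex.norm_real, Complex.norm_real, Real.norm_eq_abs, Real.norm_of_nonneg (mT_pos _ _ _).le]
  exact mul_le_mul_of_nonneg_right (F.abs_dT_le hK hKτ ξ) (norm_nonneg _)

theorem norm_ddT_mul_le (F : Frame ζ e τ) (hK : 22 ≤ K) (hKτ : K ≤ τ) (V : Schwartz8) (j : Fin 8)
    (ξ : R3) : ‖mulOp (fun ξ => (ddT ζ e τ (K * τ) ξ : ℂ)) V j ξ‖ ≤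
      3 * ‖mulOp (fun ξ => (mT ζ (K * τ) ξ : ℂ)) V j ξ‖ := by
  have h1 := hasTemperateGrowth_mT ζ (K * τ)
  have h2 := hasTemperateGrowth_ddT ζ e τ (K * τ)
  rw [mulOp_apply (by fun_prop), mulOp_apply (by fun_prop), norm_mul, norm_mul, ← mul_assoc,
    Complex.norm_real, Complex.norm_real, Real.norm_eq_abs, Real.norm_of_nonneg (mT_pos _ _ _).le]
  exact mul_le_mul_of_nonneg_right (F.abs_ddT_le hK hKτ ξ) (norm_nonneg _)

/-- The numerical core. B is the norm of the convexified operator on T V and y that of T applied to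
the convexified operator on V. The three commutator errors take 1/12, 1/4 and 1/6 of B, so B ≤ 2y.
The first and third use √M · 11/K ≤ 1/12, hence 132 = 11 · 12; the second uses that τ is large. -/
theorem carleman_absorb {C₁ C₂ C₃ : ℝ} (hC₁ : 0 ≤ C₁) (hC₃ : 0 ≤ C₃)
    (hM : 1 ≤ M) (hK : 132 * M ≤ K) (hK' : M * (3 + 6 * C₃ + 4 * C₁) ≤ K)
    (hτ : 0 ≤ τ) (hτ₁ : 4 * M ^ 2 * (3 + 2 * C₁) ≤ τ) (hτ₂ : M + M ^ 2 * C₂ ≤ τ)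
    {n nD nΦ B y np : ℝ} (hn0 : 0 ≤ n) (hnD0 : 0 ≤ nD) (hB0 : 0 ≤ B) (hY0 : 0 ≤ y)
    (hcar : 8 * M * (nD ^ 2 + nΦ ^ 2) ≤ B ^ 2) (h1 : τ * n ≤ nΦ + M * ((C₁ + 1) * n))
    (hBy : B ≤ y + (2 * M * (11 / K * nD) + M ^ 2 * (2 * (C₁ * n) + 3 * n)
        + 2 * τ * M * (11 / K * n)))
    (i5 : np ≤ y + (2 * M * (C₃ * (nD + τ * n)) + M * n + M ^ 2 * (C₂ * n)
      + 2 * τ * M * (C₁ * n))) :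
    √M * (τ * n + np / K) ≤ 3 * y := by
  have hK0 : 0 < K := by linarith
  set r := √M with hr
  have hr1 : 1 ≤ r := Real.one_le_sqrt.2 hM
  have hr2 : r ^ 2 = M := Real.sq_sqrt (by linarith)
  have hr0 : 0 ≤ r := by linarith
  have hM0 : 0 ≤ M := by linarith
  have hτn : 0 ≤ τ * n := mul_nonneg hτ hn0
  have p1 := mul_nonneg hM0 (sq_nonneg nD)
  have p2 := mul_nonneg hM0 (sq_nonneg nΦ)
  have i1 : 2 * r * nD ≤ B := by
    refine le_of_sq_le_sq ?_ hB0
    rw [mul_pow, mul_pow, hr2]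
    linarith
  have i2 : 2 * r * nΦ ≤ B := by
    refine le_of_sq_le_sq ?_ hB0
    rw [mul_pow, mul_pow, hr2]
    linarith
  have i3 : r * (τ * n) ≤ B := by
    have h2 : 2 * (M * (C₁ + 1)) ≤ τ := by
      have : M * (C₁ + 1) ≤ M ^ 2 * (3 + 2 * C₁) := by
        rw [sq, mul_assoc]
        refine mul_le_mul_of_nonneg_left ?_ hM0
        nlinarith
      nlinarith
    have h3 : τ * n ≤ 2 * nΦ := by
      have : 2 * (M * (C₁ + 1)) * n ≤ τ * n := mul_le_mul_of_nonneg_right h2 hn0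
      linarith
    have := mul_le_mul_of_nonneg_left h3 hr0
    linarith
  have i3' : τ * n ≤ B := (le_mul_of_one_le_left hτn hr1).trans i3
  have i4 : B ≤ 2 * y := by
    have hrδ : r * (11 / K) ≤ 1 / 12 := by
      rw [← mul_div_assoc, div_le_iff₀ hK0]
      nlinarith
    have h2 : 2 * M * (11 / K * nD) ≤ 1 / 12 * B := by
      calc 2 * M * (11 / K * nD) = (r * (11 / K)) * (2 * r * nD) := by rw [← hr2]; ring
        _ ≤ (1 / 12) * B := by gcongr
    have h3 : 2 * τ * M * (11 / K * n) ≤ 1 / 6 * B := by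
      calc 2 * τ * M * (11 / K * n) = 2 * (r * (11 / K)) * (r * (τ * n)) := by rw [← hr2]; ring
        _ ≤ 2 * (1 / 12) * B := by gcongr
        _ = _ := by ring
    have h4 : M ^ 2 * (2 * (C₁ * n) + 3 * n) ≤ 1 / 4 * B := by
      have := mul_le_mul_of_nonneg_right hτ₁ hn0
      linarith
    linarith
  -- The term p w is recovered from the equation itself, every other term of `convexOp` being
  -- already controlled by B.
  have i6 : np ≤ r * (3 + 6 * C₃ + 4 * C₁) * y := by
    have h1 : 2 * M * (C₃ * (nD + τ * n)) ≤ 3 * r * C₃ * B := by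
      calc _ = r * C₃ * (2 * r * nD + 2 * (r * (τ * n))) := by rw [← hr2]; ring
        _ ≤ r * C₃ * (B + 2 * B) := by gcongr
        _ = _ := by ring
    have h2 : M * n + M ^ 2 * (C₂ * n) ≤ B := by
      have := mul_le_mul_of_nonneg_right hτ₂ hn0
      linarith
    have h3 : 2 * τ * M * (C₁ * n) ≤ 2 * r * C₁ * B := by
      calc _ = 2 * r * C₁ * (r * (τ * n)) := by rw [← hr2]; ring
        _ ≤ _ := by gcongr
    have h4 : 3 * r * C₃ * B ≤ 3 * r * C₃ * (2 * y) := by gcongr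
    have h5 : 2 * r * C₁ * B ≤ 2 * r * C₁ * (2 * y) := by gcongr
    have h6 : y ≤ r * y := le_mul_of_one_le_left hY0 hr1
    linarith
  -- Keeping only |p|/K lets K ≥ M(3 + 6C₃ + 4C₁) absorb the factor √M · √M.
  have i7 : r * (np / K) ≤ y := by
    rw [← mul_div_assoc, div_le_iff₀ hK0]
    calc _ ≤ r * (r * (3 + 6 * C₃ + 4 * C₁) * y) := by gcongr
      _ = (M * (3 + 6 * C₃ + 4 * C₁)) * y := by rw [← hr2]; ring
      _ ≤ _ := by rw [mul_comm y]; gcongr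
  rw [mul_add]
  linarith

theorem norm_emb_nonneg (x : Schwartz8) : 0 ≤ ‖emb x‖ := norm_nonneg (emb x)

theorem norm_emb_ofReal_smul {c : ℝ} (hc : 0 ≤ c) (x : Schwartz8) :
    ‖emb ((c : ℂ) • x)‖ = c * ‖emb x‖ := by
  rw [map_smul, norm_smul, Complex.norm_real, Real.norm_of_nonneg hc]

theorem norm_convexOp_sub_le (hτ : 0 ≤ τ) (hM : 0 ≤ M) (w w₁ w₂ x₁ x₂ : Schwartz8) :
    ‖emb (convexOp ζ e τ M w x₁ x₂)‖ ≤ ‖emb (convexOp ζ e τ M w w₁ w₂)‖ +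
      (2 * M * ‖emb (derOp e (x₁ - w₁))‖ + M ^ 2 * ‖emb (x₂ - w₂)‖
        + 2 * τ * M * ‖emb (x₁ - w₁)‖) := by
  have h : convexOp ζ e τ M w x₁ x₂ = convexOp ζ e τ M w w₁ w₂ +
      (((2 * M : ℝ) : ℂ) • derOp e (x₁ - w₁) - ((M ^ 2 : ℝ) : ℂ) • (x₂ - w₂)
        - ((2 * τ * M : ℝ) : ℂ) • (x₁ - w₁)) := by
    simp only [convexOp, map_sub]
    push_cast
    module
  rw [h, map_add]
  refine (norm_add_le _ _).trans (add_le_add_right ?_ _)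
  rw [map_sub, map_sub]
  refine (norm_sub_le _ _).trans (add_le_add ((norm_sub_le _ _).trans (add_le_add ?_ ?_)) ?_)
  · rw [norm_emb_ofReal_smul (by positivity)]
  · rw [norm_emb_ofReal_smul (by positivity)]
  · rw [norm_emb_ofReal_smul (by positivity)]

theorem norm_mulOp_p_le (hτ : 0 ≤ τ) (hM : 0 ≤ M) (w w₁ w₂ : Schwartz8) :
    ‖emb (mulOp (p ζ) w)‖ ≤ ‖emb (convexOp ζ e τ M w w₁ w₂)‖ +
      (2 * M * ‖emb (derOp e w₁)‖ + M * ‖emb w‖ + M ^ 2 * ‖emb w₂‖ + 2 * τ * M * ‖emb w₁‖) := by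
  have h : mulOp (p ζ) w = convexOp ζ e τ M w w₁ w₂ -
      (((2 * M : ℝ) : ℂ) • derOp e w₁ - (M : ℂ) • w - ((M ^ 2 : ℝ) : ℂ) • w₂
        - ((2 * τ * M : ℝ) : ℂ) • w₁) := by
    rw [convexOp]
    push_cast
    abel
  rw [h, map_sub]
  refine (norm_sub_le _ _).trans (add_le_add_right ?_ _)
  rw [map_sub, map_sub, map_sub]
  refine (norm_sub_le _ _).trans (add_le_add ((norm_sub_le _ _).trans (add_le_add
    ((norm_sub_le _ _).trans (add_le_add ?_ ?_)) ?_)) ?_)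
  · rw [norm_emb_ofReal_smul (by positivity)]
  · rw [norm_emb_ofReal_smul (by positivity)]
  · rw [norm_emb_ofReal_smul (by positivity)]
  · rw [norm_emb_ofReal_smul (by positivity)]

/-- The commutators of the position operator with the multiplier `T` are small. -/
theorem commutator_bounds (F : Frame ζ e τ) (hK1 : 22 ≤ K) (hKτ : K ≤ τ)
    {V w w₁ w₂ : Schwartz8} (hw : w = mulOp (fun ξ => (mT ζ (K * τ) ξ : ℂ)) V)
    (hw₁ : w₁ = mulOp (fun ξ => (mT ζ (K * τ) ξ : ℂ)) (posOp e V))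
    (hw₂ : w₂ = mulOp (fun ξ => (mT ζ (K * τ) ξ : ℂ)) (posOp e (posOp e V))) :
    ‖emb (posOp e w - w₁)‖ ≤ 11 / K * ‖emb w‖ ∧
    ‖emb (derOp e (posOp e w - w₁))‖ ≤ 11 / K * ‖emb (derOp e w)‖ ∧
    ‖emb (posOp e (posOp e w) - w₂)‖ ≤ 2 * ‖emb w₁‖ + 3 * ‖emb w‖ := by
  have hK0 : 0 < K := by linarith
  have hδ0 : 0 ≤ 11 / K := by positivity
  have hδ1 : 11 / K ≤ 1 := by rw [div_le_one hK0]; linarith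
  have e1 : posOp e w - w₁ =
      (-Complex.I) • mulOp (fun ξ => (dT ζ e τ (K * τ) ξ : ℂ)) V := by
    rw [hw, F.posOp_mT, hw₁]; abel
  -- Leibniz' rule with X = -i∂_e: [X², T] = -2i T' X - T''.
  have e2 : posOp e (posOp e w) - w₂ =
      (-2 * Complex.I) • mulOp (fun ξ => (dT ζ e τ (K * τ) ξ : ℂ)) (posOp e V)
      - mulOp (fun ξ => (ddT ζ e τ (K * τ) ξ : ℂ)) V := by
    rw [hw, F.posOp_mT, map_add, map_smul, F.posOp_mT, F.posOp_dT, hw₂, smul_add, smul_smul]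
    rw [show (-Complex.I) * -Complex.I = -1 by linear_combination Complex.I_sq]
    module
  refine ⟨?_, ?_, ?_⟩
  · rw [e1, map_smul, norm_smul, norm_neg, Complex.norm_I, one_mul, hw]
    exact norm_emb_le hδ0 fun j ξ => F.norm_dT_mul_le (by linarith) hKτ V j ξ
  · rw [e1, map_smul, map_smul, norm_smul, norm_neg, Complex.norm_I, one_mul, hw]
    refine norm_emb_le hδ0 fun j ξ => ?_
    rw [derOp_apply, derOp_apply, norm_mul, norm_mul (-Complex.I * _), mul_left_comm]
    exact mul_le_mul_of_nonneg_left (F.norm_dT_mul_le (by linarith) hKτ V j ξ) (norm_nonneg _)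
  · rw [e2, map_sub, map_smul]
    refine (norm_sub_le _ _).trans (add_le_add ?_ ?_)
    · rw [norm_smul, norm_mul, norm_neg, Complex.norm_I, mul_one, Complex.norm_ofNat]
      refine mul_le_mul_of_nonneg_left ?_ (by norm_num)
      rw [hw₁]
      refine (norm_emb_le hδ0 fun j ξ =>
        F.norm_dT_mul_le (by linarith) hKτ (posOp e V) j ξ).trans ?_
      exact mul_le_of_le_one_left (norm_nonneg _) hδ1
    · rw [hw]
      exact norm_emb_le (by norm_num) fun j ξ => F.norm_ddT_mul_le hK1 hKτ V j ξ

/-- The Carleman estimate for `w = T V`, with the convexified operator applied before the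
multiplier `T`. -/
theorem carleman_multiplier (F : Frame ζ e τ) {C₁ C₂ C₃ : ℝ} (hC₁ : 0 ≤ C₁)
    (hC₃ : 0 ≤ C₃) (hM : 1 ≤ M) (hK : 132 * M ≤ K) (hK' : M * (3 + 6 * C₃ + 4 * C₁) ≤ K)
    (hKτ : K ≤ τ) (hτ₁ : 4 * M ^ 2 * (3 + 2 * C₁) ≤ τ) (hτ₂ : M + M ^ 2 * C₂ ≤ τ)
    {V w w₁ w₂ : Schwartz8} (hw : w = mulOp (fun ξ => (mT ζ (K * τ) ξ : ℂ)) V)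
    (hw₁ : w₁ = mulOp (fun ξ => (mT ζ (K * τ) ξ : ℂ)) (posOp e V))
    (hw₂ : w₂ = mulOp (fun ξ => (mT ζ (K * τ) ξ : ℂ)) (posOp e (posOp e V)))
    (b₁ : ‖emb w₁‖ ≤ C₁ * ‖emb w‖) (b₂ : ‖emb w₂‖ ≤ C₂ * ‖emb w‖)
    (b₃ : ‖emb (derOp e w₁)‖ ≤ C₃ * (‖emb (derOp e w)‖ + τ * ‖emb w‖)) :
    √M * (τ * ‖emb w‖ + ‖emb (mulOp (p ζ) w)‖ / K) ≤ 3 * ‖emb (convexOp ζ e τ M w w₁ w₂)‖ := by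
  have hτ : 0 ≤ τ := by linarith [F.one_le]
  have hM0 : 0 ≤ M := by linarith
  have hK1 : 22 ≤ K := by linarith
  have hδ1 : 11 / K ≤ 1 := by rw [div_le_one (by linarith)]; linarith
  obtain ⟨n1, n1', n2⟩ := F.commutator_bounds hK1 hKτ hw hw₁ hw₂
  have hcar := F.carleman_convexOp M w
  refine carleman_absorb (n := ‖emb w‖) (nD := ‖emb (derOp e w)‖)
    (nΦ := ‖emb ((τ : ℂ) • w + (M : ℂ) • posOp e w)‖)
    (B := ‖emb (convexOp ζ e τ M w (posOp e w) (posOp e (posOp e w)))‖)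
    (y := ‖emb (convexOp ζ e τ M w w₁ w₂)‖) (np := ‖emb (mulOp (p ζ) w)‖)
    hC₁ hC₃ hM hK hK' hτ hτ₁ hτ₂ (norm_emb_nonneg _) (norm_emb_nonneg _)
    (norm_emb_nonneg _) (norm_emb_nonneg _) hcar ?_ ?_ ?_
  · have h1 : (τ : ℂ) • w = ((τ : ℂ) • w + (M : ℂ) • posOp e w)
        - ((M : ℂ) • w₁ + (M : ℂ) • (posOp e w - w₁)) := by
      rw [smul_sub]; abel
    rw [← norm_emb_ofReal_smul hτ w]
    conv_lhs => rw [h1, map_sub]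
    refine (norm_sub_le _ _).trans (add_le_add_right ?_ _)
    rw [map_add]
    refine (norm_add_le _ _).trans ?_
    rw [norm_emb_ofReal_smul hM0, norm_emb_ofReal_smul hM0, ← mul_add]
    refine mul_le_mul_of_nonneg_left ?_ hM0
    have := mul_le_mul_of_nonneg_right hδ1 (norm_nonneg (emb w))
    linarith
  · refine (norm_convexOp_sub_le hτ hM0 w w₁ w₂ _ _).trans (add_le_add_right ?_ _)
    gcongr
    linarith
  · refine (norm_mulOp_p_le (e := e) hτ hM0 w w₁ w₂).trans (add_le_add_right ?_ _)
    gcongr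

end Frame

/-! ### Cut-off functions of one variable -/

/-- A Schwartz function equal to `f` on `[-R, R]`. -/
def cutS (R : ℝ) (hR : 0 < R) (f : ℝ → ℂ) (hf : ContDiff ℝ ∞ f) : 𝓢(ℝ, ℂ) :=
  let χ : ContDiffBump (0 : ℝ) := ⟨R, 2 * R, hR, by linarith⟩
  (χ.hasCompactSupport.smul_right (f' := f)).toSchwartzMap (χ.contDiff.smul hf)

theorem cutS_apply {R : ℝ} (hR : 0 < R) {f : ℝ → ℂ} (hf : ContDiff ℝ ∞ f) {s : ℝ}
    (hs : |s| ≤ R) : cutS R hR f hf s = f s := by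
  set χ : ContDiffBump (0 : ℝ) := ⟨R, 2 * R, hR, by linarith⟩ with hχ
  have h1 : cutS R hR f hf s = χ s • f s := rfl
  have h2 : χ s = 1 := χ.one_of_mem_closedBall (by simpa using hs)
  rw [h1, h2, one_smul]

theorem cutS_deriv {R : ℝ} (hR : 0 < R) {f : ℝ → ℂ} (hf : ContDiff ℝ ∞ f) {s : ℝ}
    (hs : |s| < R) : derivCLM ℂ ℂ (cutS R hR f hf) s = deriv f s := by
  rw [derivCLM_apply]
  refine Filter.EventuallyEq.deriv_eq ?_
  filter_upwards [(continuous_abs.isOpen_preimage _ isOpen_Iio).mem_nhds hs] with t ht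
  exact cutS_apply hR hf (le_of_lt ht)

theorem cutS_deriv_deriv {R : ℝ} (hR : 0 < R) {f : ℝ → ℂ} (hf : ContDiff ℝ ∞ f) {s : ℝ}
    (hs : |s| < R) :
    derivCLM ℂ ℂ (derivCLM ℂ ℂ (cutS R hR f hf)) s = deriv (deriv f) s := by
  rw [derivCLM_apply]
  refine Filter.EventuallyEq.deriv_eq ?_
  filter_upwards [(continuous_abs.isOpen_preimage _ isOpen_Iio).mem_nhds hs] with t ht
  exact cutS_deriv hR hf ht

/-- The convexifying factor `e^{c s²/2}`. -/
def gaussFactor (c : ℝ) (s : ℝ) : ℂ := Complex.exp (((c / 2 * s ^ 2 : ℝ)) : ℂ)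

theorem contDiff_gaussFactor (c : ℝ) : ContDiff ℝ ∞ (gaussFactor c) := by
  unfold gaussFactor
  exact Complex.contDiff_exp.comp
    (Complex.ofRealCLM.contDiff.comp (contDiff_const.mul (contDiff_id.pow 2)))

theorem hasDerivAt_gaussFactor (c s : ℝ) :
    HasDerivAt (gaussFactor c) (c * s * gaussFactor c s) s := by
  have h1 : HasDerivAt (fun s : ℝ => ((c / 2 * s ^ 2 : ℝ) : ℂ)) ((c / 2 * (2 * s) : ℝ) : ℂ) s := by
    have := ((hasDerivAt_id s).pow 2).const_mul (c / 2)
    simp only [id_eq] at this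
    convert! this.ofReal_comp using 2
    simp
  refine h1.cexp.congr_deriv ?_
  rw [gaussFactor]; push_cast; ring

theorem deriv_gaussFactor (c : ℝ) : deriv (gaussFactor c) = fun s => c * s * gaussFactor c s :=
  funext fun s => (hasDerivAt_gaussFactor c s).deriv

theorem deriv_deriv_gaussFactor (c s : ℝ) :
    deriv (deriv (gaussFactor c)) s = (c + c ^ 2 * s ^ 2) * gaussFactor c s := by
  rw [deriv_gaussFactor]
  have h0 : HasDerivAt (fun s : ℝ => (c : ℂ) * (s : ℂ)) (c : ℂ) s := by
    have := (Complex.ofRealCLM.hasDerivAt (x := s)).const_mul (c : ℂ)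
    simpa using! this
  have h1 := h0.mul (hasDerivAt_gaussFactor c s)
  refine h1.deriv.trans ?_
  ring

theorem gaussFactor_neg_mul (c s : ℝ) : gaussFactor (-c) s * gaussFactor c s = 1 := by
  rw [gaussFactor, gaussFactor, ← Complex.exp_add]
  push_cast
  rw [← Complex.exp_zero]; congr 1; ring

theorem conj_gaussFactor (c s : ℝ) : starRingEnd ℂ (gaussFactor c s) = gaussFactor c s := by
  rw [gaussFactor, ← Complex.exp_conj, Complex.conj_ofReal]

/-! ### The free operator on Schwartz functions and its conjugation -/

/-- The standard basis vectors of `ℝ³`. -/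
def bv (i : Fin 3) : R3 := EuclideanSpace.single i 1

theorem inner_bv (x : R3) (i : Fin 3) : inner ℝ x (bv i) = x i := by
  rw [bv, EuclideanSpace.inner_single_right]; simp

theorem dirOp_eq_sum (e : R3) (w : Schwartz8) : dirOp e w = ∑ i, (e i : ℂ) • dirOp (bv i) w := by
  funext j
  ext x
  have he : e = ∑ i, e i • bv i := by
    ext k
    simp [bv, Finset.sum_apply, Pi.single_apply]
  rw [dirOp_apply_apply]
  conv_lhs => rw [he]
  rw [map_sum, Finset.sum_apply, sum_apply]
  refine Finset.sum_congr rfl fun i _ => ?_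
  rw [map_smul, Pi.smul_apply, smul_apply, dirOp_apply_apply, Complex.real_smul, smul_eq_mul]

/-- `-Δ + 2 ζ·∇` on Schwartz 8-vectors. -/
def freeS (ζ : C3) : Module.End ℂ Schwartz8 :=
  -(∑ i, dirOp (bv i) * dirOp (bv i)) + (2 : ℂ) • ∑ i, ζ i • dirOp (bv i)

theorem freeS_apply (ζ : C3) (u : Schwartz8) :
    freeS ζ u = -(∑ i, dirOp (bv i) (dirOp (bv i) u)) + (2 : ℂ) • ∑ i, ζ i • dirOp (bv i) u := by
  simp [freeS, LinearMap.sum_apply]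

theorem freeOp_eq (ζ : C3) (u φ : Schwartz8) :
    freeOp ζ u φ = ∑ j, ∫ x, freeS ζ u j x * φ j x := by
  rw [freeOp]
  refine Finset.sum_congr rfl fun j _ => integral_congr_ae (.of_forall fun x => ?_)
  simp only [freeS_apply, Pi.add_apply, Pi.neg_apply, Pi.smul_apply, Finset.sum_apply, add_apply,
    neg_apply, smul_apply, sum_apply, smul_eq_mul]
  rfl

theorem derOp_ftOp (e : R3) (u : Schwartz8) : derOp e (ftOp u) = ftOp (dirOp e u) := by
  funext j
  ext ξ
  rw [derOp_apply, ftOp_apply, ftOp_apply, dirOp_apply, ft_lineDeriv]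

theorem posOp_ftOp (e : R3) (u : Schwartz8) :
    posOp e (ftOp u) = ftOp (mulOp (fun x => (inner ℝ x e : ℝ)) u) := by
  funext j
  rw [ftOp_apply]
  exact (ft_mul_inner e (u j)).symm

theorem mulOp_p_ftOp (ζ : C3) (u : Schwartz8) : mulOp (p ζ) (ftOp u) = ftOp (freeS ζ u) := by
  rw [freeS_apply, map_add, map_neg, map_sum, map_smul, map_sum]
  simp only [map_smul, ← derOp_ftOp]
  funext j
  ext ξ
  rw [mulOp_apply (hasTemperateGrowth_p ζ)]
  simp only [Pi.add_apply, Pi.neg_apply, Pi.smul_apply, Finset.sum_apply, add_apply,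
    neg_apply, smul_apply, sum_apply, smul_eq_mul, derOp_apply, inner_bv, p]
  have h1 : ((‖ξ‖ : ℂ)) ^ 2 = ∑ i, ((ξ i : ℝ) : ℂ) ^ 2 := by
    have := EuclideanSpace.norm_sq_eq ξ
    simp only [Real.norm_eq_abs, sq_abs] at this
    exact_mod_cast this
  rw [h1, sub_mul, Finset.sum_mul, ← Finset.sum_neg_distrib, sub_eq_add_neg]
  congr 1
  · refine Finset.sum_congr rfl fun i _ => ?_
    linear_combination (((ξ i : ℝ) : ℂ) ^ 2 * ftOp u j ξ) * Complex.I_sq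
  · rw [Finset.mul_sum, Finset.mul_sum, Finset.sum_mul, ← Finset.sum_neg_distrib]
    refine Finset.sum_congr rfl fun i _ => ?_
    ring

theorem fderiv_alongDir (g : 𝓢(ℝ, ℂ)) (e a x : R3) :
    fderiv ℝ (alongDir g e) x a = (inner ℝ a e : ℝ) * alongDir (derivCLM ℂ ℂ g) e x := by
  have h1 : HasFDerivAt (fun y : R3 => inner ℝ y e) ((innerSL ℝ).flip e) x :=
    ((innerSL ℝ).flip e).hasFDerivAt
  have h2 := (g.hasDerivAt (inner ℝ x e)).hasFDerivAt.comp x h1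
  have h3 : fderiv ℝ (alongDir g e) x = _ := h2.fderiv
  rw [h3, alongDir, derivCLM_apply]
  simp only [ContinuousLinearMap.comp_apply, ContinuousLinearMap.flip_apply,
    innerSL_apply_apply ℝ, ContinuousLinearMap.toSpanSingleton_apply, Complex.real_smul]

theorem dirOp_alongDir (g : 𝓢(ℝ, ℂ)) (e a : R3) (u : Schwartz8) :
    dirOp a (mulOp (alongDir g e) u) = mulOp (alongDir g e) (dirOp a u) +
      ((inner ℝ a e : ℝ) : ℂ) • mulOp (alongDir (derivCLM ℂ ℂ g) e) u := by
  have h1 := hasTemperateGrowth_alongDir g e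
  have h2 := hasTemperateGrowth_alongDir (derivCLM ℂ ℂ g) e
  rw [dirOp_mulOp h1 (m' := fun x => (inner ℝ a e : ℝ) * alongDir (derivCLM ℂ ℂ g) e x)
    (by fun_prop) (fderiv_alongDir g e a)]
  congr 1
  funext j
  ext x
  rw [mulOp_apply (by fun_prop), Pi.smul_apply, smul_apply, mulOp_apply h2, smul_eq_mul, mul_assoc]

/-- The factor depends on x·e alone, so its gradient is g' e and its Laplacian g''; of ζ only ζ·e =
τ is seen. -/
theorem freeS_alongDir {ζ : C3} {e : R3} {τ : ℝ} (F : Frame ζ e τ) (g : 𝓢(ℝ, ℂ)) (u : Schwartz8) :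
    freeS ζ (mulOp (alongDir g e) u) = mulOp (alongDir g e) (freeS ζ u)
      - (2 : ℂ) • mulOp (alongDir (derivCLM ℂ ℂ g) e) (dirOp e u)
      - mulOp (alongDir (derivCLM ℂ ℂ (derivCLM ℂ ℂ g)) e) u
      + (2 * τ : ℂ) • mulOp (alongDir (derivCLM ℂ ℂ g) e) u := by
  have hsum : ∑ i, (e i : ℂ) ^ 2 = 1 := by
    have := EuclideanSpace.norm_sq_eq e
    rw [F.norm_e] at this
    simp only [Real.norm_eq_abs, sq_abs] at this
    have h2 : ∑ i, e i ^ 2 = 1 := by linarith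
    exact_mod_cast h2
  have hζ : ∑ i, ζ i * (e i : ℂ) = τ := by
    rw [sum_mul_eq, F.re_eq, inner_smul_right, real_inner_self_eq_norm_sq, F.norm_e, F.orth]
    simp
  have hin : ∀ i, inner ℝ (bv i) e = e i := fun i => by rw [real_inner_comm, inner_bv]
  simp only [freeS_apply, dirOp_alongDir, map_add, map_smul, hin, smul_add, smul_smul,
    Finset.sum_add_distrib, dirOp_eq_sum e u, map_sum, map_neg, Finset.smul_sum]
  have e1 : ∀ z : Schwartz8, ∑ i, ((e i : ℂ) * (e i : ℂ)) • z = z := fun z => by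
    rw [← Finset.sum_smul]
    simp only [← sq, hsum, one_smul]
  have e2 : ∀ z : Schwartz8, ∑ i, (2 * (ζ i * (e i : ℂ))) • z = (2 * τ : ℂ) • z := fun z => by
    rw [← Finset.sum_smul, ← Finset.mul_sum, hζ]
  have e3 : ∑ i, (2 * (e i : ℂ)) • mulOp (alongDir (derivCLM ℂ ℂ g) e) (dirOp (bv i) u) =
      ∑ i, (e i : ℂ) • mulOp (alongDir (derivCLM ℂ ℂ g) e) (dirOp (bv i) u) +
      ∑ i, (e i : ℂ) • mulOp (alongDir (derivCLM ℂ ℂ g) e) (dirOp (bv i) u) := by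
    rw [← Finset.sum_add_distrib]
    exact Finset.sum_congr rfl fun i _ => by module
  rw [e1, e2, e3]
  abel

/-- Multipliers that agree on a set containing the support give the same product. -/
theorem mulOp_congr {m m' : R3 → ℂ} (hm : m.HasTemperateGrowth) (hm' : m'.HasTemperateGrowth)
    {u : Schwartz8} (h : ∀ j, ∀ x, u j x ≠ 0 → m x = m' x) : mulOp m u = mulOp m' u := by
  funext j
  ext x
  rw [mulOp_apply hm, mulOp_apply hm']
  by_cases hx : u j x = 0
  · simp [hx]
  · rw [h j x hx]

theorem abs_inner_lt_of_ne_zero {e : R3} (he : ‖e‖ = 1) {R : ℝ} {u : Schwartz8}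
    (hu : ∀ j, tsupport (u j) ⊆ Metric.ball 0 R) (j : Fin 8) (x : R3) (hx : u j x ≠ 0) :
    |inner ℝ x e| < R := by
  have h1 := hu j (subset_tsupport _ hx)
  rw [mem_ball_zero_iff] at h1
  have h2 := abs_real_inner_le_norm x e
  rw [he, mul_one] at h2
  exact h2.trans_lt h1

theorem tsupport_dirOp {R : ℝ} {u : Schwartz8} (hu : ∀ j, tsupport (u j) ⊆ Metric.ball 0 R)
    (e : R3) (j : Fin 8) : tsupport (dirOp e u j) ⊆ Metric.ball 0 R :=
  (tsupport_lineDerivOp_subset e (u j)).trans (hu j)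

theorem tsupport_mulOp {R : ℝ} {u : Schwartz8} (hu : ∀ j, tsupport (u j) ⊆ Metric.ball 0 R)
    (m : R3 → ℂ) (j : Fin 8) : tsupport (mulOp m u j) ⊆ Metric.ball 0 R :=
  (tsupport_smulLeftCLM_subset m (u j)).trans (Set.inter_subset_left.trans (hu j))

/-- Conjugation of the free operator with the convexifying factor, on the Fourier side. -/
theorem convexOp_ftOp {ζ : C3} {e : R3} {τ R M : ℝ} (F : Frame ζ e τ) (hR : 0 < R)
    {u : Schwartz8} (hu : ∀ j, tsupport (u j) ⊆ Metric.ball 0 R) :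
    let G := mulOp (alongDir (cutS R hR (gaussFactor M) (contDiff_gaussFactor M)) e)
    Frame.convexOp ζ e τ M (ftOp (G u)) (posOp e (ftOp (G u))) (posOp e (posOp e (ftOp (G u)))) =
      ftOp (G (freeS ζ u)) := by
  intro G
  set g := cutS R hR (gaussFactor M) (contDiff_gaussFactor M) with hg
  have hs := abs_inner_lt_of_ne_zero F.norm_e hu
  have hs' := abs_inner_lt_of_ne_zero F.norm_e (tsupport_dirOp hu e)
  have tg := hasTemperateGrowth_alongDir g e
  have tg' := hasTemperateGrowth_alongDir (derivCLM ℂ ℂ g) e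
  have tg'' := hasTemperateGrowth_alongDir (derivCLM ℂ ℂ (derivCLM ℂ ℂ g)) e
  -- On the support of u, where |s| < R strictly, the cut-off function agrees with exp(M s²/2) near
  -- s. So g' = M s g and g'' = (M + M² s²) g there, and derivatives of the cut-off never meet u.
  have hg' : ∀ x : R3, |inner ℝ x e| < R →
      alongDir (derivCLM ℂ ℂ g) e x = M * (inner ℝ x e : ℝ) * alongDir g e x := fun x hx => by
    rw [alongDir, alongDir, hg, cutS_deriv hR _ hx, cutS_apply hR _ hx.le, deriv_gaussFactor]
  have hg'' : ∀ x : R3, |inner ℝ x e| < R → alongDir (derivCLM ℂ ℂ (derivCLM ℂ ℂ g)) e x =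
      (M + M ^ 2 * ((inner ℝ x e : ℝ) : ℂ) ^ 2) * alongDir g e x := fun x hx => by
    rw [alongDir, alongDir, hg, cutS_deriv_deriv hR _ hx, cutS_apply hR _ hx.le,
      deriv_deriv_gaussFactor]
  have k1 : mulOp (alongDir (derivCLM ℂ ℂ g) e) u =
      mulOp (fun x => M * (inner ℝ x e : ℝ) * alongDir g e x) u :=
    mulOp_congr tg' (by fun_prop) fun j x hx => hg' x (hs j x hx)
  have k2 : mulOp (alongDir (derivCLM ℂ ℂ g) e) (dirOp e u) =
      mulOp (fun x => M * (inner ℝ x e : ℝ) * alongDir g e x) (dirOp e u) :=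
    mulOp_congr tg' (by fun_prop) fun j x hx => hg' x (hs' j x hx)
  have k3 : mulOp (alongDir (derivCLM ℂ ℂ (derivCLM ℂ ℂ g)) e) u =
      mulOp (fun x => (M + M ^ 2 * ((inner ℝ x e : ℝ) : ℂ) ^ 2) * alongDir g e x) u :=
    mulOp_congr tg'' (by fun_prop) fun j x hx => hg'' x (hs j x hx)
  have k4 : freeS ζ (G u) = _ := freeS_alongDir F g u
  have k5 : dirOp e (mulOp (fun x => ((inner ℝ x e : ℝ) : ℂ)) (G u)) =
      mulOp (fun x => ((inner ℝ x e : ℝ) : ℂ)) (dirOp e (G u)) + mulOp (fun _ => 1) (G u) := by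
    refine dirOp_mulOp (by fun_prop) (by fun_prop) (fun x => ?_) (G u)
    have h1 : HasFDerivAt (fun y : R3 => ((inner ℝ y e : ℝ) : ℂ))
        (Complex.ofRealCLM ∘L (innerSL ℝ).flip e) x :=
      Complex.ofRealCLM.hasFDerivAt.comp x ((innerSL ℝ).flip e).hasFDerivAt
    rw [h1.fderiv]
    simp [innerSL_apply_apply ℝ, F.norm_e]
  have k6 : dirOp e (G u) = G (dirOp e u) + mulOp (alongDir (derivCLM ℂ ℂ g) e) u := by
    have := dirOp_alongDir g e e u
    rw [real_inner_self_eq_norm_sq, F.norm_e] at this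
    simpa using this
  rw [Frame.convexOp, posOp_ftOp, posOp_ftOp, mulOp_p_ftOp, derOp_ftOp, k5, k6, k4, k1, k2, k3]
  simp only [← LinearMap.map_smul ftOp, ← LinearMap.map_sub ftOp, ← LinearMap.map_add ftOp]
  congr 1
  funext j
  ext x
  simp only [Pi.add_apply, Pi.sub_apply, Pi.smul_apply, add_apply, sub_apply, smul_apply, G, ← hg]
  have t1 : (fun x : R3 => (M * (inner ℝ x e : ℝ) * alongDir g e x : ℂ)).HasTemperateGrowth := by
    fun_prop
  have t2 : (fun x : R3 => ((M + M ^ 2 * ((inner ℝ x e : ℝ) : ℂ) ^ 2) * alongDir g e x : ℂ)).HasTemperateGrowth := by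
    fun_prop
  have t3 : (fun x : R3 => ((inner ℝ x e : ℝ) : ℂ)).HasTemperateGrowth := by fun_prop
  have t4 : (fun _ : R3 => (1 : ℂ)).HasTemperateGrowth := by fun_prop
  simp only [mulOp_apply tg, mulOp_apply t1, mulOp_apply t2, mulOp_apply t3, mulOp_apply t4,
    Pi.add_apply, add_apply, smul_eq_mul]
  ring

/-! ### The a priori estimate for first-order potentials -/

/-- Componentwise complex conjugation. -/
def conj8 (w : Schwartz8) : Schwartz8 := fun j => conjS (w j)

theorem conj8_apply (w : Schwartz8) (j : Fin 8) (x : R3) :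
    conj8 w j x = starRingEnd ℂ (w j x) := rfl

theorem norm_emb_conj8 (w : Schwartz8) : ‖emb (conj8 w)‖ = ‖emb w‖ :=
  norm_emb_eq fun j x => by rw [conj8_apply, RCLike.norm_conj]

theorem norm_emb_dirOp_conj8 (e : R3) (w : Schwartz8) :
    ‖emb (dirOp e (conj8 w))‖ = ‖emb (dirOp e w)‖ :=
  norm_emb_eq fun j x => by
    rw [dirOp_apply, conj8, lineDeriv_conjS, RCLike.norm_conj]; rfl

theorem conj8_mulOp {m : R3 → ℂ} (hm : m.HasTemperateGrowth)
    (h : ∀ x, starRingEnd ℂ (m x) = m x) (w : Schwartz8) :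
    conj8 (mulOp m w) = mulOp m (conj8 w) := by
  funext j
  ext x
  rw [conj8_apply, mulOp_apply hm, mulOp_apply hm, map_mul, h, conj8_apply]

theorem mulOp_comm {m m' : R3 → ℂ} (hm : m.HasTemperateGrowth) (hm' : m'.HasTemperateGrowth)
    (w : Schwartz8) : mulOp m (mulOp m' w) = mulOp m' (mulOp m w) := by
  funext j
  ext x
  rw [mulOp_apply hm, mulOp_apply hm', mulOp_apply hm', mulOp_apply hm]
  ring

theorem mulOp_mulOp {m m' m'' : R3 → ℂ} (hm : m.HasTemperateGrowth)
    (hm' : m'.HasTemperateGrowth) (hm'' : m''.HasTemperateGrowth)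
    (h : ∀ x, m x * m' x = m'' x) (w : Schwartz8) : mulOp m (mulOp m' w) = mulOp m'' w := by
  funext j
  ext x
  rw [mulOp_apply hm, mulOp_apply hm', mulOp_apply hm'', ← h, mul_assoc]

theorem norm_emb_mulOp_le {m m' : R3 → ℂ} (hm : m.HasTemperateGrowth)
    (hm' : m'.HasTemperateGrowth) {c : ℝ} (hc : 0 ≤ c) (h : ∀ x, ‖m x‖ ≤ c * ‖m' x‖)
    (w : Schwartz8) : ‖emb (mulOp m w)‖ ≤ c * ‖emb (mulOp m' w)‖ :=
  norm_emb_le hc fun j x => by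
    rw [mulOp_apply hm, mulOp_apply hm', norm_mul, norm_mul, ← mul_assoc]
    exact mul_le_mul_of_nonneg_right (h x) (norm_nonneg _)

theorem mulOp_one (w : Schwartz8) : mulOp (fun _ => 1) w = w := by
  funext j
  ext x
  rw [mulOp_apply (by fun_prop), one_mul]

theorem Frame.convexOp_mulOp {ζ : C3} {e : R3} {τ M : ℝ} {m : R3 → ℂ} (hm : m.HasTemperateGrowth)
    (w w₁ w₂ : Schwartz8) : Frame.convexOp ζ e τ M (mulOp m w) (mulOp m w₁) (mulOp m w₂) =
      mulOp m (Frame.convexOp ζ e τ M w w₁ w₂) := by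
  have h : derOp e (mulOp m w₁) = mulOp m (derOp e w₁) := mulOp_comm (by fun_prop) hm _
  simp only [Frame.convexOp, map_add, map_sub, map_smul, mulOp_comm (hasTemperateGrowth_p ζ) hm, h]

/-- The operator norm bound for multiplication by `g(x·e)`. -/
def multNorm (g : 𝓢(ℝ, ℂ)) : ℝ := 2 * (multConst g).toReal

theorem multNorm_nonneg (g : 𝓢(ℝ, ℂ)) : 0 ≤ multNorm g := by unfold multNorm; positivity

/-- The sum of the `L²` norms of the partial derivatives. -/
def gradNorm (w : Schwartz8) : ℝ := ∑ i, ‖emb (dirOp (bv i) w)‖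

theorem gradNorm_nonneg (w : Schwartz8) : 0 ≤ gradNorm w :=
  Finset.sum_nonneg fun _ _ => norm_nonneg _

/-- A bilinear form `⟨q w, φ⟩` which is bounded by one derivative, with small constant `a` for the
terms with a derivative. -/
structure FirstOrder (a c : ℝ) (q : Schwartz8 → Functional8) : Prop where
  add : ∀ w φ ψ, q w (φ + ψ) = q w φ + q w ψ
  smul : ∀ w (b : ℂ) φ, q w (b • φ) = b * q w φ
  -- This holds because the forms see only products of a component of w with a component of φ. It
  -- makes the potential invariant under conjugation by the convexifying factor.
  comm : ∀ (m : R3 → ℂ), m.HasTemperateGrowth → ∀ w φ, q (mulOp m w) φ = q w (mulOp m φ)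
  -- Compact support of one argument is what permits integration by parts against κ.
  bound : ∀ w φ, (∀ j, HasCompactSupport (w j)) → ‖q w φ‖ ≤
    a * (gradNorm w * ‖emb φ‖ + ‖emb w‖ * gradNorm φ) + c * (‖emb w‖ * ‖emb φ‖)

namespace Frame

variable {ζ : C3} {e : R3} {τ K R M : ℝ}

theorem norm_mT_alongDir_le (F : Frame ζ e τ) (hK : 22 ≤ K) (hKτ : K ≤ τ) (g : 𝓢(ℝ, ℂ))
    (v : Schwartz8) :
    ‖emb (mulOp (fun ξ => (mT ζ (K * τ) ξ : ℂ)) (ftOp (mulOp (alongDir g e) v)))‖ ≤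
      multNorm g * ‖emb (mulOp (fun ξ => (mT ζ (K * τ) ξ : ℂ)) (ftOp v))‖ := by
  refine norm_alongDir_le g e (hasTemperateGrowth_mT _ _) (fun ξ => (mT_pos _ _ ξ).le)
    zero_le_two (fun ξ t => (F.mT_le_line hK hKτ ξ t).trans ?_) v
  have := mT_pos ζ (K * τ) (ξ + t • e)
  gcongr
  nlinarith [abs_nonneg t]

theorem norm_qSym_alongDir_le (F : Frame ζ e τ) (hK : 22 ≤ K) (hKτ : K ≤ τ) (g : 𝓢(ℝ, ℂ))
    (v : Schwartz8) :
    ‖emb (mulOp (fun ξ => ((qSym ζ (K * τ) ξ ^ (1 / 4 : ℝ) : ℝ) : ℂ))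
        (ftOp (mulOp (alongDir g e) v)))‖ ≤ multNorm g *
      ‖emb (mulOp (fun ξ => ((qSym ζ (K * τ) ξ ^ (1 / 4 : ℝ) : ℝ) : ℂ)) (ftOp v))‖ := by
  have hpos : ∀ ξ, 0 < qSym ζ (K * τ) ξ ^ (1 / 4 : ℝ) := fun ξ =>
    Real.rpow_pos_of_pos (qSym_pos _ _ _) _
  refine norm_alongDir_le g e (hasTemperateGrowth_qSym_rpow _ _ _) (fun ξ => (hpos ξ).le)
    zero_le_two (fun ξ t => ?_) v
  have h1 := F.qSym_line_le hK hKτ (ξ + t • e) (-t)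
  have h2 : ξ + t • e + (-t) • e = ξ := by module
  rw [h2, abs_neg] at h1
  refine h1.trans ?_
  have := hpos (ξ + t • e)
  gcongr
  nlinarith [abs_nonneg t]

/-- The weight `(1 + (ξ·e/τ)²)^{1/2}`. -/
def bracket (e : R3) (τ : ℝ) (ξ : R3) : ℝ := (1 + ‖τ⁻¹ * inner ℝ ξ e‖ ^ 2) ^ (1 / 2 : ℝ)

theorem hasTemperateGrowth_bracket (e : R3) (τ : ℝ) : (bracket e τ).HasTemperateGrowth := by
  have h : (fun ξ : R3 => τ⁻¹ * inner ℝ ξ e).HasTemperateGrowth := by fun_prop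
  exact (Function.hasTemperateGrowth_one_add_norm_sq_rpow ℝ (1 / 2)).comp h

theorem bracket_eq (e : R3) (τ : ℝ) (ξ : R3) :
    bracket e τ ξ = √(1 + (τ⁻¹ * inner ℝ ξ e) ^ 2) := by
  rw [bracket, Real.sqrt_eq_rpow, Real.norm_eq_abs, sq_abs]

theorem bracket_pos (e : R3) (τ : ℝ) (ξ : R3) : 0 < bracket e τ ξ := by
  rw [bracket_eq]; positivity

theorem bracket_le_line (F : Frame ζ e τ) (ξ : R3) (t : ℝ) :
    bracket e τ ξ ≤ (1 + |t|) * bracket e τ (ξ + t • e) := by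
  have hτ := F.one_le
  rw [bracket_eq, bracket_eq, F.inner_line]
  refine Real.sqrt_le_iff.2 ⟨by positivity, ?_⟩
  rw [mul_pow (1 + |t|), Real.sq_sqrt (by positivity)]
  set y := τ⁻¹ * (inner ℝ ξ e + t) with hy
  have h1 : τ⁻¹ * inner ℝ ξ e = y - τ⁻¹ * t := by rw [hy]; ring
  have h2 : |τ⁻¹ * t| ≤ |t| := by
    rw [abs_mul, abs_of_pos (by positivity : 0 < τ⁻¹)]
    exact mul_le_of_le_one_left (abs_nonneg _) (inv_le_one_of_one_le₀ hτ)
  have h3 : (τ⁻¹ * t) ^ 2 ≤ |t| ^ 2 := by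
    rw [← sq_abs]; exact pow_le_pow_left₀ (abs_nonneg _) h2 2
  have h4 : -(2 * (y * (τ⁻¹ * t))) ≤ 2 * (|y| * |t|) := by
    have : |y * (τ⁻¹ * t)| ≤ |y| * |t| := by
      rw [abs_mul]; exact mul_le_mul_of_nonneg_left h2 (abs_nonneg _)
    linarith [neg_abs_le (y * (τ⁻¹ * t))]
  have h5 : 2 * (|y| * |t|) ≤ |t| * (1 + y ^ 2) := by
    nlinarith [abs_nonneg t, sq_nonneg (|y| - 1), sq_abs y]
  rw [h1]
  nlinarith [abs_nonneg t, mul_nonneg (abs_nonneg t) (sq_nonneg y), sq_nonneg (|t| * y),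
    sq_nonneg |t|]

/-- The weight τ `bracket` is comparable to |ξ·e| + τ, and `bracket` times T varies slowly along e.
The passage between |ξ·e| and |ξ·e| + τ is paid for by the last term. -/
theorem norm_derOp_mT_le (F : Frame ζ e τ) (hK : 22 ≤ K) (hKτ : K ≤ τ) (g : 𝓢(ℝ, ℂ))
    (v : Schwartz8) :
    ‖emb (derOp e (mulOp (fun ξ => (mT ζ (K * τ) ξ : ℂ)) (ftOp (mulOp (alongDir g e) v))))‖ ≤
      multNorm g * (‖emb (derOp e (mulOp (fun ξ => (mT ζ (K * τ) ξ : ℂ)) (ftOp v)))‖ +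
        τ * ‖emb (mulOp (fun ξ => (mT ζ (K * τ) ξ : ℂ)) (ftOp v))‖) := by
  have hτ := F.one_le
  have hT := hasTemperateGrowth_mT ζ (K * τ)
  have hB := hasTemperateGrowth_bracket e τ
  set W : R3 → ℝ := fun ξ => bracket e τ ξ * mT ζ (K * τ) ξ with hWdef
  have hW : W.HasTemperateGrowth := by fun_prop
  have hW0 : ∀ ξ, 0 < W ξ := fun ξ => mul_pos (bracket_pos _ _ _) (mT_pos _ _ _)
  have hWc : (fun ξ => (W ξ : ℂ)).HasTemperateGrowth := by fun_prop
  have hTc : (fun ξ => (mT ζ (K * τ) ξ : ℂ)).HasTemperateGrowth := by fun_prop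
  have key := norm_alongDir_le g e hW (fun ξ => (hW0 ξ).le) zero_le_two (fun ξ t => by
    have h1 := F.mT_le_line hK hKτ ξ t
    have h2 := F.bracket_le_line ξ t
    have h3 := mT_pos ζ (K * τ) ξ
    have h4 := bracket_pos e τ (ξ + t • e)
    calc W ξ ≤ ((1 + |t|) * bracket e τ (ξ + t • e)) *
          (2 * (1 + |t|) * mT ζ (K * τ) (ξ + t • e)) :=
          mul_le_mul h2 h1 h3.le (by positivity)
      _ = _ := by rw [hWdef]; ring) v
  have hnW : ∀ (z : Schwartz8) (j : Fin 8) (ξ : R3), ‖mulOp (fun ξ => (W ξ : ℂ)) z j ξ‖ =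
      bracket e τ ξ * ‖mulOp (fun ξ => (mT ζ (K * τ) ξ : ℂ)) z j ξ‖ := fun z j ξ => by
    rw [mulOp_apply hWc, mulOp_apply hTc, norm_mul, norm_mul, Complex.norm_real,
      Complex.norm_real, Real.norm_of_nonneg (hW0 ξ).le, Real.norm_of_nonneg (mT_pos _ _ _).le,
      hWdef, mul_assoc]
  have hder : ∀ (z : Schwartz8) (j : Fin 8) (ξ : R3),
      ‖derOp e z j ξ‖ = |inner ℝ ξ e| * ‖z j ξ‖ := fun z j ξ => by
    rw [derOp_apply, norm_mul, norm_mul, norm_neg, Complex.norm_I, one_mul, Complex.norm_real,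
      Real.norm_eq_abs]
  have h1 : ∀ z : Schwartz8, ‖emb (derOp e (mulOp (fun ξ => (mT ζ (K * τ) ξ : ℂ)) z))‖ ≤
      τ * ‖emb (mulOp (fun ξ => (W ξ : ℂ)) z)‖ := fun z =>
    norm_emb_le (by positivity) fun j ξ => by
      rw [hder, hnW, ← mul_assoc]
      refine mul_le_mul_of_nonneg_right ?_ (norm_nonneg _)
      rw [bracket_eq]
      have : |τ⁻¹ * inner ℝ ξ e| ≤ √(1 + (τ⁻¹ * inner ℝ ξ e) ^ 2) := Real.abs_le_sqrt (by linarith)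
      rw [abs_mul, abs_of_pos (by positivity : 0 < τ⁻¹), inv_mul_le_iff₀ (by positivity)] at this
      exact this
  have h2 : ∀ z : Schwartz8, τ * ‖emb (mulOp (fun ξ => (W ξ : ℂ)) z)‖ ≤
      1 * ‖emb (derOp e (mulOp (fun ξ => (mT ζ (K * τ) ξ : ℂ)) z))‖ +
        τ * ‖emb (mulOp (fun ξ => (mT ζ (K * τ) ξ : ℂ)) z)‖ := fun z => by
    rw [← norm_emb_ofReal_smul (by positivity : 0 ≤ τ)]
    refine norm_emb_le₂ zero_le_one (by positivity) fun j ξ => ?_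
    rw [Pi.smul_apply, smul_apply, smul_eq_mul, norm_mul, hnW, hder, Complex.norm_real,
      Real.norm_of_nonneg (by positivity), ← mul_assoc, one_mul, ← add_mul]
    refine mul_le_mul_of_nonneg_right ?_ (norm_nonneg _)
    rw [bracket_eq]
    have h3 : √(1 + (τ⁻¹ * inner ℝ ξ e) ^ 2) ≤ 1 + |τ⁻¹ * inner ℝ ξ e| := by
      refine Real.sqrt_le_iff.2 ⟨by positivity, ?_⟩
      nlinarith [abs_nonneg (τ⁻¹ * inner ℝ ξ e), sq_abs (τ⁻¹ * inner ℝ ξ e)]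
    calc _ ≤ τ * (1 + |τ⁻¹ * inner ℝ ξ e|) := by gcongr
      _ = _ := by
        rw [abs_mul, abs_of_pos (by positivity : 0 < τ⁻¹)]; field_simp; ring
  refine (h1 _).trans ((mul_le_mul_of_nonneg_left key (by positivity)).trans ?_)
  have := mul_le_mul_of_nonneg_left (h2 (ftOp v)) (multNorm_nonneg g)
  rw [one_mul] at this
  refine le_trans (le_of_eq ?_) this
  rw [multNorm]; ring

end Frame

/-- Reality of the factor lets it pass through the conjugation that links the bilinear pairing to
the inner product. -/
theorem conj_alongDir_cutS {R : ℝ} (hR : 0 < R) (c : ℝ) (e x : R3) :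
    starRingEnd ℂ (alongDir (cutS R hR (gaussFactor c) (contDiff_gaussFactor c)) e x) =
      alongDir (cutS R hR (gaussFactor c) (contDiff_gaussFactor c)) e x := by
  let χ : ContDiffBump (0 : ℝ) := ⟨R, 2 * R, hR, by linarith⟩
  have h : ∀ s, cutS R hR (gaussFactor c) (contDiff_gaussFactor c) s = χ s • gaussFactor c s :=
    fun _ => rfl
  rw [alongDir, h, Complex.real_smul, map_mul, conj_gaussFactor, Complex.conj_ofReal]

theorem contDiff_ofReal_pow (n : ℕ) : ContDiff ℝ ∞ fun s : ℝ => (s : ℂ) ^ n :=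
  Complex.ofRealCLM.contDiff.pow n

namespace Frame

variable {ζ : C3} {e : R3} {τ K R M : ℝ}

/-- The Carleman estimate for functions with support in a ball, on the Fourier side. -/
theorem carleman_support (F : Frame ζ e τ) (hR : 0 < R) {C₁ C₂ : ℝ}
    (hC₁ : C₁ = multNorm (cutS R hR (fun s => (s : ℂ) ^ 1) (contDiff_ofReal_pow 1)))
    (hC₂ : C₂ = multNorm (cutS R hR (fun s => (s : ℂ) ^ 2) (contDiff_ofReal_pow 2)))
    (hM : 1 ≤ M) (hK : 132 * M ≤ K) (hK' : M * (3 + 6 * C₁ + 4 * C₁) ≤ K)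
    (hKτ : K ≤ τ) (hτ₁ : 4 * M ^ 2 * (3 + 2 * C₁) ≤ τ) (hτ₂ : M + M ^ 2 * C₂ ≤ τ)
    {u : Schwartz8} (hu : ∀ j, tsupport (u j) ⊆ Metric.ball 0 R) :
    let G := mulOp (alongDir (cutS R hR (gaussFactor M) (contDiff_gaussFactor M)) e)
    let T := mulOp (fun ξ => (mT ζ (K * τ) ξ : ℂ))
    √M * (τ * ‖emb (T (ftOp (G u)))‖ + ‖emb (mulOp (p ζ) (T (ftOp (G u))))‖ / K) ≤
      3 * ‖emb (T (ftOp (G (freeS ζ u))))‖ := by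
  intro G T
  have hT : (fun ξ => (mT ζ (K * τ) ξ : ℂ)).HasTemperateGrowth := by
    have := hasTemperateGrowth_mT ζ (K * τ)
    fun_prop
  have hK22 : 22 ≤ K := by linarith
  have hv : ∀ j, tsupport (G u j) ⊆ Metric.ball 0 R := tsupport_mulOp hu _
  have hs := abs_inner_lt_of_ne_zero F.norm_e hv
  have tX : (fun x : R3 => ((inner ℝ x e : ℝ) : ℂ)).HasTemperateGrowth := by fun_prop
  -- On the support s and s² coincide with Schwartz functions of s, whose operator norms C₁ and C₂
  -- on the weighted spaces do not depend on ζ. The bound with ∂_e involves the same cut-off of s,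
  -- so C₁ also serves as C₃.
  have e1 : posOp e (ftOp (G u)) =
      ftOp (mulOp (alongDir (cutS R hR (fun s => (s : ℂ) ^ 1) (contDiff_ofReal_pow 1)) e) (G u)) := by
    rw [posOp_ftOp]
    congr 1
    refine mulOp_congr tX (hasTemperateGrowth_alongDir _ _) fun j x hx => ?_
    rw [alongDir, cutS_apply hR _ (hs j x hx).le, pow_one]
  have e2 : posOp e (posOp e (ftOp (G u))) =
      ftOp (mulOp (alongDir (cutS R hR (fun s => (s : ℂ) ^ 2) (contDiff_ofReal_pow 2)) e) (G u)) := by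
    rw [posOp_ftOp, posOp_ftOp, mulOp_mulOp tX tX (m'' := fun x => ((inner ℝ x e : ℝ) : ℂ) ^ 2)
      (by fun_prop) fun x => (sq _).symm]
    congr 1
    refine mulOp_congr (by fun_prop) (hasTemperateGrowth_alongDir _ _) fun j x hx => ?_
    rw [alongDir, cutS_apply hR _ (hs j x hx).le]
  have hC₁0 : 0 ≤ C₁ := hC₁ ▸ multNorm_nonneg _
  have h := F.carleman_multiplier (V := ftOp (G u)) hC₁0 hC₁0 hM hK hK' hKτ hτ₁ hτ₂ rfl rfl rfl
    (C₂ := C₂)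
    (by rw [e1, hC₁]; exact F.norm_mT_alongDir_le hK22 hKτ _ _)
    (by rw [e2, hC₂]; exact F.norm_mT_alongDir_le hK22 hKτ _ _)
    (by rw [e1, hC₁]; exact F.norm_derOp_mT_le hK22 hKτ _ _)
  rwa [convexOp_mulOp hT, convexOp_ftOp F hR hu] at h

theorem sqrt_mul_norm_emb (w : Schwartz8) :
    √((2 * Real.pi) ^ 3) * ‖emb w‖ = ‖emb (ftOp w)‖ := by
  rw [← Real.sqrt_sq (norm_emb_nonneg (ftOp w)), norm_emb_ftOp, Real.sqrt_mul (by positivity),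
    Real.sqrt_sq (norm_emb_nonneg w)]

theorem gradNorm_eq (w : Schwartz8) :
    √((2 * Real.pi) ^ 3) * gradNorm w = ∑ i, ‖emb (derOp (bv i) (ftOp w))‖ := by
  rw [gradNorm, Finset.mul_sum]
  exact Finset.sum_congr rfl fun i _ => by rw [sqrt_mul_norm_emb, derOp_ftOp]

theorem abs_coord_le (ξ : R3) (i : Fin 3) : |inner ℝ ξ (bv i)| ≤ ‖ξ‖ := by
  have := abs_real_inner_le_norm ξ (bv i)
  simpa [bv] using this

/-- Derivatives are controlled by the weight `q^{1/4}`. -/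
theorem gradNorm_le (F : Frame ζ e τ) (hK : 1 ≤ K) (hKτ : K ≤ τ) (w : Schwartz8) :
    √((2 * Real.pi) ^ 3) * gradNorm w ≤ 30 * τ *
      ‖emb (mulOp (fun ξ => ((qSym ζ (K * τ) ξ ^ (1 / 4 : ℝ) : ℝ) : ℂ)) (ftOp w))‖ := by
  have hτ := F.one_le
  have hq := hasTemperateGrowth_qSym_rpow ζ (K * τ) (1 / 4)
  rw [gradNorm_eq]
  have : ∀ i : Fin 3, ‖emb (derOp (bv i) (ftOp w))‖ ≤ 10 * τ *
      ‖emb (mulOp (fun ξ => ((qSym ζ (K * τ) ξ ^ (1 / 4 : ℝ) : ℝ) : ℂ)) (ftOp w))‖ := fun i => by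
    refine norm_emb_mulOp_le (by fun_prop) (by fun_prop) (by positivity) (fun ξ => ?_) _
    rw [norm_mul, norm_neg, Complex.norm_I, one_mul, Complex.norm_real, Complex.norm_real,
      Real.norm_eq_abs, Real.norm_of_nonneg (Real.rpow_nonneg (qSym_pos _ _ _).le _)]
    exact (abs_coord_le ξ i).trans (F.norm_le_qSym hK hKτ ξ)
  refine (Finset.sum_le_sum fun i _ => this i).trans (le_of_eq ?_)
  rw [Finset.sum_const, Finset.card_univ, Fintype.card_fin]
  ring

theorem norm_emb_le_qSym (ζ : C3) (Λ : ℝ) (w : Schwartz8) :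
    √((2 * Real.pi) ^ 3) * ‖emb w‖ ≤
      ‖emb (mulOp (fun ξ => ((qSym ζ Λ ξ ^ (1 / 4 : ℝ) : ℝ) : ℂ)) (ftOp w))‖ := by
  have hq := hasTemperateGrowth_qSym_rpow ζ Λ (1 / 4)
  rw [sqrt_mul_norm_emb]
  have h := norm_emb_mulOp_le (m := fun _ => (1 : ℂ))
    (m' := fun ξ => ((qSym ζ Λ ξ ^ (1 / 4 : ℝ) : ℝ) : ℂ)) (by fun_prop) (by fun_prop) zero_le_one
    (fun ξ => ?_) (ftOp w)
  · rwa [mulOp_one, one_mul] at h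
  · rw [norm_one, one_mul, Complex.norm_real, Real.norm_eq_abs]
    exact (Real.one_le_rpow (one_le_qSym _ _ _) (by norm_num)).trans (le_abs_self _)

theorem qSym_mul_mT (ζ : C3) (Λ : ℝ) (w : Schwartz8) :
    mulOp (fun ξ => ((qSym ζ Λ ξ ^ (1 / 4 : ℝ) : ℝ) : ℂ))
      (mulOp (fun ξ => (mT ζ Λ ξ : ℂ)) w) = w := by
  have hq := hasTemperateGrowth_qSym_rpow ζ Λ (1 / 4)
  have hT := hasTemperateGrowth_mT ζ Λ
  rw [mulOp_mulOp (m'' := fun _ => 1) (by fun_prop) (by fun_prop) (by fun_prop), mulOp_one]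
  intro ξ
  have := Real.rpow_pos_of_pos (qSym_pos ζ Λ ξ) (1 / 4)
  rw [mT_eq_inv, ← Complex.ofReal_mul, mul_inv_cancel₀ this.ne', Complex.ofReal_one]

/-- Write q^{1/4} = q^{1/2} T and use τ q^{1/2} ≤ τ + |p_ζ|/K. The right side consists of the two
quantities controlled by the Carleman estimate. -/
theorem qSym_le_carleman (F : Frame ζ e τ) (hK : 0 < K) (V : Schwartz8) :
    τ * ‖emb (mulOp (fun ξ => ((qSym ζ (K * τ) ξ ^ (1 / 4 : ℝ) : ℝ) : ℂ)) V)‖ ≤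
      τ * ‖emb (mulOp (fun ξ => (mT ζ (K * τ) ξ : ℂ)) V)‖ +
        ‖emb (mulOp (p ζ) (mulOp (fun ξ => (mT ζ (K * τ) ξ : ℂ)) V))‖ / K := by
  have hτ := F.one_le
  have hτ0 : 0 < τ := by linarith
  have hq := hasTemperateGrowth_qSym_rpow ζ (K * τ) (1 / 4)
  have hT := hasTemperateGrowth_mT ζ (K * τ)
  have hp := hasTemperateGrowth_p ζ
  rw [← norm_emb_ofReal_smul hτ0.le, div_eq_inv_mul ‖_‖ K]
  refine norm_emb_le₂ hτ0.le (by positivity) fun j ξ => ?_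
  rw [Pi.smul_apply, smul_apply, mulOp_apply (by fun_prop), mulOp_apply hp,
    mulOp_apply (by fun_prop)]
  simp only [smul_eq_mul, norm_mul, Complex.norm_real]
  have hQ := Real.rpow_pos_of_pos (qSym_pos ζ (K * τ) ξ) (1 / 4)
  set Q := qSym ζ (K * τ) ξ ^ (1 / 4 : ℝ) with hQdef
  have hQ4 : (Q ^ 2) ^ 2 = qSym ζ (K * τ) ξ := by
    rw [← pow_mul, hQdef, ← Real.rpow_natCast, ← Real.rpow_mul (qSym_pos _ _ _).le]; norm_num
  have hle : τ * Q ^ 2 ≤ τ + K⁻¹ * ‖p ζ ξ‖ := by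
    have h1 : Q ^ 2 ≤ 1 + ‖((K * τ : ℝ) : ℂ)⁻¹ * p ζ ξ‖ := by
      refine le_of_sq_le_sq ?_ (by positivity)
      rw [hQ4, qSym]
      nlinarith [norm_nonneg (((K * τ : ℝ) : ℂ)⁻¹ * p ζ ξ)]
    rw [norm_mul, norm_inv, Complex.norm_real, Real.norm_of_nonneg (by positivity)] at h1
    calc τ * Q ^ 2 ≤ τ * (1 + (K * τ)⁻¹ * ‖p ζ ξ‖) := by gcongr
      _ = _ := by field_simp
  rw [mT_eq_inv, ← hQdef, Real.norm_of_nonneg hτ0.le, Real.norm_of_nonneg hQ.le,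
    Real.norm_of_nonneg (by positivity : 0 ≤ Q⁻¹)]
  have h2 := mul_le_mul_of_nonneg_right hle (by positivity : 0 ≤ Q⁻¹ * ‖V j ξ‖)
  calc _ = τ * Q ^ 2 * (Q⁻¹ * ‖V j ξ‖) := by field_simp
    _ ≤ _ := h2
    _ = _ := by ring

/-- The dual estimate: the conjugated equation tested against a solution of the dual problem. -/
theorem norm_source_le (F : Frame ζ e τ) (hR : 0 < R) (hK : 22 ≤ K) (hKτ : K ≤ τ)
    {a c N : ℝ} (ha : 0 ≤ a) (hc : 0 ≤ c) (hN : 0 ≤ N) {q : Schwartz8 → Functional8}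
    (hq : FirstOrder a c q)
    {u : Schwartz8} (hu : ∀ j, tsupport (u j) ⊆ Metric.ball 0 R)
    (hΛ : ∀ ψ, ‖(freeOp ζ u + q u) (conj8 ψ)‖ ≤ ((2 * Real.pi) ^ 3)⁻¹ * N *
      ‖emb (mulOp (fun ξ => ((√(2 * (K * τ)) * qSym ζ (K * τ) ξ ^ (1 / 4 : ℝ) : ℝ) : ℂ)) (ftOp ψ))‖) :
    let g := cutS R hR (gaussFactor M) (contDiff_gaussFactor M)
    let G := mulOp (alongDir g e)
    let T := mulOp (fun ξ => (mT ζ (K * τ) ξ : ℂ))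
    let S := mulOp (fun ξ => ((qSym ζ (K * τ) ξ ^ (1 / 4 : ℝ) : ℝ) : ℂ))
    ‖emb (T (ftOp (G (freeS ζ u))))‖ ≤ multNorm g * N * √(2 * (K * τ)) +
      (60 * a * τ + c) * ‖emb (S (ftOp (G u)))‖ := by
  intro g G T S
  have hτ := F.one_le
  have tg := hasTemperateGrowth_alongDir g e
  have tq := hasTemperateGrowth_qSym_rpow ζ (K * τ) (1 / 4)
  have tT := hasTemperateGrowth_mT ζ (K * τ)
  set Y := T (ftOp (G (freeS ζ u))) with hY
  -- The test function is chosen so that ‖Y‖² is (2π)³ times the pairing of f with G(-Δ + 2ζ·∇)u,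
  -- while its norm with weight q^{1/4} is exactly ‖Y‖.
  obtain ⟨f, hf⟩ := ftOp_surjective (T Y)
  have hST : S (ftOp f) = Y := by rw [hf]; exact qSym_mul_mT _ _ _
  set B : ℝ := (2 * Real.pi) ^ 3 with hB
  have hB0 : 0 < B := by positivity
  have hBB : √B * √B = B := Real.mul_self_sqrt hB0.le
  have hGconj : ∀ w, conj8 (G w) = G (conj8 w) := fun w =>
    conj8_mulOp tg (conj_alongDir_cutS hR M e) w
  -- The potential is added and subtracted: the full functional is tested against G f, and in the
  -- remainder G is moved onto u.
  have hid : inner ℂ (emb Y) (emb Y) = (B : ℂ) *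
      ((freeOp ζ u + q u) (conj8 (G f)) - q (G u) (conj8 f)) := by
    have h1 : inner ℂ (emb Y) (emb Y) = inner ℂ (emb (ftOp f)) (emb (ftOp (G (freeS ζ u)))) := by
      rw [hf]
      conv_lhs => rw [hY]
      exact ((mulOp_formalAdjoint (by fun_prop) (by fun_prop)
        (fun ξ => Complex.conj_ofReal _)) _ _).symm
    have h2 : freeOp ζ u (G (conj8 f)) = inner ℂ (emb f) (emb (G (freeS ζ u))) := by
      rw [freeOp_eq, inner_emb]
      refine Finset.sum_congr rfl fun j _ => integral_congr_ae (.of_forall fun x => ?_)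
      simp only [G, mulOp_apply tg, conj8_apply]
      ring
    rw [h1, inner_emb_ftOp, hGconj, Pi.add_apply, hq.comm _ tg, h2, hB]
    push_cast
    ring
  have hYsq : ‖emb Y‖ ^ 2 ≤ B * (‖(freeOp ζ u + q u) (conj8 (G f))‖ + ‖q (G u) (conj8 f)‖) := by
    have h1 : ‖inner ℂ (emb Y) (emb Y)‖ = ‖emb Y‖ ^ 2 := by
      rw [inner_self_eq_norm_sq_to_K]; simp
    rw [← h1, hid, norm_mul, Complex.norm_real, Real.norm_of_nonneg hB0.le]
    exact mul_le_mul_of_nonneg_left (norm_sub_le _ _) hB0.le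
  have hfirst : B * ‖(freeOp ζ u + q u) (conj8 (G f))‖ ≤
      multNorm g * N * √(2 * (K * τ)) * ‖emb Y‖ := by
    have h1 := hΛ (G f)
    have h2 : mulOp (fun ξ => ((√(2 * (K * τ)) * qSym ζ (K * τ) ξ ^ (1 / 4 : ℝ) : ℝ) : ℂ))
        (ftOp (G f)) = ((√(2 * (K * τ)) : ℝ) : ℂ) • S (ftOp (G f)) := by
      funext j
      ext ξ
      rw [mulOp_apply (by fun_prop), Pi.smul_apply, smul_apply, mulOp_apply (by fun_prop)]
      push_cast
      rw [smul_eq_mul, mul_assoc]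
    rw [h2, norm_emb_ofReal_smul (by positivity)] at h1
    have h3 := F.norm_qSym_alongDir_le hK hKτ g f
    rw [hST] at h3
    calc _ ≤ B * (B⁻¹ * N * (√(2 * (K * τ)) * ‖emb (S (ftOp (G f)))‖)) := by gcongr
      _ = N * √(2 * (K * τ)) * ‖emb (S (ftOp (G f)))‖ := by field_simp
      _ ≤ N * √(2 * (K * τ)) * (multNorm g * ‖emb Y‖) := by gcongr
      _ = _ := by ring
  have hcs : ∀ j, HasCompactSupport (G u j) := fun j =>
    (isCompact_closedBall (0 : R3) R).of_isClosed_subset (isClosed_tsupport _)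
      ((tsupport_mulOp hu _ j).trans Metric.ball_subset_closedBall)
  -- A gradient costs 30τ, that is 10τ in each of three directions; it falls on either argument,
  -- whence 60aτ.
  have hsecond : B * ‖q (G u) (conj8 f)‖ ≤ (60 * a * τ + c) * ‖emb (S (ftOp (G u)))‖ * ‖emb Y‖ := by
    have h1 := hq.bound (G u) (conj8 f) hcs
    have h2 : gradNorm (conj8 f) = gradNorm f := by
      simp only [gradNorm, norm_emb_dirOp_conj8]
    rw [norm_emb_conj8, h2] at h1
    have b1 := F.gradNorm_le (by linarith : 1 ≤ K) hKτ f
    have b2 := F.gradNorm_le (by linarith : 1 ≤ K) hKτ (G u)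
    have b3 := norm_emb_le_qSym ζ (K * τ) f
    have b4 := norm_emb_le_qSym ζ (K * τ) (G u)
    change _ ≤ 30 * τ * ‖emb (S (ftOp f))‖ at b1
    change _ ≤ ‖emb (S (ftOp f))‖ at b3
    change _ ≤ 30 * τ * ‖emb (S (ftOp (G u)))‖ at b2
    change _ ≤ ‖emb (S (ftOp (G u)))‖ at b4
    rw [hST] at b1 b3
    rw [← hB] at b1 b2 b3 b4
    set Q := ‖emb (S (ftOp (G u)))‖ with hQ
    have nQ : 0 ≤ Q := norm_emb_nonneg _
    have nY : 0 ≤ ‖emb Y‖ := norm_emb_nonneg _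
    have n1 : 0 ≤ √B * gradNorm f := mul_nonneg (Real.sqrt_nonneg _) (gradNorm_nonneg _)
    have n2 : 0 ≤ √B * gradNorm (G u) := mul_nonneg (Real.sqrt_nonneg _) (gradNorm_nonneg _)
    have n3 : 0 ≤ √B * ‖emb f‖ := mul_nonneg (Real.sqrt_nonneg _) (norm_emb_nonneg _)
    have n4 : 0 ≤ √B * ‖emb (G u)‖ := mul_nonneg (Real.sqrt_nonneg _) (norm_emb_nonneg _)
    have p1 := mul_le_mul b2 b3 n3 (by positivity)
    have p2 := mul_le_mul b4 b1 n1 nQ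
    have p3 := mul_le_mul b4 b3 n3 nQ
    calc B * ‖q (G u) (conj8 f)‖ ≤ √B * √B * (a * (gradNorm (G u) * ‖emb f‖ +
          ‖emb (G u)‖ * gradNorm f) + c * (‖emb (G u)‖ * ‖emb f‖)) := by
          rw [hBB]; exact mul_le_mul_of_nonneg_left h1 hB0.le
      _ = a * ((√B * gradNorm (G u)) * (√B * ‖emb f‖) +
          (√B * ‖emb (G u)‖) * (√B * gradNorm f)) +
          c * ((√B * ‖emb (G u)‖) * (√B * ‖emb f‖)) := by ring
      _ ≤ a * (30 * τ * Q * ‖emb Y‖ + Q * (30 * τ * ‖emb Y‖)) + c * (Q * ‖emb Y‖) := by gcongr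
      _ = _ := by ring
  have hfin : ‖emb Y‖ * ‖emb Y‖ ≤ (multNorm g * N * √(2 * (K * τ)) +
      (60 * a * τ + c) * ‖emb (S (ftOp (G u)))‖) * ‖emb Y‖ := by
    rw [← sq]
    refine hYsq.trans ?_
    rw [mul_add, add_mul]
    exact add_le_add hfirst hsecond
  have h0 : 0 ≤ multNorm g * N * √(2 * (K * τ)) +
      (60 * a * τ + c) * ‖emb (S (ftOp (G u)))‖ := by
    have := multNorm_nonneg g
    have := norm_emb_nonneg (S (ftOp (G u)))
    positivity
  rcases (norm_emb_nonneg Y).eq_or_lt with h | h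
  · rw [← h]; exact h0
  · exact le_of_mul_le_mul_right hfin h

end Frame

/-- The a priori estimate for `-Δ + 2 ζ·∇ + q` on functions with support in a ball. -/
theorem exists_apriori (a R : ℝ) (ha : 0 ≤ a) (hR : 0 < R) : ∃ K₀ : ℝ, 0 < K₀ ∧
    ∀ c : ℝ, 0 ≤ c → ∃ τ₀ : ℝ, ∀ (ζ : C3) (e : R3) (τ : ℝ), Frame ζ e τ → τ₀ ≤ τ →
      ∃ W : R3 → ℝ, W.HasTemperateGrowth ∧ (∀ ξ, weight ζ (1 / 2) ξ ≤ W ξ) ∧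
        ∀ q, FirstOrder a c q → ∀ u : Schwartz8, (∀ j, tsupport (u j) ⊆ Metric.ball 0 R) →
          ∀ N : ℝ, 0 ≤ N → (∀ ψ, ‖(freeOp ζ u + q u) (conj8 ψ)‖ ≤ ((2 * Real.pi) ^ 3)⁻¹ * N *
              ‖emb (mulOp (fun ξ => (W ξ : ℂ)) (ftOp ψ))‖) →
            ‖emb (mulOp (fun ξ => (W ξ : ℂ)) (ftOp u))‖ ≤ K₀ * N := by
  -- In √M = 180a + 4 the part 180a absorbs 3 · 60a from the potential. Of the remaining 4, one unit
  -- absorbs 3c ≤ τ, and three cancel the factor 3 of the Carleman estimate.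
  set M : ℝ := (180 * a + 4) ^ 2 with hM
  have hM1 : 1 ≤ M := by rw [hM]; nlinarith
  have hsM : √M = 180 * a + 4 := Real.sqrt_sq (by positivity)
  set C₁ := multNorm (cutS R hR (fun s => (s : ℂ) ^ 1) (contDiff_ofReal_pow 1)) with hC₁
  set C₂ := multNorm (cutS R hR (fun s => (s : ℂ) ^ 2) (contDiff_ofReal_pow 2)) with hC₂
  have hC₁0 : 0 ≤ C₁ := multNorm_nonneg _
  set gp := cutS R hR (gaussFactor M) (contDiff_gaussFactor M) with hgp
  set gm := cutS R hR (gaussFactor (-M)) (contDiff_gaussFactor (-M)) with hgm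
  have hHp := multNorm_nonneg gp
  have hHm := multNorm_nonneg gm
  -- Order of choices: M from a, then K from M and R, and only then the threshold for τ, the sole
  -- place where c is used.
  set K : ℝ := 132 * M + M * (3 + 6 * C₁ + 4 * C₁) with hKdef
  have hK1 : 132 * M ≤ K := by
    have : 0 ≤ M * (3 + 6 * C₁ + 4 * C₁) := by positivity
    linarith
  have hK2 : M * (3 + 6 * C₁ + 4 * C₁) ≤ K := by linarith
  have hK22 : 22 ≤ K := by linarith
  -- The summand 1 only ensures positivity.
  refine ⟨4 * multNorm gm * multNorm gp * K + 1, by positivity, fun c hc =>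
    ⟨max (max K (4 * M ^ 2 * (3 + 2 * C₁))) (max (M + M ^ 2 * C₂) (3 * c)), ?_⟩⟩
  intro ζ e τ F hτ0
  simp only [max_le_iff] at hτ0
  obtain ⟨⟨hKτ, hτ₁⟩, hτ₂, hτ₃⟩ := hτ0
  have hτ := F.one_le
  have tq := hasTemperateGrowth_qSym_rpow ζ (K * τ) (1 / 4)
  refine ⟨fun ξ => √(2 * (K * τ)) * qSym ζ (K * τ) ξ ^ (1 / 4 : ℝ), by fun_prop,
    F.weight_half_le hK22, fun q hq u hu N hN hΛ => ?_⟩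
  have hcar := F.carleman_support hR hC₁ hC₂ hM1 hK1 hK2 hKτ hτ₁ hτ₂ hu
  have hsrc := F.norm_source_le (M := M) hR hK22 hKτ ha hc hN hq hu hΛ
  have hlow := F.qSym_le_carleman (by linarith : 0 < K) (ftOp (mulOp (alongDir gp e) u))
  simp only [← hgp] at hcar hsrc
  set Q := ‖emb (mulOp (fun ξ => ((qSym ζ (K * τ) ξ ^ (1 / 4 : ℝ) : ℝ) : ℂ))
    (ftOp (mulOp (alongDir gp e) u)))‖ with hQ
  have hQ0 : 0 ≤ Q := Frame.norm_emb_nonneg _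
  have hmain : τ * Q ≤ multNorm gp * N * √(2 * (K * τ)) := by
    rw [hsM] at hcar
    have h1 := mul_le_mul_of_nonneg_left hlow (by positivity : 0 ≤ 180 * a + 4)
    have h2 : 3 * c * Q ≤ τ * Q := mul_le_mul_of_nonneg_right hτ₃ hQ0
    nlinarith
  -- The factor exp(-M s²/2) undoes the conjugation on the support of u, at the cost of its own
  -- multiplier norm.
  have hback : mulOp (alongDir gm e) (mulOp (alongDir gp e) u) = u := by
    have tm := hasTemperateGrowth_alongDir gm e
    have tp := hasTemperateGrowth_alongDir gp e
    rw [mulOp_mulOp (m'' := fun x => alongDir gm e x * alongDir gp e x) tm tp (by fun_prop)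
      fun _ => rfl]
    conv_rhs => rw [← mulOp_one u]
    refine mulOp_congr (by fun_prop) (by fun_prop) fun j x hx => ?_
    have := (abs_inner_lt_of_ne_zero F.norm_e hu j x hx).le
    rw [alongDir, alongDir, hgm, hgp, cutS_apply hR _ this, cutS_apply hR _ this,
      gaussFactor_neg_mul]
  have h3 := F.norm_qSym_alongDir_le hK22 hKτ gm (mulOp (alongDir gp e) u)
  rw [hback] at h3
  have h4 : mulOp (fun ξ => ((√(2 * (K * τ)) * qSym ζ (K * τ) ξ ^ (1 / 4 : ℝ) : ℝ) : ℂ))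
      (ftOp u) = ((√(2 * (K * τ)) : ℝ) : ℂ) •
        mulOp (fun ξ => ((qSym ζ (K * τ) ξ ^ (1 / 4 : ℝ) : ℝ) : ℂ)) (ftOp u) := by
    funext j
    ext ξ
    rw [mulOp_apply (by fun_prop), Pi.smul_apply, smul_apply, mulOp_apply (by fun_prop)]
    push_cast
    rw [smul_eq_mul, mul_assoc]
  rw [h4, Frame.norm_emb_ofReal_smul (by positivity)]
  have h5 : √(2 * (K * τ)) * √(2 * (K * τ)) = 2 * (K * τ) := Real.mul_self_sqrt (by positivity)
  have h6 : √(2 * (K * τ)) * (multNorm gm * Q) * τ ≤ (2 * multNorm gm * multNorm gp * K * N) * τ := by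
    calc _ = √(2 * (K * τ)) * multNorm gm * (τ * Q) := by ring
      _ ≤ √(2 * (K * τ)) * multNorm gm * (multNorm gp * N * √(2 * (K * τ))) := by gcongr
      _ = (√(2 * (K * τ)) * √(2 * (K * τ))) * (multNorm gm * multNorm gp * N) := by ring
      _ = _ := by rw [h5]; ring
  have h7 := le_of_mul_le_mul_right h6 (by linarith)
  have h8 : √(2 * (K * τ)) * ‖emb (mulOp (fun ξ => ((qSym ζ (K * τ) ξ ^ (1 / 4 : ℝ) : ℝ) : ℂ))
      (ftOp u))‖ ≤ √(2 * (K * τ)) * (multNorm gm * Q) :=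
    mul_le_mul_of_nonneg_left h3 (Real.sqrt_nonneg _)
  have h9 : 0 ≤ multNorm gm * multNorm gp * K * N := by positivity
  nlinarith

/-! ### The weighted norms: duality and finiteness -/

/-- Conjugation reverses the sign in the kernel, so this is Fourier inversion. It exhibits conj ψ as
a transform, the form in which functionals are tested. -/
theorem ft_conjS_ft (ψ : 𝓢(R3, ℂ)) :
    ft (conjS (ft ψ)) = ((2 * Real.pi : ℂ) ^ 3) • conjS ψ := by
  ext x
  rw [ft_apply, smul_apply, conjS_apply, smul_eq_mul]
  have h1 := integral_comp_dilation fun z =>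
    Complex.exp (Complex.I * (inner ℝ ((2 * Real.pi) • z) x : ℝ)) * starRingEnd ℂ ((𝓕⁻ ψ) z)
  have h2 : ∀ ξ : R3, (2 * Real.pi) • (2 * Real.pi)⁻¹ • ξ = ξ := fun ξ =>
    smul_inv_smul₀ (by positivity) ξ
  simp only [h2] at h1
  simp only [conjS_apply, ft_eq]
  rw [h1, Complex.real_smul]
  have h3 : ψ x = 𝓕 (𝓕⁻ ψ) x := by rw [FourierTransform.fourier_fourierInv_eq]
  rw [h3, fourier_coe, Real.fourier_eq', ← integral_conj]
  push_cast
  congr 1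
  refine integral_congr_ae (.of_forall fun z => ?_)
  simp only [smul_eq_mul, map_mul, ← Complex.exp_conj, Complex.conj_ofReal, Complex.conj_I,
    inner_smul_left, conj_trivial]
  congr 2
  push_cast
  simp only [map_neg, map_ofNat]
  ring

theorem continuous_p (ζ : C3) : Continuous (p ζ) := (hasTemperateGrowth_p ζ).1.continuous

theorem norm_zeta_add_pos {ζ : C3} (hζ : 0 < ‖ζ‖) (ξ : R3) : 0 < ‖ζ‖ + ‖p ζ ξ‖ := by positivity

theorem weight_pos {ζ : C3} (hζ : 0 < ‖ζ‖) (b : ℝ) (ξ : R3) : 0 < weight ζ b ξ :=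
  Real.rpow_pos_of_pos (norm_zeta_add_pos hζ ξ) _

theorem continuous_weight {ζ : C3} (hζ : 0 < ‖ζ‖) (b : ℝ) : Continuous (weight ζ b) :=
  (continuous_const.add (continuous_p ζ).norm).rpow_const
    fun ξ => Or.inl (norm_zeta_add_pos hζ ξ).ne'

theorem weight_neg_mul {ζ : C3} (hζ : 0 < ‖ζ‖) (ξ : R3) :
    weight ζ (-1 / 2) ξ * weight ζ (1 / 2) ξ = 1 := by
  rw [weight, weight, ← Real.rpow_add (norm_zeta_add_pos hζ ξ)]
  norm_num

theorem enorm_ofReal_nonneg {a : ℝ} (ha : 0 ≤ a) : ‖(a : ℂ)‖ₑ = ENNReal.ofReal a := by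
  rw [← ofReal_norm, Complex.norm_real, Real.norm_of_nonneg ha]

theorem eLpNorm_two_sq (f : R3 → ℂ) : eLpNorm f 2 volume ^ 2 = ∫⁻ x, ‖f x‖ₑ ^ 2 := by
  have := eLpNorm_nnreal_pow_eq_lintegral (f := f) (μ := (volume : Measure R3)) (p := 2) two_ne_zero
  simpa using this

/-- The weighted norm of a candidate for the Fourier transform. -/
def candNorm (ζ : C3) (b : ℝ) (g : Fin 8 → R3 → ℂ) : ℝ≥0∞ :=
  (∑ j, eLpNorm (fun ξ => (weight ζ b ξ : ℂ) * g j ξ) 2 volume ^ 2) ^ (1 / 2 : ℝ)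

theorem sum_mul_le_sqrt (a b : Fin 8 → ℝ≥0∞) :
    ∑ j, a j * b j ≤ (∑ j, a j ^ 2) ^ (1 / 2 : ℝ) * (∑ j, b j ^ 2) ^ (1 / 2 : ℝ) := by
  have := ENNReal.inner_le_Lp_mul_Lq Finset.univ a b Real.HolderConjugate.two_two
  simpa using this

theorem sqrt_sum_lintegral_eq (w : Schwartz8) :
    (∑ j, ∫⁻ x, ‖w j x‖ₑ ^ 2) ^ (1 / 2 : ℝ) = ENNReal.ofReal ‖emb w‖ := by
  rw [← norm_emb_sq_eq_lintegral, ENNReal.ofReal_rpow_of_nonneg (sq_nonneg _) (by norm_num),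
    ← Real.sqrt_eq_rpow, Real.sqrt_sq (Frame.norm_emb_nonneg w)]

/-- Cauchy–Schwarz after inserting 1 ≤ `weight ζ (-1/2)` · W, first in L² and then over the
components. -/
theorem enorm_pairing_le {ζ : C3} (hζ : 0 < ‖ζ‖) {W : R3 → ℝ} (hW : W.HasTemperateGrowth)
    (hle : ∀ ξ, weight ζ (1 / 2) ξ ≤ W ξ) {g : Fin 8 → R3 → ℂ}
    (hg : ∀ j, LocallyIntegrable (g j) volume) (φ : Schwartz8) :
    ‖∑ j, ∫ ξ, g j ξ * φ j ξ‖ₑ ≤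
      candNorm ζ (-1 / 2) g * ENNReal.ofReal ‖emb (mulOp (fun ξ => (W ξ : ℂ)) φ)‖ := by
  have hWc : (fun ξ => (W ξ : ℂ)).HasTemperateGrowth := by fun_prop
  have hWm : Measurable fun ξ => (W ξ : ℂ) := hWc.1.continuous.measurable
  have hwm : Measurable fun ξ => (weight ζ (-1 / 2) ξ : ℂ) :=
    (Complex.continuous_ofReal.comp (continuous_weight hζ _)).measurable
  calc ‖∑ j, ∫ ξ, g j ξ * φ j ξ‖ₑ ≤ ∑ j, ‖∫ ξ, g j ξ * φ j ξ‖ₑ := enorm_sum_le _ _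
    _ ≤ ∑ j, eLpNorm (fun ξ => (weight ζ (-1 / 2) ξ : ℂ) * g j ξ) 2 volume *
        eLpNorm (mulOp (fun ξ => (W ξ : ℂ)) φ j) 2 volume := by
        refine Finset.sum_le_sum fun j _ => (enorm_integral_le_lintegral_enorm _).trans ?_
        have hgm := (hg j).aestronglyMeasurable.aemeasurable
        have hφm := (φ j).continuous.measurable
        have hf1 : AEMeasurable fun ξ => ‖(weight ζ (-1 / 2) ξ : ℂ) * g j ξ‖ₑ :=
          (hwm.aemeasurable.mul hgm).enorm
        have hf2 : AEMeasurable fun ξ => ‖mulOp (fun ξ => (W ξ : ℂ)) φ j ξ‖ₑ :=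
          ((mulOp (fun ξ => (W ξ : ℂ)) φ j).continuous.measurable).enorm.aemeasurable
        have hH := ENNReal.lintegral_mul_le_Lp_mul_Lq volume Real.HolderConjugate.two_two hf1 hf2
        refine (lintegral_mono fun ξ => ?_).trans (hH.trans (le_of_eq ?_))
        · simp only [Pi.mul_apply]
          rw [mulOp_apply hWc, ← enorm_mul]
          have h1 : ‖(1 : ℂ)‖ₑ ≤ ‖(weight ζ (-1 / 2) ξ : ℂ) * (W ξ : ℂ)‖ₑ := by
            rw [← Complex.ofReal_mul, enorm_ofReal_nonneg, ← Complex.ofReal_one,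
              enorm_ofReal_nonneg zero_le_one]
            · refine ENNReal.ofReal_le_ofReal ?_
              exact (weight_neg_mul hζ ξ).symm.le.trans
                (mul_le_mul_of_nonneg_left (hle ξ) (weight_pos hζ _ _).le)
            · exact mul_nonneg (weight_pos hζ _ _).le ((weight_pos hζ _ _).le.trans (hle ξ))
          calc ‖g j ξ * φ j ξ‖ₑ = ‖(1 : ℂ)‖ₑ * ‖g j ξ * φ j ξ‖ₑ := by simp
            _ ≤ ‖(weight ζ (-1 / 2) ξ : ℂ) * (W ξ : ℂ)‖ₑ * ‖g j ξ * φ j ξ‖ₑ := by gcongr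
            _ = _ := by rw [← enorm_mul]; congr 1; ring
        · have : ∀ f : R3 → ℂ, (∫⁻ ξ, ‖f ξ‖ₑ ^ (2 : ℝ)) ^ (1 / (2 : ℝ)) = eLpNorm f 2 volume :=
            fun f => by
              rw [eLpNorm_eq_lintegral_rpow_enorm_toReal two_ne_zero ENNReal.ofNat_ne_top]
              simp
          rw [this, this]
    _ ≤ _ := sum_mul_le_sqrt _ _
    _ = _ := by
        rw [candNorm, ← sqrt_sum_lintegral_eq]
        simp only [eLpNorm_two_sq]

/-- Duality between the weighted spaces. -/
theorem norm_functional_conj8_le {ζ : C3} (hζ : 0 < ‖ζ‖) {W : R3 → ℝ}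
    (hW : W.HasTemperateGrowth) (hle : ∀ ξ, weight ζ (1 / 2) ξ ≤ W ξ) {Λ : Functional8}
    {g : Fin 8 → R3 → ℂ} (hg : HasFourierTransform Λ g) (hfin : candNorm ζ (-1 / 2) g ≠ ⊤)
    (ψ : Schwartz8) :
    ‖Λ (conj8 ψ)‖ ≤ ((2 * Real.pi) ^ 3)⁻¹ * (candNorm ζ (-1 / 2) g).toReal *
      ‖emb (mulOp (fun ξ => (W ξ : ℂ)) (ftOp ψ))‖ := by
  have hWc : (fun ξ => (W ξ : ℂ)).HasTemperateGrowth := by fun_prop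
  set B : ℝ := (2 * Real.pi) ^ 3 with hB
  have hB0 : 0 < B := by positivity
  have hBc : (B : ℂ) ≠ 0 := by exact_mod_cast hB0.ne'
  -- This is the function whose transform is conj ψ, so W sees it as (2π)⁻³ ψ̂.
  set χ : Schwartz8 := ((B⁻¹ : ℝ) : ℂ) • conj8 (ftOp ψ) with hχ
  have h1 : conj8 ψ = fun j => ft (χ j) := by
    funext j
    have h2 : ft (χ j) = (B⁻¹ : ℂ) • ft (conjS (ft (ψ j))) := by
      rw [← Complex.ofReal_inv]
      exact ftₗ.map_smul _ _
    have h3 : (2 * Real.pi : ℂ) ^ 3 = B := by rw [hB]; push_cast; rfl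
    rw [h2, ft_conjS_ft, h3, inv_smul_smul₀ hBc]
    rfl
  have h4 : ‖emb (mulOp (fun ξ => (W ξ : ℂ)) χ)‖ =
      B⁻¹ * ‖emb (mulOp (fun ξ => (W ξ : ℂ)) (ftOp ψ))‖ := by
    rw [hχ, map_smul, Frame.norm_emb_ofReal_smul (by positivity),
      ← conj8_mulOp hWc (fun ξ => Complex.conj_ofReal _), norm_emb_conj8]
  have h5 := enorm_pairing_le hζ hW hle hg.locallyIntegrable χ
  rw [h1, hg.pairing]
  rw [h4] at h5
  have h6 := ENNReal.toReal_mono (ENNReal.mul_ne_top hfin ENNReal.ofReal_ne_top) h5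
  rw [ENNReal.toReal_mul, toReal_enorm, ENNReal.toReal_ofReal (by positivity)] at h6
  refine h6.trans (le_of_eq ?_)
  ring

theorem hasFourierTransform_ofSchwartz (u : Schwartz8) :
    HasFourierTransform (ofSchwartz u) fun j => ft (u j) where
  locallyIntegrable j := (ft (u j)).integrable.locallyIntegrable
  integrable j φ := by
    have h := MemLp.integrable_mul (p := 2) (q := 2) ((ft (u j)).memLp 2 (volume : Measure R3))
      (φ.memLp 2 volume)
    exact h
  pairing φ := Finset.sum_congr rfl fun j _ => (integral_ft_mul (u j) (φ j)).symm

/-- The infimum defining the norm is bounded by its value at one candidate. On the right of the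
final estimate all candidates are treated, so uniqueness of the transform is not needed. -/
theorem xNorm_ofSchwartz_le {ζ : C3} (hζ : 0 < ‖ζ‖) {W : R3 → ℝ} (hW : W.HasTemperateGrowth)
    (hle : ∀ ξ, weight ζ (1 / 2) ξ ≤ W ξ) (u : Schwartz8) :
    xNorm ζ (1 / 2) (ofSchwartz u) ≤
      ENNReal.ofReal ‖emb (mulOp (fun ξ => (W ξ : ℂ)) (ftOp u))‖ := by
  have hWc : (fun ξ => (W ξ : ℂ)).HasTemperateGrowth := by fun_prop
  refine (iInf₂_le _ (hasFourierTransform_ofSchwartz u)).trans ?_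
  rw [← sqrt_sum_lintegral_eq]
  refine ENNReal.rpow_le_rpow (Finset.sum_le_sum fun j _ => ?_) (by norm_num)
  rw [eLpNorm_two_sq]
  refine lintegral_mono fun ξ => ?_
  rw [mulOp_apply hWc, enorm_mul, enorm_mul, enorm_ofReal_nonneg (weight_pos hζ _ _).le,
    enorm_ofReal_nonneg ((weight_pos hζ _ _).le.trans (hle ξ)), ftOp_apply]
  gcongr
  exact hle ξ

/-- An a priori estimate tested by duality gives an estimate of the weighted norms. -/
theorem xNorm_le_of_dual {ζ : C3} (hζ : 0 < ‖ζ‖) {W : R3 → ℝ} (hW : W.HasTemperateGrowth)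
    (hle : ∀ ξ, weight ζ (1 / 2) ξ ≤ W ξ) {Λ : Functional8} {u : Schwartz8} {K₀ : ℝ}
    (hK₀ : 0 < K₀) (h : ∀ N : ℝ, 0 ≤ N →
      (∀ ψ, ‖Λ (conj8 ψ)‖ ≤ ((2 * Real.pi) ^ 3)⁻¹ * N *
        ‖emb (mulOp (fun ξ => (W ξ : ℂ)) (ftOp ψ))‖) →
      ‖emb (mulOp (fun ξ => (W ξ : ℂ)) (ftOp u))‖ ≤ K₀ * N) :
    xNorm ζ (1 / 2) (ofSchwartz u) ≤ K₀.toNNReal * xNorm ζ (-1 / 2) Λ := by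
  have hK : (K₀.toNNReal : ℝ≥0∞) ≠ 0 := by simpa using hK₀
  rw [xNorm.eq_def ζ (-1 / 2), ENNReal.mul_iInf_of_ne hK ENNReal.coe_ne_top]
  refine le_iInf fun g => ?_
  rw [ENNReal.mul_iInf_of_ne hK ENNReal.coe_ne_top]
  refine le_iInf fun hg => ?_
  change _ ≤ _ * candNorm ζ (-1 / 2) g
  by_cases hfin : candNorm ζ (-1 / 2) g = ⊤
  · rw [hfin, ENNReal.mul_top hK]; exact le_top
  · have h1 := h _ ENNReal.toReal_nonneg (norm_functional_conj8_le hζ hW hle hg hfin)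
    refine (xNorm_ofSchwartz_le hζ hW hle u).trans ((ENNReal.ofReal_le_ofReal h1).trans ?_)
    rw [ENNReal.ofReal_mul hK₀.le, ENNReal.ofReal_toReal hfin]
    rfl

/-! ### Finiteness of the X^{-1/2} norm -/

/-- The Riesz representation theorem for functionals on Schwartz functions that are bounded for
the `L²` norm. -/
theorem exists_memLp_of_bound (l : 𝓢(R3, ℂ) →ₗ[ℂ] ℂ) {B : ℝ}
    (h : ∀ η, ‖l η‖ ≤ B * ‖η.toLp 2 (volume : Measure R3)‖) :
    ∃ f : R3 → ℂ, MemLp f 2 volume ∧ ∀ η, l η = ∫ ξ, f ξ * η ξ := by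
  have hd : DenseRange (toLpCLM ℂ ℂ 2 (volume : Measure R3)).toLinearMap :=
    denseRange_toLpCLM ENNReal.ofNat_ne_top
  set L := l.extendOfNorm (toLpCLM ℂ ℂ 2 (volume : Measure R3)).toLinearMap
  have hL : ∀ η : 𝓢(R3, ℂ), L (η.toLp 2 volume) = l η :=
    fun η => LinearMap.extendOfNorm_eq hd ⟨B, h⟩ η
  set k := (InnerProductSpace.toDual ℂ (Lp ℂ 2 (volume : Measure R3))).symm L with hk
  refine ⟨fun ξ => starRingEnd ℂ (k ξ), (Lp.memLp k).star, fun η => ?_⟩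
  rw [← hL, ← InnerProductSpace.toDual_symm_apply (y := L), ← hk, L2.inner_def]
  refine integral_congr_ae ?_
  filter_upwards [η.coeFn_toLp 2 (volume : Measure R3)] with ξ hξ
  rw [hξ, RCLike.inner_apply, mul_comm]

/-- From ‖ξ‖² ≤ |p_ζ| + 2‖ζ‖‖ξ‖ by completing the square. -/
theorem norm_sq_le_norm_p (ζ : C3) (ξ : R3) : ‖ξ‖ ^ 2 ≤ 2 * ‖p ζ ξ‖ + 4 * ‖ζ‖ ^ 2 := by
  have h1 : ‖∑ i, ζ i * (ξ i : ℂ)‖ ≤ ‖ζ‖ * ‖ξ‖ := by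
    rw [sum_mul_eq]
    refine le_of_sq_le_sq ?_ (by positivity)
    have a1 : (inner ℝ ξ (reVec ζ)) ^ 2 ≤ (‖ξ‖ * ‖reVec ζ‖) ^ 2 :=
      sq_le_sq' (by linarith [neg_abs_le (inner ℝ ξ (reVec ζ)), abs_real_inner_le_norm ξ (reVec ζ)])
        (real_inner_le_norm _ _)
    have a2 : (inner ℝ ξ (imVec ζ)) ^ 2 ≤ (‖ξ‖ * ‖imVec ζ‖) ^ 2 :=
      sq_le_sq' (by linarith [neg_abs_le (inner ℝ ξ (imVec ζ)), abs_real_inner_le_norm ξ (imVec ζ)])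
        (real_inner_le_norm _ _)
    rw [Complex.sq_norm, Complex.normSq_apply, mul_pow, norm_sq_eq_re_im]
    simp
    nlinarith
  have h2 : ‖ξ‖ ^ 2 ≤ ‖p ζ ξ‖ + 2 * (‖ζ‖ * ‖ξ‖) := by
    have h3 : ((‖ξ‖ : ℂ)) ^ 2 = p ζ ξ + 2 * Complex.I * ∑ i, ζ i * (ξ i : ℂ) := by rw [p]; ring
    have h4 : ‖((‖ξ‖ : ℂ)) ^ 2‖ = ‖ξ‖ ^ 2 := by simp
    rw [← h4, h3]
    refine (norm_add_le _ _).trans ?_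
    rw [norm_mul, norm_mul, Complex.norm_I]
    simp only [Complex.norm_ofNat, mul_one]
    linarith
  nlinarith [sq_nonneg (‖ξ‖ - 2 * ‖ζ‖)]

/-- The embedding of H⁻¹ into X^{-1/2}. Its constant depends on ζ, which is harmless since only
finiteness is deduced from it. -/
theorem weight_mul_bracket_le {ζ : C3} (hζ : 0 < ‖ζ‖) (ξ : R3) :
    weight ζ (-1 / 2) ξ * (1 + ‖ξ‖ ^ 2) ^ (1 / 2 : ℝ) ≤ √(2 + (1 + 4 * ‖ζ‖ ^ 2) / ‖ζ‖) := by
  have h0 := norm_zeta_add_pos hζ ξ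
  have h1 : 1 + ‖ξ‖ ^ 2 ≤ (2 + (1 + 4 * ‖ζ‖ ^ 2) / ‖ζ‖) * (‖ζ‖ + ‖p ζ ξ‖) := by
    have h2 := norm_sq_le_norm_p ζ ξ
    have h3 : (1 + 4 * ‖ζ‖ ^ 2) / ‖ζ‖ * ‖ζ‖ = 1 + 4 * ‖ζ‖ ^ 2 := div_mul_cancel₀ _ hζ.ne'
    have h4 : 0 ≤ (1 + 4 * ‖ζ‖ ^ 2) / ‖ζ‖ * ‖p ζ ξ‖ := by positivity
    nlinarith
  rw [weight, ← Real.sqrt_eq_rpow, show (-1 / 2 : ℝ) = -(1 / 2) by norm_num,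
    Real.rpow_neg h0.le, ← Real.sqrt_eq_rpow, inv_mul_le_iff₀ (by positivity),
    ← Real.sqrt_mul h0.le]
  refine Real.sqrt_le_sqrt (h1.trans (le_of_eq (mul_comm _ _)))

/-- Functionals that are bounded by one derivative have finite `X^{-1/2}_ζ` norm. -/
theorem xNorm_lt_top {ζ : C3} (hζ : 0 < ‖ζ‖) {Λ : Functional8}
    (hadd : ∀ φ ψ, Λ (φ + ψ) = Λ φ + Λ ψ) (hsmul : ∀ (b : ℂ) φ, Λ (b • φ) = b * Λ φ) {B : ℝ}
    (hB : 0 ≤ B) (hbd : ∀ φ, ‖Λ φ‖ ≤ B * (‖emb φ‖ + gradNorm φ)) : xNorm ζ (-1 / 2) Λ < ⊤ := by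
  set J : R3 → ℝ := fun ξ => (1 + ‖ξ‖ ^ 2) ^ (1 / 2 : ℝ) with hJ
  set J' : R3 → ℝ := fun ξ => (1 + ‖ξ‖ ^ 2) ^ (-1 / 2 : ℝ) with hJ'
  have tJ : J.HasTemperateGrowth := Function.hasTemperateGrowth_one_add_norm_sq_rpow R3 _
  have tJ' : J'.HasTemperateGrowth := Function.hasTemperateGrowth_one_add_norm_sq_rpow R3 _
  have tJc : (fun ξ => (J ξ : ℂ)).HasTemperateGrowth := by fun_prop
  have tJc' : (fun ξ => (J' ξ : ℂ)).HasTemperateGrowth := by fun_prop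
  have hJJ : ∀ ξ, J' ξ * J ξ = 1 := fun ξ => by
    rw [hJ, hJ']
    simp only
    rw [← Real.rpow_add (by positivity)]; norm_num
  have hJ1 : ∀ ξ, J ξ = √(1 + ‖ξ‖ ^ 2) := fun ξ => (Real.sqrt_eq_rpow _).symm
  have hJpos : ∀ ξ, 0 < J ξ := fun ξ => by rw [hJ1]; positivity
  have hJpos' : ∀ ξ, 0 < J' ξ := fun ξ => Real.rpow_pos_of_pos (by positivity) _
  let Λₗ : Schwartz8 →ₗ[ℂ] ℂ :=
    { toFun := Λ, map_add' := hadd, map_smul' := fun b φ => by rw [hsmul]; rfl }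
  -- With J = (1 + ‖ξ‖²)^{1/2}, this is the transform of Λ divided by J. It is bounded in L² because
  -- `ft` turns the coordinates, each at most J, into derivatives.
  let ℓ : Schwartz8 →ₗ[ℂ] ℂ := Λₗ ∘ₗ ftOp ∘ₗ mulOp fun ξ => (J' ξ : ℂ)
  set b : ℝ := √((2 * Real.pi) ^ 3) with hb
  have hb0 : 0 ≤ b := Real.sqrt_nonneg _
  have hℓ : ∀ η, ‖ℓ η‖ ≤ B * (4 * b) * ‖emb η‖ := fun η => by
    set z := mulOp (fun ξ => (J' ξ : ℂ)) η with hz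
    have h1 : ‖ℓ η‖ ≤ B * (‖emb (ftOp z)‖ + gradNorm (ftOp z)) := hbd _
    have hz1 : ‖emb z‖ ≤ 1 * ‖emb η‖ := norm_emb_le zero_le_one fun j ξ => by
      rw [hz, mulOp_apply tJc', norm_mul, Complex.norm_real, Real.norm_of_nonneg (hJpos' ξ).le]
      refine mul_le_mul_of_nonneg_right ?_ (norm_nonneg _)
      have h2 : 1 ≤ J ξ := by rw [hJ1]; exact Real.one_le_sqrt.2 (by nlinarith [norm_nonneg ξ])
      nlinarith [hJJ ξ, hJpos' ξ]
    have hz2 : ∀ i, ‖emb (dirOp (bv i) (ftOp z))‖ ≤ b * ‖emb η‖ := fun i => by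
      have h3 : ‖emb (dirOp (bv i) (ftOp z))‖ = ‖emb (posOp (bv i) (ftOp z))‖ := by
        rw [posOp_apply, map_smul, norm_smul, norm_neg, Complex.norm_I, one_mul]
      rw [h3, posOp_ftOp, ← Frame.sqrt_mul_norm_emb]
      refine mul_le_mul_of_nonneg_left ?_ hb0
      have h4 : ‖emb (mulOp (fun x => ((inner ℝ x (bv i) : ℝ) : ℂ)) z)‖ ≤ 1 * ‖emb η‖ :=
        norm_emb_le zero_le_one fun j ξ => by
          rw [mulOp_apply (by fun_prop), hz, mulOp_apply tJc', norm_mul, norm_mul,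
            Complex.norm_real, Complex.norm_real, Real.norm_of_nonneg (hJpos' ξ).le, ← mul_assoc]
          refine mul_le_mul_of_nonneg_right ?_ (norm_nonneg _)
          have h5 : |inner ℝ ξ (bv i)| ≤ J ξ := (Frame.abs_coord_le ξ i).trans (by
            rw [hJ1]; exact Real.le_sqrt_of_sq_le (by linarith))
          rw [Real.norm_eq_abs, ← hJJ ξ, mul_comm]
          exact mul_le_mul_of_nonneg_left h5 (hJpos' ξ).le
      rwa [one_mul] at h4
    have hz3 : gradNorm (ftOp z) ≤ 3 * (b * ‖emb η‖) := by
      refine (Finset.sum_le_sum fun i _ => hz2 i).trans (le_of_eq ?_)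
      rw [Finset.sum_const, Finset.card_univ, Fintype.card_fin]; ring
    rw [← Frame.sqrt_mul_norm_emb] at h1
    rw [one_mul] at hz1
    calc ‖ℓ η‖ ≤ B * (b * ‖emb η‖ + 3 * (b * ‖emb η‖)) :=
          h1.trans (mul_le_mul_of_nonneg_left
            (add_le_add (mul_le_mul_of_nonneg_left hz1 hb0) hz3) hB)
      _ = _ := by ring
  have hsingle : ∀ (j : Fin 8) (η : 𝓢(R3, ℂ)),
      ‖emb (Pi.single j η)‖ = ‖η.toLp 2 (volume : Measure R3)‖ := fun j η => by
    rw [norm_emb, Finset.sum_eq_single j]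
    · rw [Pi.single_eq_same, Real.sqrt_sq (norm_nonneg _)]
    · intro i _ hij
      rw [Pi.single_eq_of_ne hij, ← toLpCLM_apply (𝕜 := ℂ), map_zero]; simp
    · simp
  have hex : ∀ j : Fin 8, ∃ f : R3 → ℂ, MemLp f 2 volume ∧
      ∀ η, ℓ (Pi.single j η) = ∫ ξ, f ξ * η ξ := fun j =>
    exists_memLp_of_bound (ℓ ∘ₗ LinearMap.single ℂ (fun _ : Fin 8 => 𝓢(R3, ℂ)) j)
      (B := B * (4 * b)) fun η => (hℓ _).trans (le_of_eq (by
        rw [← hsingle j η]; rfl))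
  choose f hf hfℓ using hex
  have hJη : ∀ φ : Schwartz8, mulOp (fun ξ => (J' ξ : ℂ)) (mulOp (fun ξ => (J ξ : ℂ)) φ) = φ :=
    fun φ => by
      rw [mulOp_mulOp (m'' := fun _ => 1) tJc' tJc (by fun_prop), mulOp_one]
      intro ξ
      rw [← Complex.ofReal_mul, hJJ, Complex.ofReal_one]
  -- Riesz representation of each component of ℓ gives f in L², and the transform of Λ is J f.
  have hF : HasFourierTransform Λ fun j ξ => (J ξ : ℂ) * f j ξ :=
    { locallyIntegrable := fun j => by
        have h := ((hf j).locallyIntegrable one_le_two).smul_continuous tJc.1.continuous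
        simpa only [smul_eq_mul, mul_comm] using h
      integrable := fun j φ => by
        have h := MemLp.integrable_mul (p := 2) (q := 2) (hf j)
          ((smulLeftCLM ℂ (fun ξ => (J ξ : ℂ)) φ).memLp 2 (volume : Measure R3))
        refine h.congr (.of_forall fun ξ => ?_)
        simp only [Pi.mul_apply, smulLeftCLM_apply_apply tJc, smul_eq_mul]
        ring
      pairing := fun φ => by
        have h1 : Λ (fun j => ft (φ j)) = ℓ (mulOp (fun ξ => (J ξ : ℂ)) φ) := by
          change Λ (ftOp φ) = Λ (ftOp (mulOp (fun ξ => (J' ξ : ℂ)) _))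
          rw [hJη]
        have h2 : mulOp (fun ξ => (J ξ : ℂ)) φ =
            ∑ j, Pi.single j (mulOp (fun ξ => (J ξ : ℂ)) φ j) :=
          (Finset.univ_sum_single _).symm
        rw [h1, h2, map_sum]
        refine Finset.sum_congr rfl fun j _ => ?_
        rw [hfℓ]
        refine integral_congr_ae (.of_forall fun ξ => ?_)
        simp only [mulOp_apply tJc]
        ring }
  refine (iInf₂_le _ hF).trans_lt ?_
  refine ENNReal.rpow_lt_top_of_nonneg (by norm_num) (ENNReal.sum_lt_top.2 fun j _ => ?_).ne
  refine ENNReal.pow_lt_top ?_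
  refine ((hf j).of_le_mul (c := √(2 + (1 + 4 * ‖ζ‖ ^ 2) / ‖ζ‖)) ?_ (.of_forall fun ξ => ?_)).2
  · exact ((Complex.continuous_ofReal.comp (continuous_weight hζ _)).aestronglyMeasurable).mul
      (tJc.1.continuous.aestronglyMeasurable.mul (hf j).1)
  · rw [norm_mul, norm_mul, ← mul_assoc, Complex.norm_real, Complex.norm_real,
      Real.norm_of_nonneg (weight_pos hζ _ _).le, Real.norm_of_nonneg (hJpos ξ).le]
    exact mul_le_mul_of_nonneg_right (weight_mul_bracket_le hζ ξ) (norm_nonneg _)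

/-! ### Bilinear forms of first order given by integrals -/

/-- Bilinear integrands whose integrals form a bilinear form of first order. -/
structure IsFirstOrder (a c : ℝ) (I : Schwartz8 → Schwartz8 → R3 → ℂ) : Prop where
  integrable : ∀ w φ, Integrable (I w φ)
  add : ∀ w φ ψ x, I w (φ + ψ) x = I w φ x + I w ψ x
  smul : ∀ w (b : ℂ) φ x, I w (b • φ) x = b * I w φ x
  comm : ∀ (m : R3 → ℂ), m.HasTemperateGrowth → ∀ w φ x, I (mulOp m w) φ x = I w (mulOp m φ) x
  bound : ∀ w φ, (∀ j, HasCompactSupport (w j)) → ‖∫ x, I w φ x‖ ≤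
    a * (gradNorm w * ‖emb φ‖ + ‖emb w‖ * gradNorm φ) + c * (‖emb w‖ * ‖emb φ‖)

theorem first_nonneg (w φ : Schwartz8) : 0 ≤ gradNorm w * ‖emb φ‖ + ‖emb w‖ * gradNorm φ :=
  add_nonneg (mul_nonneg (gradNorm_nonneg _) (Frame.norm_emb_nonneg _))
    (mul_nonneg (Frame.norm_emb_nonneg _) (gradNorm_nonneg _))

theorem zeroth_nonneg (w φ : Schwartz8) : 0 ≤ ‖emb w‖ * ‖emb φ‖ :=
  mul_nonneg (Frame.norm_emb_nonneg _) (Frame.norm_emb_nonneg _)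

namespace IsFirstOrder

variable {a a' c c' : ℝ} {I J : Schwartz8 → Schwartz8 → R3 → ℂ}

theorem firstOrder (h : IsFirstOrder a c I) : FirstOrder a c fun w φ => ∫ x, I w φ x where
  add w φ ψ := by
    rw [← integral_add (h.integrable _ _) (h.integrable _ _)]
    exact integral_congr_ae (.of_forall (h.add w φ ψ))
  smul w b φ := by
    rw [← integral_const_mul]
    exact integral_congr_ae (.of_forall (h.smul w b φ))
  comm m hm w φ := integral_congr_ae (.of_forall (h.comm m hm w φ))
  bound := h.bound

theorem mono (h : IsFirstOrder a c I) (ha : a ≤ a') (hc : c ≤ c') : IsFirstOrder a' c' I :=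
  { h with
    bound := fun w φ hw => (h.bound w φ hw).trans (add_le_add
      (mul_le_mul_of_nonneg_right ha (first_nonneg w φ))
      (mul_le_mul_of_nonneg_right hc (zeroth_nonneg w φ))) }

theorem sum_add (h : IsFirstOrder a c I) (h' : IsFirstOrder a' c' J) :
    IsFirstOrder (a + a') (c + c') fun w φ x => I w φ x + J w φ x where
  integrable w φ := (h.integrable w φ).add (h'.integrable w φ)
  add w φ ψ x := by rw [h.add, h'.add]; ring
  smul w b φ x := by rw [h.smul, h'.smul]; ring
  comm m hm w φ x := by rw [h.comm m hm, h'.comm m hm]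
  bound w φ hw := by
    rw [integral_add (h.integrable w φ) (h'.integrable w φ)]
    refine (norm_add_le _ _).trans ((add_le_add (h.bound w φ hw) (h'.bound w φ hw)).trans
      (le_of_eq ?_))
    ring

theorem neg (h : IsFirstOrder a c I) : IsFirstOrder a c fun w φ x => -I w φ x where
  integrable w φ := (h.integrable w φ).neg
  add w φ ψ x := by rw [h.add]; ring
  smul w b φ x := by rw [h.smul]; ring
  comm m hm w φ x := by rw [h.comm m hm]
  bound w φ hw := by rw [integral_neg, norm_neg]; exact h.bound w φ hw

theorem sum_sub (h : IsFirstOrder a c I) (h' : IsFirstOrder a' c' J) :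
    IsFirstOrder (a + a') (c + c') fun w φ x => I w φ x - J w φ x := by
  simpa only [sub_eq_add_neg] using h.sum_add h'.neg

theorem sum_fin_three {I : Fin 3 → Schwartz8 → Schwartz8 → R3 → ℂ}
    (h : ∀ i, IsFirstOrder a c (I i)) :
    IsFirstOrder (3 * a) (3 * c) fun w φ x => ∑ i, I i w φ x := by
  simp only [Fin.sum_univ_three]
  exact (((h 0).sum_add (h 1)).sum_add (h 2)).mono (by linarith) (by linarith)

end IsFirstOrder

theorem integral_norm_mul_le (f g : 𝓢(R3, ℂ)) :
    ∫ x, ‖f x * g x‖ ≤ ‖f.toLp 2 (volume : Measure R3)‖ * ‖g.toLp 2 (volume : Measure R3)‖ := by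
  have h := integral_mul_le_Lp_mul_Lq_of_nonneg (μ := (volume : Measure R3))
    Real.HolderConjugate.two_two
    (f := fun x => ‖f x‖) (g := fun x => ‖g x‖) (.of_forall fun _ => norm_nonneg _)
    (.of_forall fun _ => norm_nonneg _)
    (by simpa using (f.memLp 2 (volume : Measure R3)).norm)
    (by simpa using (g.memLp 2 (volume : Measure R3)).norm)
  have h2 : ∀ f : 𝓢(R3, ℂ), (∫ x, ‖f x‖ ^ (2 : ℝ)) ^ (1 / (2 : ℝ)) =
      ‖f.toLp 2 (volume : Measure R3)‖ := fun f => by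
    rw [← Real.sqrt_eq_rpow, ← Real.sqrt_sq (norm_nonneg (f.toLp 2 (volume : Measure R3))),
      norm_toLp_sq]
    simp
  rw [h2, h2] at h
  simpa only [norm_mul] using h

theorem norm_toLp_le (w : Schwartz8) (j : Fin 8) :
    ‖(w j).toLp 2 (volume : Measure R3)‖ ≤ ‖emb w‖ := by
  refine le_of_sq_le_sq ?_ (Frame.norm_emb_nonneg w)
  rw [norm_emb_sq]
  exact Finset.single_le_sum (f := fun j => ‖(w j).toLp 2 (volume : Measure R3)‖ ^ 2)
    (fun _ _ => sq_nonneg _) (Finset.mem_univ j)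

theorem norm_emb_dirOp_le (w : Schwartz8) (i : Fin 3) : ‖emb (dirOp (bv i) w)‖ ≤ gradNorm w :=
  Finset.single_le_sum (f := fun i => ‖emb (dirOp (bv i) w)‖)
    (fun _ _ => Frame.norm_emb_nonneg _) (Finset.mem_univ i)

theorem integral_norm_mul_comp_le (w φ : Schwartz8) (a b : Fin 8) :
    ∫ x, ‖w a x * φ b x‖ ≤ ‖emb w‖ * ‖emb φ‖ :=
  (integral_norm_mul_le _ _).trans (mul_le_mul (norm_toLp_le w a) (norm_toLp_le φ b)
    (norm_nonneg _) (Frame.norm_emb_nonneg w))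

theorem integrable_mul (f g : 𝓢(R3, ℂ)) : Integrable fun x => f x * g x :=
  MemLp.integrable_mul (p := 2) (q := 2) (f.memLp 2 (volume : Measure R3)) (g.memLp 2 volume)

/-- `∂ᵢ` of the product of two components. -/
def pdMul (i : Fin 3) (a b : Fin 8) (w φ : Schwartz8) (x : R3) : ℂ :=
  pd i (fun y => w a y * φ b y) x

theorem pdMul_eq (i : Fin 3) (a b : Fin 8) (w φ : Schwartz8) (x : R3) :
    pdMul i a b w φ x = dirOp (bv i) w a x * φ b x + w a x * dirOp (bv i) φ b x := by
  have h : HasFDerivAt (fun y => w a y * φ b y) _ x :=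
    ((w a).hasFDerivAt x).mul ((φ b).hasFDerivAt x)
  rw [pdMul, pd, h.fderiv]
  simp only [add_apply, smul_apply, smul_eq_mul, dirOp_apply_apply, bv]
  ring

theorem isFirstOrder_mul {f : R3 → ℂ} (hf : AEStronglyMeasurable f volume) {B : ℝ}
    (hB : ∀ᵐ x, ‖f x‖ ≤ B) (a b : Fin 8) :
    IsFirstOrder 0 B fun w φ x => f x * (w a x * φ b x) where
  integrable w φ := (integrable_mul (w a) (φ b)).bdd_mul hf hB
  add w φ ψ x := by simp only [Pi.add_apply, add_apply]; ring
  smul w z φ x := by simp only [Pi.smul_apply, smul_apply, smul_eq_mul]; ring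
  comm m hm w φ x := by simp only [mulOp_apply hm]; ring
  bound w φ _ := by
    rw [zero_mul, zero_add]
    have hB0 : 0 ≤ B := by
      obtain ⟨x, hx⟩ := hB.exists
      exact (norm_nonneg _).trans hx
    calc _ ≤ ∫ x, B * ‖w a x * φ b x‖ := by
          refine norm_integral_le_of_norm_le ((integrable_mul _ _).norm.const_mul B) ?_
          filter_upwards [hB] with x hx
          rw [norm_mul]
          exact mul_le_mul_of_nonneg_right hx (norm_nonneg _)
      _ ≤ _ := by
          rw [integral_const_mul]
          exact mul_le_mul_of_nonneg_left (integral_norm_mul_comp_le w φ a b) hB0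

theorem isFirstOrder_pdMul {f : R3 → ℂ} (hf : AEStronglyMeasurable f volume) {B : ℝ}
    (hB : ∀ᵐ x, ‖f x‖ ≤ B) (i : Fin 3) (a b : Fin 8) :
    IsFirstOrder B 0 fun w φ x => f x * pdMul i a b w φ x where
  integrable w φ := by
    simp only [pdMul_eq]
    exact ((integrable_mul _ _).add (integrable_mul _ _)).bdd_mul hf hB
  add w φ ψ x := by
    simp only [pdMul_eq, map_add, Pi.add_apply, add_apply]; ring
  smul w z φ x := by
    simp only [pdMul_eq, map_smul, Pi.smul_apply, smul_apply, smul_eq_mul]; ring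
  comm m hm w φ x := by
    have h : (fun y => mulOp m w a y * φ b y) = fun y => w a y * mulOp m φ b y :=
      funext fun y => by simp only [mulOp_apply hm]; ring
    simp only [pdMul, h]
  bound w φ _ := by
    rw [zero_mul, add_zero]
    have hB0 : 0 ≤ B := by
      obtain ⟨x, hx⟩ := hB.exists
      exact (norm_nonneg _).trans hx
    have i1 := (integrable_mul (dirOp (bv i) w a) (φ b)).norm
    have i2 := (integrable_mul (w a) (dirOp (bv i) φ b)).norm
    calc _ ≤ ∫ x, B * (‖dirOp (bv i) w a x * φ b x‖ + ‖w a x * dirOp (bv i) φ b x‖) := by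
          refine norm_integral_le_of_norm_le ((i1.add i2).const_mul B) ?_
          filter_upwards [hB] with x hx
          rw [norm_mul, pdMul_eq]
          exact mul_le_mul hx (norm_add_le _ _) (norm_nonneg _) hB0
      _ ≤ _ := by
          rw [integral_const_mul, integral_add i1 i2]
          refine mul_le_mul_of_nonneg_left (add_le_add ?_ ?_) hB0
          · exact (integral_norm_mul_comp_le _ _ a b).trans
              (mul_le_mul_of_nonneg_right (norm_emb_dirOp_le w i) (Frame.norm_emb_nonneg _))
          · exact (integral_norm_mul_comp_le _ _ a b).trans
              (mul_le_mul_of_nonneg_left (norm_emb_dirOp_le φ i) (Frame.norm_emb_nonneg _))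

/-! ### Integration by parts for Lipschitz coefficients -/

/-- Integration by parts against a Lipschitz function, for real functions. -/
theorem abs_integral_lipschitz_mul_lineDeriv_le {k f : R3 → ℝ} {L : ℝ≥0} (hk : LipschitzWith L k)
    (hf : ContDiff ℝ 1 f) (hc : HasCompactSupport f) (i : Fin 3) :
    |∫ x, k x * fderiv ℝ f x (bv i)| ≤ L * ∫ x, |f x| := by
  obtain ⟨D, hD⟩ := hf.lipschitzWith_of_hasCompactSupport hc (by simp)
  have h := LipschitzWith.integral_lineDeriv_mul_eq (μ := volume) hk hD hc (-bv i)
  have h1 : ∫ x, k x * fderiv ℝ f x (bv i) = ∫ x, lineDeriv ℝ k x (-bv i) * f x := by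
    rw [h]
    refine integral_congr_ae (.of_forall fun x => ?_)
    simp only [neg_neg]
    rw [(hf.differentiable one_ne_zero x).lineDeriv_eq_fderiv, mul_comm]
  rw [h1, ← integral_const_mul, ← Real.norm_eq_abs]
  refine norm_integral_le_of_norm_le
    ((hf.continuous.integrable_of_hasCompactSupport hc).abs.const_mul _) (.of_forall fun x => ?_)
  rw [norm_mul, Real.norm_eq_abs (f x)]
  refine mul_le_mul_of_nonneg_right ?_ (abs_nonneg _)
  have h2 := norm_lineDeriv_le_of_lipschitz ℝ hk (x₀ := x) (v := -bv i)
  simpa [bv] using h2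

/-- The factor 4 counts the real integrals obtained from the real and imaginary parts of k and f. -/
theorem norm_integral_lipschitz_mul_pd_le {k f : R3 → ℂ} {L : ℝ≥0} (hk : LipschitzWith L k)
    (hf : ContDiff ℝ 1 f) (hc : HasCompactSupport f) (i : Fin 3) :
    ‖∫ x, k x * pd i f x‖ ≤ 4 * L * ∫ x, ‖f x‖ := by
  have hre : LipschitzWith L fun x => (k x).re := by
    simpa using! (Complex.reCLM.lipschitzWith_of_opNorm_le (K := 1) (by simp)).comp hk
  have him : LipschitzWith L fun x => (k x).im := by
    simpa using! (Complex.imCLM.lipschitzWith_of_opNorm_le (K := 1) (by simp)).comp hk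
  have fre : ContDiff ℝ 1 fun x => (f x).re := Complex.reCLM.contDiff.comp hf
  have fim : ContDiff ℝ 1 fun x => (f x).im := Complex.imCLM.contDiff.comp hf
  have cre : HasCompactSupport fun x => (f x).re := hc.comp_left (g := Complex.re) rfl
  have cim : HasCompactSupport fun x => (f x).im := hc.comp_left (g := Complex.im) rfl
  have dre : ∀ x, fderiv ℝ (fun x => (f x).re) x (bv i) = (pd i f x).re := fun x => by
    have := Complex.reCLM.hasFDerivAt.comp x (hf.differentiable one_ne_zero x).hasFDerivAt
    have h2 : fderiv ℝ (fun x => (f x).re) x = Complex.reCLM ∘L fderiv ℝ f x := this.fderiv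
    rw [h2]; rfl
  have dim : ∀ x, fderiv ℝ (fun x => (f x).im) x (bv i) = (pd i f x).im := fun x => by
    have := Complex.imCLM.hasFDerivAt.comp x (hf.differentiable one_ne_zero x).hasFDerivAt
    have h2 : fderiv ℝ (fun x => (f x).im) x = Complex.imCLM ∘L fderiv ℝ f x := this.fderiv
    rw [h2]; rfl
  have cont : Continuous (pd i f) :=
    (hf.continuous_fderiv one_ne_zero).clm_apply continuous_const
  have csup : HasCompactSupport (pd i f) := by
    have h := (hc.fderiv (𝕜 := ℝ)).comp_left (g := fun l : R3 →L[ℝ] ℂ => l (bv i)) (by simp)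
    exact h
  have int : ∀ (k' : R3 → ℝ) (g : ℂ → ℝ), Continuous k' → Continuous g → g 0 = 0 →
      Integrable fun x => k' x * g (pd i f x) := fun k' g h1 h2 h3 =>
    (h1.mul (h2.comp cont)).integrable_of_hasCompactSupport ((csup.comp_left h3).mul_left)
  have intc : Integrable fun x => k x * pd i f x :=
    (hk.continuous.mul cont).integrable_of_hasCompactSupport csup.mul_left
  have hfi : Integrable fun x => ‖f x‖ :=
    (hf.continuous.integrable_of_hasCompactSupport hc).norm
  have bre : ∫ x, |(f x).re| ≤ ∫ x, ‖f x‖ :=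
    integral_mono (fre.continuous.integrable_of_hasCompactSupport cre).abs hfi
      fun x => Complex.abs_re_le_norm _
  have bim : ∫ x, |(f x).im| ≤ ∫ x, ‖f x‖ :=
    integral_mono (fim.continuous.integrable_of_hasCompactSupport cim).abs hfi
      fun x => Complex.abs_im_le_norm _
  have hL : (0 : ℝ) ≤ L := L.2
  have e1 := (abs_integral_lipschitz_mul_lineDeriv_le hre fre cre i).trans
    (mul_le_mul_of_nonneg_left bre hL)
  have e2 := (abs_integral_lipschitz_mul_lineDeriv_le hre fim cim i).trans
    (mul_le_mul_of_nonneg_left bim hL)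
  have e3 := (abs_integral_lipschitz_mul_lineDeriv_le him fre cre i).trans
    (mul_le_mul_of_nonneg_left bre hL)
  have e4 := (abs_integral_lipschitz_mul_lineDeriv_le him fim cim i).trans
    (mul_le_mul_of_nonneg_left bim hL)
  simp only [dre] at e1 e3
  simp only [dim] at e2 e4
  have i1 := int _ _ hre.continuous Complex.continuous_re rfl
  have i2 := int _ _ hre.continuous Complex.continuous_im rfl
  have i3 := int _ _ him.continuous Complex.continuous_re rfl
  have i4 := int _ _ him.continuous Complex.continuous_im rfl
  have r1 : (∫ x, k x * pd i f x).re =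
      (∫ x, (k x).re * (pd i f x).re) - ∫ x, (k x).im * (pd i f x).im := by
    rw [← integral_sub i1 i4]
    exact (Complex.reCLM.integral_comp_comm intc).symm
  have r2 : (∫ x, k x * pd i f x).im =
      (∫ x, (k x).re * (pd i f x).im) + ∫ x, (k x).im * (pd i f x).re := by
    rw [← integral_add i2 i3]
    exact (Complex.imCLM.integral_comp_comm intc).symm
  refine (Complex.norm_le_abs_re_add_abs_im _).trans ?_
  rw [r1, r2]
  have a1 := abs_sub (∫ x, (k x).re * (pd i f x).re) (∫ x, (k x).im * (pd i f x).im)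
  have a2 := abs_add_le (∫ x, (k x).re * (pd i f x).im) (∫ x, (k x).im * (pd i f x).re)
  linarith

/-- The derivative is thrown onto the coefficient, so the form has order zero. This keeps κ, which A
does not bound, out of the constant of the derivative terms. -/
theorem isFirstOrder_lipschitz_pdMul {k : R3 → ℂ} {L : ℝ≥0} (hk : LipschitzWith L k) {B : ℝ}
    (hB : ∀ x, ‖k x‖ ≤ B) (i : Fin 3) (a b : Fin 8) :
    IsFirstOrder 0 (4 * L) fun w φ x => k x * pdMul i a b w φ x :=
  { isFirstOrder_pdMul hk.continuous.aestronglyMeasurable (.of_forall hB) i a b with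
    bound := fun w φ hw => by
      rw [zero_mul, zero_add]
      refine (norm_integral_lipschitz_mul_pd_le hk
        (((w a).smooth 1).mul ((φ b).smooth 1)) ((hw a).mul_right) i).trans ?_
      exact mul_le_mul_of_nonneg_left (integral_norm_mul_comp_le w φ a b) (by positivity) }

/-! ### The weak potentials as bilinear forms of first order -/

/-- The indices of the components of `w₂`. -/
def ix2 (i : Fin 3) : Fin 8 := ![1, 2, 3] i

/-- The indices of the components of `w₃`. -/
def ix3 (i : Fin 3) : Fin 8 := ![4, 5, 6] i

/-- The integrand `c (w_s φ_s + w_v · φ_v)`. -/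
def potTerm (c : R3 → ℂ) (s : Fin 8) (v : Fin 3 → Fin 8) (w φ : Schwartz8) (x : R3) : ℂ :=
  c x * (w s x * φ s x) + ∑ j, c x * (w (v j) x * φ (v j) x)

/-- The integrand `d · (∇(w_s φ_s - w_v · φ_v) + ∇·(w_v φ_vᵀ + φ_v w_vᵀ))`. -/
def gradTerm (d : Fin 3 → R3 → ℂ) (s : Fin 8) (v : Fin 3 → Fin 8) (w φ : Schwartz8) (x : R3) : ℂ :=
  ∑ i, (d i x * pdMul i s s w φ x + ∑ j, (d i x * pdMul j (v i) (v j) w φ x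
    + d i x * pdMul j (v j) (v i) w φ x - d i x * pdMul i (v j) (v j) w φ x))

/-- The integrand `κ ∇·(w₁ φ₂ + w₂ φ₁ + w₃ φ₄ + w₄ φ₃)`. -/
def divTerm (κ : R3 → ℂ) (w φ : Schwartz8) (x : R3) : ℂ :=
  ∑ i, (κ x * pdMul i 0 (ix2 i) w φ x + κ x * pdMul i (ix2 i) 0 w φ x
    + κ x * pdMul i (ix3 i) 7 w φ x + κ x * pdMul i 7 (ix3 i) w φ x)

/-- The integrand `κ ∇·(w₃ ∧ φ₂ - w₂ ∧ φ₃)`. -/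
def crossTerm (κ : R3 → ℂ) (w φ : Schwartz8) (x : R3) : ℂ :=
  -- The indices i + 1 and i + 2 are modulo 3, which gives the cyclic form of the cross product.
  ∑ i, (κ x * pdMul i (ix3 (i + 1)) (ix2 (i + 2)) w φ x
    - κ x * pdMul i (ix3 (i + 2)) (ix2 (i + 1)) w φ x
    - (κ x * pdMul i (ix2 (i + 1)) (ix3 (i + 2)) w φ x
      - κ x * pdMul i (ix2 (i + 2)) (ix3 (i + 1)) w φ x))

theorem isFirstOrder_potTerm {c : R3 → ℂ} (hc : AEStronglyMeasurable c volume) {B : ℝ}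
    (hB : ∀ᵐ x, ‖c x‖ ≤ B) (s : Fin 8) (v : Fin 3 → Fin 8) :
    IsFirstOrder 0 (4 * B) (potTerm c s v) :=
  ((isFirstOrder_mul hc hB s s).sum_add
    (IsFirstOrder.sum_fin_three fun j => isFirstOrder_mul hc hB (v j) (v j))).mono
      (by linarith) (by linarith)

/-- The count is 30 = 3 · (1 + 3 · 3) elementary terms. -/
theorem isFirstOrder_gradTerm {d : Fin 3 → R3 → ℂ} (hd : ∀ i, AEStronglyMeasurable (d i) volume)
    {B : ℝ} (hB : ∀ i, ∀ᵐ x, ‖d i x‖ ≤ B) (s : Fin 8) (v : Fin 3 → Fin 8) :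
    IsFirstOrder (30 * B) 0 (gradTerm d s v) :=
  (IsFirstOrder.sum_fin_three fun i => (isFirstOrder_pdMul (hd i) (hB i) i s s).sum_add
    (IsFirstOrder.sum_fin_three fun j =>
      ((isFirstOrder_pdMul (hd i) (hB i) j (v i) (v j)).sum_add
        (isFirstOrder_pdMul (hd i) (hB i) j (v j) (v i))).sum_sub
          (isFirstOrder_pdMul (hd i) (hB i) i (v j) (v j)))).mono (by linarith) (by linarith)

/-- Here 48 = 3 · 4 · 4: three directions, four products, and the factor 4 from integration by
parts. -/
theorem isFirstOrder_divTerm {κ : R3 → ℂ} {L : ℝ≥0} (hκ : LipschitzWith L κ) {B : ℝ}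
    (hB : ∀ x, ‖κ x‖ ≤ B) : IsFirstOrder 0 (48 * L) (divTerm κ) :=
  (IsFirstOrder.sum_fin_three fun i =>
    (((isFirstOrder_lipschitz_pdMul hκ hB i 0 (ix2 i)).sum_add
      (isFirstOrder_lipschitz_pdMul hκ hB i (ix2 i) 0)).sum_add
        (isFirstOrder_lipschitz_pdMul hκ hB i (ix3 i) 7)).sum_add
          (isFirstOrder_lipschitz_pdMul hκ hB i 7 (ix3 i))).mono (by linarith) (by linarith)

theorem isFirstOrder_crossTerm {κ : R3 → ℂ} {L : ℝ≥0} (hκ : LipschitzWith L κ) {B : ℝ}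
    (hB : ∀ x, ‖κ x‖ ≤ B) : IsFirstOrder 0 (48 * L) (crossTerm κ) :=
  (IsFirstOrder.sum_fin_three fun i =>
    ((isFirstOrder_lipschitz_pdMul hκ hB i (ix3 (i + 1)) (ix2 (i + 2))).sum_sub
      (isFirstOrder_lipschitz_pdMul hκ hB i (ix3 (i + 2)) (ix2 (i + 1)))).sum_sub
        ((isFirstOrder_lipschitz_pdMul hκ hB i (ix2 (i + 1)) (ix3 (i + 2))).sum_sub
          (isFirstOrder_lipschitz_pdMul hκ hB i (ix2 (i + 2)) (ix3 (i + 1))))).mono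
      (by linarith) (by linarith)

theorem pd_add {f g : R3 → ℂ} (hf : Differentiable ℝ f) (hg : Differentiable ℝ g) (i : Fin 3)
    (x : R3) : pd i (fun y => f y + g y) x = pd i f x + pd i g x := by
  rw [pd, fderiv_fun_add (hf x) (hg x)]; rfl

theorem pd_sub {f g : R3 → ℂ} (hf : Differentiable ℝ f) (hg : Differentiable ℝ g) (i : Fin 3)
    (x : R3) : pd i (fun y => f y - g y) x = pd i f x - pd i g x := by
  rw [pd, fderiv_fun_sub (hf x) (hg x)]; rfl

theorem differentiable_schwartz (f : 𝓢(R3, ℂ)) : Differentiable ℝ f :=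
  (f.smooth 1).differentiable one_ne_zero

theorem differentiable_mul (w φ : Schwartz8) (a b : Fin 8) :
    Differentiable ℝ fun y => w a y * φ b y :=
  (differentiable_schwartz _).mul (differentiable_schwartz _)

theorem pd_mul (f g : 𝓢(R3, ℂ)) (i : Fin 3) (x : R3) :
    pd i (fun y => f y * g y) x = pd i f x * g x + f x * pd i g x := by
  rw [pd, fderiv_fun_mul (differentiable_schwartz f x) (differentiable_schwartz g x)]
  simp only [add_apply, smul_apply, smul_eq_mul, pd]
  ring

theorem gradTerm_eq₃ (d : R3 → C3) (c : ℂ) (w φ : Schwartz8) (x : R3) :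
    c * dot (d x) (grad (fun y => part1 w y * part1 φ y - dot (part3 w y) (part3 φ y)) x
      + divMat (symProd (part3 w) (part3 φ)) x) =
      gradTerm (fun i x => c * d x i) 0 ix3 w φ x := by
  have hd := fun a b => differentiable_mul w φ a b
  have hd' := fun a b => differentiable_mul φ w a b
  simp only [dot, grad, divMat, symProd, Pi.add_apply, Fin.sum_univ_three, Matrix.add_apply,
    Matrix.vecMulVec_apply, part1, part3, gradTerm, ix3, Matrix.cons_val_zero,
    Matrix.cons_val_one, Matrix.cons_val, pdMul]
  simp (disch := fun_prop) only [pd_add, pd_sub, pd_mul]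
  ring

theorem gradTerm_eq₂ (d : R3 → C3) (c : ℂ) (w φ : Schwartz8) (x : R3) :
    c * dot (d x) (grad (fun y => part4 w y * part4 φ y - dot (part2 w y) (part2 φ y)) x
      + divMat (symProd (part2 w) (part2 φ)) x) =
      gradTerm (fun i x => c * d x i) 7 ix2 w φ x := by
  have hd := fun a b => differentiable_mul w φ a b
  have hd' := fun a b => differentiable_mul φ w a b
  simp only [dot, grad, divMat, symProd, Pi.add_apply, Fin.sum_univ_three, Matrix.add_apply,
    Matrix.vecMulVec_apply, part4, part2, gradTerm, ix2, Matrix.cons_val_zero,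
    Matrix.cons_val_one, Matrix.cons_val, pdMul]
  simp (disch := fun_prop) only [pd_add, pd_sub, pd_mul]
  ring

theorem potTerm_eq₃ (c : R3 → ℂ) (w φ : Schwartz8) (x : R3) :
    c x * (part1 w x * part1 φ x + dot (part3 w x) (part3 φ x)) = potTerm c 0 ix3 w φ x := by
  simp only [dot, part1, part3, potTerm, ix3, Fin.sum_univ_three, Matrix.cons_val_zero,
    Matrix.cons_val_one, Matrix.cons_val]
  ring

theorem potTerm_eq₂ (c : R3 → ℂ) (w φ : Schwartz8) (x : R3) :
    c x * (part4 w x * part4 φ x + dot (part2 w x) (part2 φ x)) = potTerm c 7 ix2 w φ x := by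
  simp only [dot, part4, part2, potTerm, ix2, Fin.sum_univ_three, Matrix.cons_val_zero,
    Matrix.cons_val_one, Matrix.cons_val]
  ring

theorem divTerm_eq (κ : R3 → ℂ) (w φ : Schwartz8) (x : R3) :
    2 * Complex.I * κ x * div (fun y => part1 w y • part2 φ y + part1 φ y • part2 w y
      + part4 φ y • part3 w y + part4 w y • part3 φ y) x =
      divTerm (fun x => 2 * Complex.I * κ x) w φ x := by
  have hd := fun a b => differentiable_mul w φ a b
  have hd' := fun a b => differentiable_mul φ w a b
  simp only [div, divTerm, Fin.sum_univ_three, part1, part2, part3, part4, ix2, ix3,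
    Pi.add_apply, Pi.smul_apply, smul_eq_mul, Matrix.cons_val_zero,
    Matrix.cons_val_one, Matrix.cons_val, pdMul]
  simp (disch := fun_prop) only [pd_add, pd_mul]
  ring

theorem crossTerm_eq (κ : R3 → ℂ) (w φ : Schwartz8) (x : R3) :
    2 * Complex.I * κ x * div (fun y => crossProduct (part3 w y) (part2 φ y)
      - crossProduct (part2 w y) (part3 φ y)) x =
      crossTerm (fun x => 2 * Complex.I * κ x) w φ x := by
  have hd := fun a b => differentiable_mul w φ a b
  have hd' := fun a b => differentiable_mul φ w a b
  have h0 : (1 : Fin 3) + 2 = 0 := rfl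
  have h1 : (2 : Fin 3) + 1 = 0 := rfl
  have h2 : (2 : Fin 3) + 2 = 1 := rfl
  have h3 : (1 : Fin 3) + 1 = 2 := rfl
  simp only [div, crossTerm, Fin.sum_univ_three, part2, part3, ix2, ix3, cross_apply,
    Pi.sub_apply, Matrix.cons_val_zero, Matrix.cons_val_one, Matrix.cons_val, pdMul, zero_add,
    h0, h1, h2, h3]
  simp (disch := fun_prop) only [pd_sub, pd_mul]
  ring

theorem weakQ_eq (m : Medium) (w φ : Schwartz8) : weakQ m w φ = ∫ x,
    (potTerm (fun x => (1 / 4 : ℂ) * (dot (m.α x) (m.α x) - 4 * m.θ x)) 0 ix3 w φ x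
      - gradTerm (fun i x => (1 / 2 : ℂ) * m.α x i) 0 ix3 w φ x
      + potTerm (fun x => (1 / 4 : ℂ) * (dot (m.β x) (m.β x) - 4 * m.θ x)) 7 ix2 w φ x
      - gradTerm (fun i x => (1 / 2 : ℂ) * m.β x i) 7 ix2 w φ x
      - divTerm (fun x => 2 * Complex.I * m.κ x) w φ x) := by
  simp only [weakQ, ← gradTerm_eq₃, ← gradTerm_eq₂, ← potTerm_eq₃, ← potTerm_eq₂, ← divTerm_eq]

theorem weakQtilde_eq (m : Medium) (w φ : Schwartz8) : weakQtilde m w φ = ∫ x,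
    (potTerm (fun x => (1 / 4 : ℂ) * (dot (m.β x) (m.β x) - 4 * m.θ x)) 0 ix3 w φ x
      + gradTerm (fun i x => (1 / 2 : ℂ) * m.β x i) 0 ix3 w φ x
      + potTerm (fun x => (1 / 4 : ℂ) * (dot (m.α x) (m.α x) - 4 * m.θ x)) 7 ix2 w φ x
      + gradTerm (fun i x => (1 / 2 : ℂ) * m.α x i) 7 ix2 w φ x
      + crossTerm (fun x => 2 * Complex.I * m.κ x) w φ x) := by
  simp only [weakQtilde, ← gradTerm_eq₃, ← gradTerm_eq₂, ← potTerm_eq₃, ← potTerm_eq₂,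
    ← crossTerm_eq]

/-! ### Bounds for the coefficients -/

theorem exists_bound_of_const_outside {f : R3 → ℂ} (hf : Continuous f) {r : ℝ} {z : ℂ}
    (h : ∀ x, r ≤ ‖x‖ → f x = z) : ∃ B : ℝ, ∀ x, ‖f x‖ ≤ B := by
  obtain ⟨B, hB⟩ := (isCompact_closedBall (0 : R3) r).exists_bound_of_continuousOn hf.continuousOn
  refine ⟨max B ‖z‖, fun x => ?_⟩
  rcases le_total r ‖x‖ with hx | hx
  · rw [h x hx]; exact le_max_right _ _
  · exact (hB x (by simpa using hx)).trans (le_max_left _ _)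

theorem lipschitz_mul {f g : R3 → ℂ} {a b : ℝ≥0} {A B : ℝ} (hf : LipschitzWith a f)
    (hg : LipschitzWith b g) (hA : ∀ x, ‖f x‖ ≤ A) (hB : ∀ x, ‖g x‖ ≤ B) :
    ∃ c : ℝ≥0, LipschitzWith c fun x => f x * g x := by
  refine ⟨A.toNNReal * b + B.toNNReal * a, LipschitzWith.of_dist_le_mul fun x y => ?_⟩
  have hA0 : 0 ≤ A := (norm_nonneg _).trans (hA 0)
  have hB0 : 0 ≤ B := (norm_nonneg _).trans (hB 0)
  have h1 := hf.dist_le_mul x y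
  have h2 := hg.dist_le_mul x y
  rw [dist_eq_norm] at h1 h2 ⊢
  push_cast
  rw [Real.coe_toNNReal _ hA0, Real.coe_toNNReal _ hB0]
  calc ‖f x * g x - f y * g y‖ = ‖f x * (g x - g y) + g y * (f x - f y)‖ := by congr 1; ring
    _ ≤ ‖f x‖ * ‖g x - g y‖ + ‖g y‖ * ‖f x - f y‖ := by
        rw [← norm_mul, ← norm_mul]; exact norm_add_le _ _
    _ ≤ A * (b * dist x y) + B * (a * dist x y) := by gcongr <;> [exact hA x; exact hB y]
    _ = _ := by ring

/-- The half-plane is convex and avoids the branch cut, and the derivative z^{-1/2}/2 is bounded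
there. -/
theorem lipschitzOn_cpow_half {c : ℝ} (hc : 0 < c) :
    ∃ L : ℝ≥0, LipschitzOnWith L (fun z : ℂ => z ^ (1 / 2 : ℂ)) {z | c ≤ z.re} := by
  refine ⟨(1 / 2 * c ^ (-1 / 2 : ℝ)).toNNReal, ?_⟩
  refine Convex.lipschitzOnWith_of_nnnorm_deriv_le (𝕜 := ℂ) (fun z hz => ?_) (fun z hz => ?_)
    (convex_halfSpace_re_ge c)
  · exact ((hasDerivAt_id z).cpow_const (Or.inl (hc.trans_le hz))).differentiableAt
  · have hz0 : z ≠ 0 := fun h => by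
      have : c ≤ z.re := hz
      rw [h, Complex.zero_re] at this; linarith
    have hd : HasDerivAt (fun z : ℂ => z ^ (1 / 2 : ℂ)) _ z :=
      (hasDerivAt_id z).cpow_const (c := (1 / 2 : ℂ)) (Or.inl (hc.trans_le hz))
    rw [hd.deriv, id_eq, mul_one, ← NNReal.coe_le_coe, coe_nnnorm, Real.coe_toNNReal _ (by positivity), norm_mul]
    have h1 : (1 / 2 - 1 : ℂ) = ((-1 / 2 : ℝ) : ℂ) := by push_cast; norm_num
    rw [h1, Complex.norm_cpow_of_ne_zero hz0, Complex.ofReal_re, Complex.ofReal_im]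
    simp only [mul_zero, Real.exp_zero, div_one]
    have h2 : c ≤ ‖z‖ := le_trans hz ((le_abs_self _).trans (Complex.abs_re_le_norm z))
    have h3 : ‖z‖ ^ (-1 / 2 : ℝ) ≤ c ^ (-1 / 2 : ℝ) :=
      Real.rpow_le_rpow_of_nonpos hc h2 (by norm_num)
    have h4 : ‖(1 / 2 : ℂ)‖ = 1 / 2 := by norm_num
    rw [h4]
    gcongr

theorem measurable_gradLog (f : R3 → ℂ) (i : Fin 3) : Measurable fun x => gradLog f x i :=
  measurable_fderiv_apply_const ℝ _ _

theorem ae_norm_le_of_eLpNorm_lt {f : R3 → C3} {A : ℝ} (hA : 0 ≤ A)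
    (h : eLpNorm f ⊤ volume < ENNReal.ofReal A) : ∀ᵐ x, ‖f x‖ ≤ A := by
  rw [eLpNorm_exponent_top] at h
  filter_upwards [enorm_ae_le_eLpNormEssSup f volume] with x hx
  have := hx.trans h.le
  rwa [← ofReal_norm, ENNReal.ofReal_le_ofReal_iff hA] at this

theorem norm_dot_self_le (v : C3) : ‖dot v v‖ ≤ ‖v‖ ^ 2 := by
  rw [EuclideanSpace.norm_sq_eq]
  refine (norm_sum_le _ _).trans (Finset.sum_le_sum fun i _ => ?_)
  rw [norm_mul, sq]

namespace Medium

variable (m : Medium)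

theorem lipschitz_γ : ∃ c : ℝ≥0, LipschitzWith c m.γ := by
  obtain ⟨a, ha⟩ := m.ε_lip
  obtain ⟨b, hb⟩ := m.σ_lip
  have h1 : LipschitzWith a fun x => (m.ε x : ℂ) := by
    simpa using! (Complex.isometry_ofReal.lipschitz).comp ha
  have h2 : LipschitzWith b fun x => (m.σ x : ℂ) := by
    simpa using! (Complex.isometry_ofReal.lipschitz).comp hb
  have h3 : LipschitzWith (‖Complex.I / (m.ω : ℂ)‖₊ * b)
      fun x => Complex.I / (m.ω : ℂ) * (m.σ x : ℂ) := (lipschitzWith_smul _).comp h2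
  have h4 : m.γ = fun x => (m.ε x : ℂ) + Complex.I / (m.ω : ℂ) * (m.σ x : ℂ) := by
    funext x; rw [γ]; ring
  rw [h4]
  exact ⟨_, h1.add h3⟩

theorem lipschitz_μ : ∃ c : ℝ≥0, LipschitzWith c fun x => (m.μ x : ℂ) := by
  obtain ⟨a, ha⟩ := m.μ_lip
  exact ⟨a, by simpa using! (Complex.isometry_ofReal.lipschitz).comp ha⟩

theorem continuous_γ : Continuous m.γ := m.lipschitz_γ.choose_spec.continuous

theorem continuous_μ : Continuous fun x => (m.μ x : ℂ) := m.lipschitz_μ.choose_spec.continuous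

theorem μγ_outside : ∃ r : ℝ, ∀ x, r ≤ ‖x‖ →
    (m.μ x : ℂ) = m.μ₀ ∧ m.γ x = m.ε₀ := by
  obtain ⟨r, hr⟩ := m.const_outside
  refine ⟨r, fun x hx => ?_⟩
  obtain ⟨h1, h2, h3⟩ := hr x hx
  refine ⟨by rw [h2], ?_⟩
  rw [γ, h1, h3]; simp

theorem exists_bound_γ : ∃ B : ℝ, ∀ x, ‖m.γ x‖ ≤ B := by
  obtain ⟨r, hr⟩ := m.μγ_outside
  exact exists_bound_of_const_outside m.continuous_γ fun x hx => (hr x hx).2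

theorem exists_bound_μ : ∃ B : ℝ, ∀ x, ‖(m.μ x : ℂ)‖ ≤ B := by
  obtain ⟨r, hr⟩ := m.μγ_outside
  exact exists_bound_of_const_outside m.continuous_μ fun x hx => (hr x hx).1

theorem re_μγ (x : R3) : ((m.μ x : ℂ) * m.γ x).re = m.μ x * m.ε x := by
  rw [γ]
  simp [Complex.div_re, Complex.normSq_apply]

/-- The real part is με, as σ contributes only to the imaginary part. Its reciprocal is continuous
and constant outside a ball, hence bounded, so the principal root defining κ is taken in a
half-plane where it is Lipschitz. -/
theorem exists_le_re_μγ : ∃ c : ℝ, 0 < c ∧ ∀ x, c ≤ ((m.μ x : ℂ) * m.γ x).re := by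
  obtain ⟨r, hr⟩ := m.const_outside
  obtain ⟨a, ha⟩ := m.ε_lip
  have hpos : ∀ x, 0 < m.μ x * m.ε x := fun x => mul_pos (m.μ_pos x) (m.ε_pos x)
  have hcont : Continuous fun x => (((m.μ x * m.ε x)⁻¹ : ℝ) : ℂ) :=
    Complex.continuous_ofReal.comp
      (((m.μ_lip.choose_spec.continuous).mul ha.continuous).inv₀ fun x => (hpos x).ne')
  obtain ⟨B, hB⟩ := exists_bound_of_const_outside hcont (r := r)
    (z := (((m.μ₀ * m.ε₀)⁻¹ : ℝ) : ℂ)) fun x hx => by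
      obtain ⟨h1, h2, -⟩ := hr x hx
      rw [h1, h2]
  have hB' : ∀ x, (m.μ x * m.ε x)⁻¹ ≤ B := fun x => by
    have := hB x
    rwa [Complex.norm_real, Real.norm_of_nonneg (inv_nonneg.2 (hpos x).le)] at this
  have hB0 : 0 < B := (inv_pos.2 (hpos 0)).trans_le (hB' 0)
  refine ⟨B⁻¹, inv_pos.2 hB0, fun x => ?_⟩
  rw [re_μγ]
  exact inv_le_of_inv_le₀ (hpos x) (hB' x)

theorem exists_κ_bounds : ∃ (L : ℝ≥0) (B : ℝ), LipschitzWith L (fun x => 2 * Complex.I * m.κ x) ∧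
    ∀ x, ‖2 * Complex.I * m.κ x‖ ≤ B := by
  obtain ⟨a, ha⟩ := m.lipschitz_γ
  obtain ⟨b, hb⟩ := m.lipschitz_μ
  obtain ⟨A, hA⟩ := m.exists_bound_γ
  obtain ⟨B, hB⟩ := m.exists_bound_μ
  obtain ⟨c, hc, hre⟩ := m.exists_le_re_μγ
  obtain ⟨L, hL⟩ := lipschitzOn_cpow_half hc
  obtain ⟨l, hl⟩ := lipschitz_mul hb ha hB hA
  have h1 : LipschitzWith (L * l) fun x => ((m.μ x : ℂ) * m.γ x) ^ (1 / 2 : ℂ) :=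
    lipschitzOnWith_univ.1 (hL.comp (lipschitzOnWith_univ.2 hl) fun x _ => hre x)
  have h2 : LipschitzWith (‖2 * Complex.I * (m.ω : ℂ)‖₊ * (L * l))
      fun x => 2 * Complex.I * m.κ x := by
    have := (lipschitzWith_smul (2 * Complex.I * (m.ω : ℂ))).comp h1
    have h3 : (fun x => 2 * Complex.I * m.κ x) = fun x => (2 * Complex.I * (m.ω : ℂ)) •
        ((m.μ x : ℂ) * m.γ x) ^ (1 / 2 : ℂ) := by
      funext x; rw [κ, smul_eq_mul]; ring
    rw [h3]; exact this
  obtain ⟨r, hr⟩ := m.μγ_outside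
  obtain ⟨B', hB'⟩ := exists_bound_of_const_outside h2.continuous (r := r) fun x hx => by
    obtain ⟨h3, h4⟩ := hr x hx
    rw [κ, h3, h4]
  exact ⟨_, B', h2, hB'⟩

theorem continuous_θ : Continuous m.θ :=
  continuous_const.mul ((m.continuous_γ.mul m.continuous_μ).sub continuous_const)

theorem exists_bound_θ : ∃ B : ℝ, ∀ x, ‖m.θ x‖ ≤ B := by
  obtain ⟨r, hr⟩ := m.μγ_outside
  refine exists_bound_of_const_outside m.continuous_θ (r := r)
    (z := (m.ω : ℂ) ^ 2 * ((m.ε₀ : ℂ) * m.μ₀ - m.ε₀ * m.μ₀)) fun x hx => ?_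
  obtain ⟨h3, h4⟩ := hr x hx
  rw [θ, h3, h4]

theorem measurable_θ : Measurable m.θ := m.continuous_θ.measurable

end Medium

/-- A zeroth order term with coefficient `(δ·δ - 4θ)/4`. -/
theorem isFirstOrder_pot {δ : R3 → C3} (hδ : ∀ i, Measurable fun x => δ x i) {θ : R3 → ℂ}
    (hθ : Measurable θ) {A B : ℝ} (hA : ∀ᵐ x, ‖δ x‖ ≤ A) (hB : ∀ x, ‖θ x‖ ≤ B) (s : Fin 8)
    (v : Fin 3 → Fin 8) :
    IsFirstOrder 0 (4 * (1 / 4 * (A ^ 2 + 4 * B)))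
      (potTerm (fun x => (1 / 4 : ℂ) * (dot (δ x) (δ x) - 4 * θ x)) s v) := by
  refine isFirstOrder_potTerm ?_ ?_ s v
  · refine Measurable.aestronglyMeasurable (measurable_const.mul (Measurable.sub ?_ (by fun_prop)))
    exact Finset.measurable_sum _ fun i _ => (hδ i).mul (hδ i)
  · filter_upwards [hA] with x hx
    have h1 : ‖(1 / 4 : ℂ)‖ = 1 / 4 := by norm_num
    rw [norm_mul, h1]
    refine mul_le_mul_of_nonneg_left ((norm_sub_le _ _).trans (add_le_add ?_ ?_)) (by norm_num)
    · exact (norm_dot_self_le _).trans (pow_le_pow_left₀ (norm_nonneg _) hx 2)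
    · rw [norm_mul, Complex.norm_ofNat]
      exact mul_le_mul_of_nonneg_left (hB x) (by norm_num)

/-- A first order term with coefficient `δ/2`. -/
theorem isFirstOrder_grad {δ : R3 → C3} (hδ : ∀ i, Measurable fun x => δ x i) {A : ℝ}
    (hA : ∀ᵐ x, ‖δ x‖ ≤ A) (s : Fin 8) (v : Fin 3 → Fin 8) :
    IsFirstOrder (30 * (1 / 2 * A)) 0 (gradTerm (fun i x => (1 / 2 : ℂ) * δ x i) s v) := by
  refine isFirstOrder_gradTerm (fun i => ?_) (fun i => ?_) s v
  · exact (measurable_const.mul (hδ i)).aestronglyMeasurable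
  · filter_upwards [hA] with x hx
    have h1 : ‖(1 / 2 : ℂ)‖ = 1 / 2 := by norm_num
    rw [norm_mul, h1]
    exact mul_le_mul_of_nonneg_left ((PiLp.norm_apply_le _ _).trans hx) (by norm_num)

/-- The weak potentials are of first order; the constant of the derivative terms depends only on
the bound for `α` and `β`. -/
theorem exists_firstOrder (m : Medium) {A : ℝ} (hA : 0 ≤ A)
    (hα : eLpNorm m.α ⊤ volume < ENNReal.ofReal A) (hβ : eLpNorm m.β ⊤ volume < ENNReal.ofReal A) :
    ∃ c : ℝ, 0 ≤ c ∧ FirstOrder (30 * A) c (weakQ m) ∧ FirstOrder (30 * A) c (weakQtilde m) := by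
  obtain ⟨L, B', hL, hB'⟩ := m.exists_κ_bounds
  obtain ⟨B, hB⟩ := m.exists_bound_θ
  have hB0 : 0 ≤ B := (norm_nonneg _).trans (hB 0)
  have mα : ∀ i, Measurable fun x => m.α x i := measurable_gradLog _
  have mβ : ∀ i, Measurable fun x => m.β x i := measurable_gradLog _
  have aα := ae_norm_le_of_eLpNorm_lt hA hα
  have aβ := ae_norm_le_of_eLpNorm_lt hA hβ
  -- Each zeroth-order term contributes A² + 4B with B a bound for θ, the term with κ contributes
  -- 48L, and the two derivative terms give 2 · 30 · A/2 = 30A.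
  refine ⟨2 * (A ^ 2 + 4 * B) + 48 * L, by positivity, ?_, ?_⟩
  · have h := ((((isFirstOrder_pot mα m.measurable_θ aα hB 0 ix3).sum_sub
      (isFirstOrder_grad mα aα 0 ix3)).sum_add
      (isFirstOrder_pot mβ m.measurable_θ aβ hB 7 ix2)).sum_sub
      (isFirstOrder_grad mβ aβ 7 ix2)).sum_sub (isFirstOrder_divTerm hL hB')
    have h2 := (h.mono (a' := 30 * A) (c' := 2 * (A ^ 2 + 4 * B) + 48 * L)
      (by linarith) (by linarith)).firstOrder
    have h3 : weakQ m = _ := funext fun w => funext fun φ => weakQ_eq m w φ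
    rw [h3]; exact h2
  · have h := ((((isFirstOrder_pot mβ m.measurable_θ aβ hB 0 ix3).sum_add
      (isFirstOrder_grad mβ aβ 0 ix3)).sum_add
      (isFirstOrder_pot mα m.measurable_θ aα hB 7 ix2)).sum_add
      (isFirstOrder_grad mα aα 7 ix2)).sum_add (isFirstOrder_crossTerm hL hB')
    have h2 := (h.mono (a' := 30 * A) (c' := 2 * (A ^ 2 + 4 * B) + 48 * L)
      (by linarith) (by linarith)).firstOrder
    have h3 : weakQtilde m = _ := funext fun w => funext fun φ => weakQtilde_eq m w φ
    rw [h3]; exact h2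

/-- Both parts are bounded by the H¹ norm of the test function: the free part because it is pairing
with a Schwartz function, the potential by `FirstOrder.bound`. -/
theorem xNorm_freeOp_add_lt_top {ζ : C3} (hζ : 0 < ‖ζ‖) {a c : ℝ} (ha : 0 ≤ a) (hc : 0 ≤ c)
    {q : Schwartz8 → Functional8} (hq : FirstOrder a c q) {u : Schwartz8}
    (hu : ∀ j, HasCompactSupport (u j)) : xNorm ζ (-1 / 2) (freeOp ζ u + q u) < ⊤ := by
  have hfree : ∀ φ, freeOp ζ u φ = inner ℂ (emb (conj8 φ)) (emb (freeS ζ u)) := fun φ => by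
    rw [freeOp_eq, inner_emb]
    simp only [conj8_apply, Complex.conj_conj]
  have hadd : ∀ φ ψ, freeOp ζ u (φ + ψ) = freeOp ζ u φ + freeOp ζ u ψ := fun φ ψ => by
    have : conj8 (φ + ψ) = conj8 φ + conj8 ψ := by
      funext j; ext x; simp [conj8]
    rw [hfree, hfree, hfree, this, map_add, inner_add_left]
  have hsmul : ∀ (b : ℂ) φ, freeOp ζ u (b • φ) = b * freeOp ζ u φ := fun b φ => by
    have : conj8 (b • φ) = starRingEnd ℂ b • conj8 φ := by
      funext j; ext x; simp [conj8]
    rw [hfree, hfree, this, map_smul, inner_smul_left, Complex.conj_conj]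
  have n1 := Frame.norm_emb_nonneg (freeS ζ u)
  have n2 := Frame.norm_emb_nonneg u
  have n3 := gradNorm_nonneg u
  refine xNorm_lt_top hζ (B := ‖emb (freeS ζ u)‖ + a * (gradNorm u + ‖emb u‖) + c * ‖emb u‖)
    (fun φ ψ => ?_) (fun b φ => ?_) (by positivity) (fun φ => ?_)
  · simp only [Pi.add_apply, hadd, hq.add]; ring
  · simp only [Pi.add_apply, hsmul, hq.smul]; ring
  · have h1 : ‖freeOp ζ u φ‖ ≤ ‖emb φ‖ * ‖emb (freeS ζ u)‖ := by
      rw [hfree, ← norm_emb_conj8 φ]; exact norm_inner_le_norm _ _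
    have h2 := hq.bound u φ hu
    have n4 := Frame.norm_emb_nonneg φ
    have n5 := gradNorm_nonneg φ
    refine (norm_add_le _ _).trans ((add_le_add h1 h2).trans ?_)
    have p1 := mul_nonneg n1 n5
    have p2 := mul_nonneg ha (mul_nonneg n3 n5)
    have p3 := mul_nonneg ha (mul_nonneg n2 n4)
    have p4 := mul_nonneg hc (mul_nonneg n2 n5)
    nlinarith

/-- The constraints give ‖ζ‖² = 2τ² + k². A lower bound on ‖ζ‖ thus forces τ to be large and k² ≤
τ², hence |Im ζ|² = τ² + k² ≤ 2τ². -/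
theorem frame_of_large {ζ : C3} {τ k τ₀ : ℝ} (hτ : 0 < τ)
    (h1 : inner ℝ (reVec ζ) (imVec ζ) = 0) (h2 : ‖reVec ζ‖ ^ 2 = τ ^ 2)
    (h3 : τ ^ 2 = ‖imVec ζ‖ ^ 2 - k ^ 2) (hζ : 2 * (|k| + |τ₀| + 1) ≤ ‖ζ‖) :
    Frame ζ (τ⁻¹ • reVec ζ) τ ∧ τ₀ ≤ τ := by
  have hn : ‖ζ‖ ^ 2 = 2 * τ ^ 2 + k ^ 2 := by rw [norm_sq_eq_re_im]; linarith
  have hre : ‖reVec ζ‖ = τ := by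
    rw [← Real.sqrt_sq (norm_nonneg (reVec ζ)), h2, Real.sqrt_sq hτ.le]
  have hbig : |k| + |τ₀| + 1 ≤ τ := by
    refine le_of_sq_le_sq ?_ hτ.le
    have h4 : (2 * (|k| + |τ₀| + 1)) ^ 2 ≤ ‖ζ‖ ^ 2 := pow_le_pow_left₀ (by positivity) hζ 2
    rw [hn] at h4
    nlinarith [sq_abs k, abs_nonneg k, abs_nonneg τ₀]
  have hk := abs_nonneg k
  have ht := abs_nonneg τ₀
  refine ⟨⟨?_, by linarith, ?_, ?_, ?_⟩, by linarith [le_abs_self τ₀]⟩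
  · rw [norm_smul, hre, norm_inv, Real.norm_of_nonneg hτ.le, inv_mul_cancel₀ hτ.ne']
  · rw [smul_inv_smul₀ hτ.ne']
  · rw [inner_smul_left, h1, mul_zero]
  · have : k ^ 2 ≤ τ ^ 2 := by
      rw [← sq_abs]; exact pow_le_pow_left₀ hk (by linarith) 2
    linarith

end

end Maxwell

/-! ### The main theorem -/

theorem mainTheorem2 :
    ∃ C : ℝ, 0 < C ∧
      ∀ A R : ℝ, 1 < A → 0 < R →
        ∃ K : ℝ≥0,
          ∀ m : Maxwell.Medium,
            eLpNorm m.α ⊤ volume < ENNReal.ofReal A →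
            eLpNorm m.β ⊤ volume < ENNReal.ofReal A →
            ∃ Z₀ : ℝ,
              ∀ (ζ : Maxwell.C3) (τ : ℝ),
                inner ℝ (Maxwell.reVec ζ) (Maxwell.imVec ζ) = 0 →
                ‖Maxwell.reVec ζ‖ ^ 2 = τ ^ 2 →
                τ ^ 2 = ‖Maxwell.imVec ζ‖ ^ 2 - m.k ^ 2 →
                C * R ^ 3 * A ^ 4 < τ →
                Z₀ ≤ ‖ζ‖ →
                ∀ u : Maxwell.Schwartz8,
                  (∀ j, tsupport (u j) ⊆ Metric.ball 0 R) →
                  (Maxwell.xNorm ζ (-1 / 2)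
                      (Maxwell.freeOp ζ u + Maxwell.weakQ m u) < ⊤ ∧
                    Maxwell.xNorm ζ (1 / 2) (Maxwell.ofSchwartz u) ≤
                      K * Maxwell.xNorm ζ (-1 / 2)
                        (Maxwell.freeOp ζ u + Maxwell.weakQ m u)) ∧
                  (Maxwell.xNorm ζ (-1 / 2)
                      (Maxwell.freeOp ζ u + Maxwell.weakQtilde m u) < ⊤ ∧
                    Maxwell.xNorm ζ (1 / 2) (Maxwell.ofSchwartz u) ≤
                      K * Maxwell.xNorm ζ (-1 / 2)
                        (Maxwell.freeOp ζ u + Maxwell.weakQtilde m u)) := by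
  -- The lower bound for τ serves only to make τ positive, so C = 1 will do; the size of τ comes
  -- from Z₀.
  refine ⟨1, one_pos, fun A R hA hR => ?_⟩
  have ha : 0 ≤ 30 * A := by linarith
  obtain ⟨K₀, hK₀, hmain⟩ := Maxwell.exists_apriori (30 * A) R ha hR
  refine ⟨K₀.toNNReal, fun m hα hβ => ?_⟩
  obtain ⟨c, hc, hQ, hQt⟩ := Maxwell.exists_firstOrder m (by linarith) hα hβ
  obtain ⟨τ₀, hτ₀⟩ := hmain c hc
  -- Here the medium enters, through k and through the threshold τ₀ determined by its constant c.
  refine ⟨2 * (|m.k| + |τ₀| + 1), fun ζ τ h1 h2 h3 h4 h5 u hu => ?_⟩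
  have hτ : 0 < τ := lt_trans (by positivity) h4
  obtain ⟨F, hle⟩ := Maxwell.frame_of_large hτ h1 h2 h3 h5
  have hζ : 0 < ‖ζ‖ := lt_of_lt_of_le (by positivity) h5
  obtain ⟨W, hW, hWle, hest⟩ := hτ₀ ζ _ τ F hle
  have hcs : ∀ j, HasCompactSupport (u j) := fun j =>
    (isCompact_closedBall (0 : Maxwell.R3) R).of_isClosed_subset (isClosed_tsupport _)
      ((hu j).trans Metric.ball_subset_closedBall)
  exact ⟨⟨Maxwell.xNorm_freeOp_add_lt_top hζ ha hc hQ hcs,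
      Maxwell.xNorm_le_of_dual hζ hW hWle hK₀ (hest _ hQ u hu)⟩,
    ⟨Maxwell.xNorm_freeOp_add_lt_top hζ ha hc hQt hcs,
      Maxwell.xNorm_le_of_dual hζ hW hWle hK₀ (hest _ hQt u hu)⟩⟩
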